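/- For a finite graph $G=(V,E)$ let $Z_G(\vec x)=\sum_{I}\prod_{v\in I}x_v$ be its independence polynomial (the sum is over all independent sets $I\subseteq V$), and let $\lambda_G=\min\{|w| : w\in\mathbb C,\ Z_G(w\vec 1)=0\}$. For integers $d\ge 2$ put $\lambda'_c(d)=\frac{(d-1)^{d-1}}{d^d}$ and $\lambda_c(d)=\frac{(d-1)^{d-1}}{(d-2)^d}$, with $\lambda_c(2)=+\infty$. A number $w\in\mathbb C$ is a $(1+\epsilon)$-approximation to $Z$ if $|w-Z|\le\epsilon|Z|$. Running time is the number of elementary operations of a real random-access machine: a deterministic machine with integer and real memory cells, indirect addressing, addition, subtraction and comparison of integers, and exact field operations and comparisons of real numbers, all at unit cost; complex numbers are given as pairs of real numbers and a graph by its adjacency matrix. There are a deterministic algorithm $\mathcal A$ and an absolute constant $C>0$ such that, on input $(G,z,\epsilon,\alpha)$, the following hold. 1. Let $d\ge 2$, let $G$ be a graph with $n\ge 1$ vertices, all of degree at most $d$, let $\alpha,\epsilon\in(0,1]$, and let $z\in\mathbb C$ satisfy $(1+\alpha)|z|\le\lambda_G$. Then $\mathcal A$ outputs a $(1+\epsilon)$-approximation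 to $Z_G(z\vec 1)$ in time at most $$C\left(\frac{n}{\epsilon\alpha}\right)^{C\log(d)/\sqrt{\alpha}} .$$ 2. In particular, the same algorithm works on the real interval $(-\lambda'_c(d),\lambda_c(d))$: for every $d\ge 2$ and every real $x$ with $-\lambda'_c(d)<x<\lambda_c(d)$ there is an $\alpha\in(0,1]$, depending only on $d$ and $x$, such that for every $\epsilon\in(0,1]$ and every graph $G$ with $n\ge 1$ vertices, all of degree at most $d$, the algorithm $\mathcal A$ on input $(G,x,\epsilon,\alpha)$ outputs a $(1+\epsilon)$-approximation to $Z_G(x\vec 1)$ in time at most $C\left(\frac{n}{\epsilon\alpha}\right)^{C\log(d)/\sqrt{\alpha}}$, which is polynomial in $n$ and $1/\epsilon$ for fixed $d$ and $x$. -/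

import Mathlib

/-! ### The independence polynomial and its thresholds -/

open Classical in
/-- The multivariate independence polynomial
`Z_G(x) = ∑_{I independent in G} ∏_{v ∈ I} x_v`. -/
noncomputable def indepPoly {V : Type*} [Fintype V] (G : SimpleGraph V) (x : V → ℂ) : ℂ :=
  ∑ I ∈ Finset.univ.filter (fun I : Finset V => G.IsIndepSet (I : Set V)), ∏ v ∈ I, x v

/-- `λ_G`: the smallest modulus of a complex root of `z ↦ Z_G(z·1)`. -/
noncomputable def lambdaG {V : Type*} [Fintype V] (G : SimpleGraph V) : ℝ :=
  sInf {r : ℝ | ∃ z : ℂ, indepPoly G (fun _ => z) = 0 ∧ r = ‖z‖}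

/-- If `G` has a vertex then the set in the definition of `λ_G` really has a least element. -/
theorem lambdaG_isLeast {V : Type*} [Fintype V] [Nonempty V] (G : SimpleGraph V) :
    IsLeast {r : ℝ | ∃ z : ℂ, indepPoly G (fun _ => z) = 0 ∧ r = ‖z‖} (lambdaG G) := by
  classical
  let p : Polynomial ℂ :=
    ∑ I ∈ Finset.univ.filter (fun I : Finset V => G.IsIndepSet (I : Set V)),
      Polynomial.X ^ I.card
  have hp : ∀ z : ℂ, p.eval z = indepPoly G (fun _ => z) := by
    intro z
    simp only [p, indepPoly, Polynomial.eval_finsetSum, Polynomial.eval_pow,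
      Polynomial.eval_X, Finset.prod_const]
  have hcoeff : p.coeff 1 ≠ 0 := by
    have h1 : p.coeff 1 = ((((Finset.univ.filter
        (fun I : Finset V => G.IsIndepSet (I : Set V))).filter
          (fun I => 1 = I.card)).card : ℕ) : ℂ) := by
      simp [p, Polynomial.coeff_X_pow]
    rw [h1, Nat.cast_ne_zero]
    obtain ⟨v⟩ := ‹Nonempty V›
    refine Finset.card_ne_zero_of_mem (a := {v}) ?_
    simp [SimpleGraph.isIndepSet_iff]
  have hp0 : p ≠ 0 := by
    intro h
    simp [h] at hcoeff
  have hdeg : p.degree ≠ 0 := by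
    intro h
    rw [Polynomial.eq_C_of_degree_eq_zero h] at hcoeff
    simp at hcoeff
  have hset : {r : ℝ | ∃ z : ℂ, indepPoly G (fun _ => z) = 0 ∧ r = ‖z‖}
      = (fun z : ℂ => ‖z‖) '' (p.rootSet ℂ) := by
    ext r
    constructor
    · rintro ⟨z, hz, rfl⟩
      refine ⟨z, ?_, rfl⟩
      rw [Polynomial.mem_rootSet]
      exact ⟨hp0, by rw [Polynomial.coe_aeval_eq_eval, hp, hz]⟩
    · rintro ⟨z, hz, rfl⟩
      rw [Polynomial.mem_rootSet, Polynomial.coe_aeval_eq_eval, hp] at hz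
      exact ⟨z, hz.2, rfl⟩
  have hfin : {r : ℝ | ∃ z : ℂ, indepPoly G (fun _ => z) = 0 ∧ r = ‖z‖}.Finite := by
    rw [hset]
    exact (p.rootSet_finite ℂ).image _
  have hne : {r : ℝ | ∃ z : ℂ, indepPoly G (fun _ => z) = 0 ∧ r = ‖z‖}.Nonempty := by
    obtain ⟨z, hz⟩ := IsAlgClosed.exists_root p hdeg
    exact ⟨‖z‖, z, by rw [← hp]; exact hz, rfl⟩
  exact ⟨hne.csInf_mem hfin, fun r hr => csInf_le hfin.bddBelow hr⟩

/-- `λ'_c(d) = (d-1)^(d-1) / d^d`, for `d ≥ 2`. -/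
noncomputable def lambdaC' (d : ℕ) : ℝ :=
  ((d : ℝ) - 1) ^ (d - 1) / (d : ℝ) ^ d

/-- `λ_c(d) = (d-1)^(d-1) / (d-2)^d`, for `d ≥ 2`; in particular `λ_c(2) = 1 / 0 = ∞`. -/
noncomputable def lambdaC (d : ℕ) : ENNReal :=
  ((d : ENNReal) - 1) ^ (d - 1) / ((d : ENNReal) - 2) ^ d

/-! ### The computation model: a deterministic real random-access machine

The memory consists of named arrays of natural numbers and named arrays of real numbers. A program
is a structured (while-)program over this memory. On natural numbers only addition, truncated
subtraction and comparison are available (no multiplication); on real numbers there are the four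
field operations and comparison, exactly, at unit cost (no rounding, no conversion of reals to
naturals), and the only constants are natural numbers. A program is a fixed finite object and
contains no information on the input. -/

/-- A memory state: `s.nat a i` and `s.real a i` are the `i`-th cells of the `a`-th arrays. -/
structure RamState where
  nat : ℕ → ℕ → ℕ
  real : ℕ → ℕ → ℝ

/-- Expressions with natural number values; `get a i` is the `i`-th cell of the array `a`. -/
inductive NatExpr where
  | lit (k : ℕ)
  | get (a : ℕ) (i : NatExpr)
  | add (e f : NatExpr)
  | sub (e f : NatExpr)

/-- Expressions with real values; `get a i` is the `i`-th cell of the array `a`. -/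
inductive RealExpr where
  | ofNat (e : NatExpr)
  | get (a : ℕ) (i : NatExpr)
  | add (e f : RealExpr)
  | sub (e f : RealExpr)
  | mul (e f : RealExpr)
  | div (e f : RealExpr)

/-- Tests. -/
inductive RamTest where
  | natLe (e f : NatExpr)
  | realLe (e f : RealExpr)
  | neg (b : RamTest)
  | conj (b c : RamTest)

/-- Programs. -/
inductive RamProg where
  | skip
  | setNat (a : ℕ) (i : NatExpr) (e : NatExpr)
  | setReal (a : ℕ) (i : NatExpr) (e : RealExpr)
  | seq (p q : RamProg)
  | ite (b : RamTest) (p q : RamProg)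
  | loop (b : RamTest) (p : RamProg)

def NatExpr.eval (s : RamState) : NatExpr → ℕ
  | .lit k => k
  | .get a i => s.nat a (i.eval s)
  | .add e f => e.eval s + f.eval s
  | .sub e f => e.eval s - f.eval s

/-- Division by zero yields zero; as programs can compare with zero, this is immaterial. -/
noncomputable def RealExpr.eval (s : RamState) : RealExpr → ℝ
  | .ofNat e => (e.eval s : ℝ)
  | .get a i => s.real a (i.eval s)
  | .add e f => e.eval s + f.eval s
  | .sub e f => e.eval s - f.eval s
  | .mul e f => e.eval s * f.eval s
  | .div e f => e.eval s / f.eval s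

def RamTest.holds (s : RamState) : RamTest → Prop
  | .natLe e f => e.eval s ≤ f.eval s
  | .realLe e f => e.eval s ≤ f.eval s
  | .neg b => ¬ b.holds s
  | .conj b c => b.holds s ∧ c.holds s

/-- Number of operations in the evaluation of an expression. -/
def NatExpr.cost : NatExpr → ℕ
  | .lit _ => 1
  | .get _ i => i.cost + 1
  | .add e f => e.cost + f.cost + 1
  | .sub e f => e.cost + f.cost + 1

/-- Number of operations in the evaluation of an expression. -/
def RealExpr.cost : RealExpr → ℕ
  | .ofNat e => e.cost + 1
  | .get _ i => i.cost + 1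
  | .add e f => e.cost + f.cost + 1
  | .sub e f => e.cost + f.cost + 1
  | .mul e f => e.cost + f.cost + 1
  | .div e f => e.cost + f.cost + 1

/-- Number of operations in the evaluation of a test. -/
def RamTest.cost : RamTest → ℕ
  | .natLe e f => e.cost + f.cost + 1
  | .realLe e f => e.cost + f.cost + 1
  | .neg b => b.cost + 1
  | .conj b c => b.cost + c.cost + 1

/-- Write `k` into the `i`-th cell of the natural number array `a`. -/
def RamState.writeNat (s : RamState) (a i k : ℕ) : RamState :=
  { s with nat := Function.update s.nat a (Function.update (s.nat a) i k) }

/-- Write `x` into the `i`-th cell of the real array `a`. -/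
noncomputable def RamState.writeReal (s : RamState) (a i : ℕ) (x : ℝ) : RamState :=
  { s with real := Function.update s.real a (Function.update (s.real a) i x) }

/-- `Exec p s s' t`: started in the state `s`, the program `p` halts in the state `s'` after
exactly `t` elementary operations. -/
inductive Exec : RamProg → RamState → RamState → ℕ → Prop where
  | skip (s : RamState) : Exec .skip s s 1
  | setNat (s : RamState) (a : ℕ) (i e : NatExpr) :
      Exec (.setNat a i e) s (s.writeNat a (i.eval s) (e.eval s)) (i.cost + e.cost + 1)
  | setReal (s : RamState) (a : ℕ) (i : NatExpr) (e : RealExpr) :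
      Exec (.setReal a i e) s (s.writeReal a (i.eval s) (e.eval s)) (i.cost + e.cost + 1)
  | seq {p q : RamProg} {s s' s'' : RamState} {t u : ℕ} :
      Exec p s s' t → Exec q s' s'' u → Exec (.seq p q) s s'' (t + u)
  | iteTrue {b : RamTest} {p q : RamProg} {s s' : RamState} {t : ℕ} :
      b.holds s → Exec p s s' t → Exec (.ite b p q) s s' (b.cost + t)
  | iteFalse {b : RamTest} {p q : RamProg} {s s' : RamState} {t : ℕ} :
      ¬ b.holds s → Exec q s s' t → Exec (.ite b p q) s s' (b.cost + t)
  | loopStop {b : RamTest} {p : RamProg} {s : RamState} :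
      ¬ b.holds s → Exec (.loop b p) s s b.cost
  | loopStep {b : RamTest} {p : RamProg} {s s' s'' : RamState} {t u : ℕ} :
      b.holds s → Exec p s s' t → Exec (.loop b p) s' s'' u →
      Exec (.loop b p) s s'' (b.cost + t + u)

/-- The machine is deterministic: the final state and the running time are determined by the
program and the initial state. -/
theorem Exec.deterministic {p : RamProg} {s s₁ s₂ : RamState} {t₁ t₂ : ℕ}
    (h₁ : Exec p s s₁ t₁) (h₂ : Exec p s s₂ t₂) : s₁ = s₂ ∧ t₁ = t₂ := by
  induction h₁ generalizing s₂ t₂ with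
  | skip => cases h₂; exact ⟨rfl, rfl⟩
  | setNat => cases h₂; exact ⟨rfl, rfl⟩
  | setReal => cases h₂; exact ⟨rfl, rfl⟩
  | seq _ _ ih₁ ih₂ =>
    cases h₂ with
    | seq a b =>
      obtain ⟨rfl, rfl⟩ := ih₁ a
      obtain ⟨rfl, rfl⟩ := ih₂ b
      exact ⟨rfl, rfl⟩
  | iteTrue hb _ ih =>
    cases h₂ with
    | iteTrue _ a => obtain ⟨rfl, rfl⟩ := ih a; exact ⟨rfl, rfl⟩
    | iteFalse hb' _ => exact absurd hb hb'
  | iteFalse hb _ ih =>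
    cases h₂ with
    | iteTrue hb' _ => exact absurd hb' hb
    | iteFalse _ a => obtain ⟨rfl, rfl⟩ := ih a; exact ⟨rfl, rfl⟩
  | loopStop hb =>
    cases h₂ with
    | loopStop _ => exact ⟨rfl, rfl⟩
    | loopStep hb' _ _ => exact absurd hb' hb
  | loopStep hb _ _ ih₁ ih₂ =>
    cases h₂ with
    | loopStop hb' => exact absurd hb hb'
    | loopStep _ a b =>
      obtain ⟨rfl, rfl⟩ := ih₁ a
      obtain ⟨rfl, rfl⟩ := ih₂ b
      exact ⟨rfl, rfl⟩

/-- The initial memory for a graph `G` on the vertices `0, …, n-1`, an activity `z` and the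
parameters `ε`, `α`: cell 0 of the natural number array 0 holds `n`; the natural number array 1
holds the adjacency matrix row by row (entry `i j` in cell `i * n + j`); the cells 0, 1, 2, 3 of
the real array 0 hold `Re z`, `Im z`, `ε`, `α`. All other cells are zero. -/
noncomputable def ramInput {n : ℕ} (G : SimpleGraph (Fin n)) [DecidableRel G.Adj]
    (z : ℂ) (ε α : ℝ) : RamState where
  nat a c :=
    if a = 0 ∧ c = 0 then n
    else if a = 1 ∧ ∃ i j : Fin n, G.Adj i j ∧ c = (i : ℕ) * n + j then 1
    else 0
  real a c :=
    if a = 0 ∧ c = 0 then z.re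
    else if a = 0 ∧ c = 1 then z.im
    else if a = 0 ∧ c = 2 then ε
    else if a = 0 ∧ c = 3 then α
    else 0

/-- The output is read off from the cells 0 and 1 of the real array 1. -/
noncomputable def ramOutput (s : RamState) : ℂ :=
  ⟨s.real 1 0, s.real 1 1⟩

/-- `w` is a `(1+ε)`-approximation to `Z`. -/
def IsApprox (ε : ℝ) (w Z : ℂ) : Prop :=
  ‖w - Z‖ ≤ ε * ‖Z‖

/-- On input `(G, z, ε, α)`, the program `P` halts after at most `T` elementary operations, and its
output is a `(1+ε)`-approximation to `Z_G(z·1)`. -/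
def ApproximatesWithin (P : RamProg) {n : ℕ} (G : SimpleGraph (Fin n)) [DecidableRel G.Adj]
    (z : ℂ) (ε α T : ℝ) : Prop :=
  ∃ (s : RamState) (t : ℕ), Exec P (ramInput G z ε α) s t ∧ (t : ℝ) ≤ T ∧
    IsApprox ε (ramOutput s) (indepPoly G (fun _ => z))

/-! Splitting off vertices one by one writes the independence polynomial as a product of factors
`Z(S) / Z(S \ u) = 1 + R`. The ratio `R` of a node satisfies `R = w / ∏ (1 + R_c)` over its children
`c` in the tree of self-avoiding walks (`indepSum_eq_mul_prod_kids`, `occRatio_eq`). Weitz'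
algorithm evaluates this recursion with the ratios at depth `J = 2mk` replaced by 0, where `m` is
about `1/√α` and `k` about `log₂ (4n/(εα))`. The truncated tree has size about `n d^J`, which gives
the running time. It remains to show that the truncation error decays at a rate `1 - δ` with `δ` of
order `√α`.

In the disc, the worst case is the negative axis. Below `λ_G` all induced polynomials are positive
at `-ρ` (`indepSum_neg_pos`), so `r = -R(-ρ)` lies in `[0, 1)`. Since `∏ (1 + R_c)⁻¹` has
nonnegative coefficients as a series in the `-R_c`, the ratios and the truncation errors at any `z`
with `|z| ≤ ρ` are dominated by those at `-ρ` (`norm_occRatio_sub_truncRatio_le`). There, let `s` be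
the truncation of `r` and let `t` be the exact ratio at `-(1+β)ρ`, still below `λ_G`. The error `r -
s` is measured in units of `t - r`, and one level contracts the quotient by `1 - δ`
(`gap_contraction`). This needs only `exp(-δ) ≤ (1-δ)(1+β)`, for which `2δ² ≤ β` suffices: hence the
square root. As `t < 1`, the unit is at most `1 - r ≤ |1 + R|`, so the final error is relative to
each factor.

On the real interval, for `x ≤ 0` the classical induction with ratios at most `1/d` gives `λ'_c(d) ≤
λ_G` (`lambdaC'_le_lambdaG`), and the disc applies. For `x > 0` the recursion contracts in the
coordinate `arsinh √r` by a factor `κ < 1` at every node with at most `d - 1` children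
(`gradient_bound`, `tree_threshold_bound`). Taking `α` small makes the same program go deep enough
(`exists_isApprox_truncPoly_of_pos`).

The program is a depth-first traversal with an explicit stack. `reach_scan` proves its correctness
and its time bound together, and `exists_exec_weitzProg` brings the bound into the required form. -/

/-! ### The independence polynomial on induced subgraphs and the self-avoiding recursion -/

section Recursion

open scoped Classical

/-- The independence polynomial, at the activity `w`, of the subgraph induced on `S`. -/
noncomputable def indepSum {V K : Type*} [CommRing K] (G : SimpleGraph V) (w : K)
    (S : Finset V) : K :=
  ∑ I ∈ S.powerset.filter (fun I : Finset V => G.IsIndepSet (I : Set V)), w ^ I.card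

/-- The children of a node of the tree of self-avoiding walks: scan the list `L` and split off
the elements of `S` with the property `N` one after the other. -/
noncomputable def kids {V : Type*} [DecidableEq V] (N : V → Prop) : Finset V → List V → List (Finset V × V)
  | _, [] => []
  | S, u :: L => if N u ∧ u ∈ S then (S, u) :: kids N (S.erase u) L else kids N S L

/-- The ratio `w Z(S \ N[v]) / Z(S \ v)`. -/
noncomputable def occRatio {V K : Type*} [DecidableEq V] [Field K] (G : SimpleGraph V) (w : K)
    (c : Finset V × V) : K :=
  w * indepSum G w ((c.1.erase c.2).filter (fun u => ¬ G.Adj c.2 u)) /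
    indepSum G w (c.1.erase c.2)

/-- The recursion for the ratios, truncated at depth `i`. -/
noncomputable def truncRatio {V K : Type*} [DecidableEq V] [Field K] (G : SimpleGraph V) (L : List V) (w : K) :
    ℕ → Finset V × V → K
  | 0, _ => 0
  | i + 1, c => w / ((kids (G.Adj c.2) (c.1.erase c.2) L).map
      (fun c' => 1 + truncRatio G L w i c')).prod

variable {V K : Type*} [DecidableEq V]

theorem indepSum_empty {V K : Type*} [CommRing K] (G : SimpleGraph V) (w : K) :
    indepSum G w ∅ = 1 := by
  rw [indepSum, Finset.powerset_empty, Finset.filter_singleton, if_pos]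
  · simp
  · simp [SimpleGraph.isIndepSet_iff]

theorem indepSum_erase [CommRing K] (G : SimpleGraph V)
    (w : K) {S : Finset V} {v : V} (hv : v ∈ S) :
    indepSum G w S = indepSum G w (S.erase v) +
      w * indepSum G w ((S.erase v).filter (fun u => ¬ G.Adj v u)) := by
  unfold indepSum
  rw [← Finset.sum_filter_add_sum_filter_not _ (fun I => v ∉ I), Finset.mul_sum]
  congr 1
  · apply Finset.sum_congr _ (fun _ _ => rfl)
    ext I
    simp only [Finset.mem_filter, Finset.mem_powerset, Finset.subset_erase]
    tauto
  · symm
    refine Finset.sum_bij (fun I _ => insert v I) ?_ ?_ ?_ ?_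
    · intro I hI
      simp only [Finset.mem_filter, Finset.mem_powerset] at hI ⊢
      obtain ⟨hI1, hI2⟩ := hI
      refine ⟨⟨?_, ?_⟩, by simp⟩
      · intro a ha
        rcases Finset.mem_insert.1 ha with rfl | ha
        · exact hv
        · exact Finset.mem_of_mem_erase (Finset.mem_filter.1 (hI1 ha)).1
      · rw [SimpleGraph.isIndepSet_iff] at hI2 ⊢
        rw [Finset.coe_insert, Set.pairwise_insert]
        refine ⟨hI2, fun b hb _ => ?_⟩
        have := (Finset.mem_filter.1 (hI1 hb)).2
        exact ⟨this, fun h => this h.symm⟩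
    · intro I hI J hJ h
      simp only [Finset.mem_filter, Finset.mem_powerset] at hI hJ
      have hvI : v ∉ I := fun h => by simpa using hI.1 h
      have hvJ : v ∉ J := fun h => by simpa using hJ.1 h
      rw [← Finset.erase_insert hvI, ← Finset.erase_insert hvJ, h]
    · intro I hI
      simp only [Finset.mem_filter, Finset.mem_powerset, not_not] at hI
      obtain ⟨⟨hI1, hI2⟩, hvI⟩ := hI
      refine ⟨I.erase v, ?_, Finset.insert_erase hvI⟩
      simp only [Finset.mem_filter, Finset.mem_powerset]
      refine ⟨fun a ha => ?_, fun a ha b hb => hI2 (Finset.mem_of_mem_erase ha)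
        (Finset.mem_of_mem_erase hb)⟩
      rw [Finset.mem_erase] at ha
      simp only [Finset.mem_filter, Finset.mem_erase]
      exact ⟨⟨ha.1, hI1 ha.2⟩, hI2 hvI ha.2 (Ne.symm ha.1)⟩
    · intro I hI
      simp only [Finset.mem_filter, Finset.mem_powerset] at hI
      have hvI : v ∉ I := fun h => by simpa using hI.1 h
      rw [Finset.card_insert_of_notMem hvI, pow_succ']

theorem indepPoly_eq_indepSum {V : Type*} [Fintype V] (G : SimpleGraph V) (w : ℂ) :
    indepPoly G (fun _ => w) = indepSum G w Finset.univ := by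
  simp [indepPoly, indepSum]

theorem indepSum_ofReal {V : Type*} (G : SimpleGraph V) (w : ℝ) (S : Finset V) :
    indepSum G (w : ℂ) S = (indepSum G w S : ℝ) := by
  simp [indepSum]

theorem mem_kids {N : V → Prop} {S : Finset V} {L : List V} {c : Finset V × V}
    (h : c ∈ kids N S L) : c.1 ⊆ S ∧ c.2 ∈ c.1 ∧ N c.2 := by
  induction L generalizing S with
  | nil => simp [kids] at h
  | cons u L ih =>
    rw [kids] at h
    split_ifs at h with hu
    · rcases List.mem_cons.1 h with rfl | h
      · exact ⟨subset_rfl, hu.2, hu.1⟩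
      · have := ih h
        exact ⟨this.1.trans (Finset.erase_subset u S), this.2⟩
    · exact ih h

/-- A vertex that has been split off is erased, so repetitions in `L` are harmless. This bounds the
branching of the tree by the degree. -/
theorem length_kids_le (N : V → Prop) (S : Finset V)
    (L : List V) : (kids N S L).length ≤ (S.filter N).card := by
  induction L generalizing S with
  | nil => simp [kids]
  | cons u L ih =>
    rw [kids]
    split_ifs with hu
    · have h1 := ih (S.erase u)
      have h2 : (S.erase u).filter N = (S.filter N).erase u := by
        ext a; simp only [Finset.mem_filter, Finset.mem_erase]; tauto
      have h3 : u ∈ S.filter N := by simp [hu]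
      rw [h2, Finset.card_erase_of_mem h3] at h1
      have h4 := Finset.card_pos.2 ⟨u, h3⟩
      simp only [List.length_cons]
      omega
    · exact ih S

theorem one_add_occRatio [Field K] (G : SimpleGraph V) (w : K) {S : Finset V}
    {v : V} (hv : v ∈ S) (h : indepSum G w (S.erase v) ≠ 0) :
    indepSum G w S = indepSum G w (S.erase v) * (1 + occRatio G w (S, v)) := by
  rw [indepSum_erase G w hv, occRatio]
  field_simp

/-- Telescoping: splitting off `u` from the current set contributes the factor `Z(S) / Z(S \ u) = 1
+ occRatio`. What is left after the scan are the vertices that were never eligible. -/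
theorem indepSum_eq_mul_prod_kids [Field K] (G : SimpleGraph V) (w : K)
    (N : V → Prop) (S : Finset V) (L : List V)
    (h : ∀ S' ⊆ S, indepSum G w S' ≠ 0) :
    indepSum G w S = indepSum G w (S.filter (fun u => ¬ (N u ∧ u ∈ L))) *
      ((kids N S L).map (fun c => 1 + occRatio G w c)).prod := by
  induction L generalizing S with
  | nil => simp [kids]
  | cons u L ih =>
    rw [kids]
    split_ifs with hu
    · rw [one_add_occRatio G w hu.2 (h _ (Finset.erase_subset _ _)),
        ih (S.erase u) (fun S' hS' => h S' (hS'.trans (Finset.erase_subset _ _)))]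
      have : (S.erase u).filter (fun a => ¬ (N a ∧ a ∈ L)) =
          S.filter (fun a => ¬ (N a ∧ a ∈ u :: L)) := by
        ext a
        simp only [Finset.mem_filter, Finset.mem_erase, List.mem_cons]
        constructor
        · rintro ⟨⟨h1, h2⟩, h3⟩; exact ⟨h2, by tauto⟩
        · rintro ⟨h2, h3⟩
          refine ⟨⟨?_, h2⟩, by tauto⟩
          rintro rfl; exact h3 ⟨hu.1, Or.inl rfl⟩
      rw [this, List.map_cons, List.prod_cons]
      ring
    · rw [ih S h]
      have : S.filter (fun a => ¬ (N a ∧ a ∈ L)) = S.filter (fun a => ¬ (N a ∧ a ∈ u :: L)) := by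
        ext a
        simp only [Finset.mem_filter, List.mem_cons]
        constructor
        · rintro ⟨h2, h3⟩
          refine ⟨h2, ?_⟩
          rintro ⟨h4, rfl | h5⟩
          · exact hu ⟨h4, h2⟩
          · exact h3 ⟨h4, h5⟩
        · rintro ⟨h2, h3⟩; exact ⟨h2, by tauto⟩
      rw [this]

/-- The recursion for the ratios. -/
theorem occRatio_eq [Field K] (G : SimpleGraph V) (w : K) (S : Finset V) (v : V)
    {L : List V} (hL : ∀ u, u ∈ L) (h : ∀ S' ⊆ S.erase v, indepSum G w S' ≠ 0) :
    occRatio G w (S, v) = w / ((kids (G.Adj v) (S.erase v) L).map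
      (fun c => 1 + occRatio G w c)).prod := by
  have h1 := indepSum_eq_mul_prod_kids G w (G.Adj v) (S.erase v) L h
  simp only [hL, and_true] at h1
  have h0 := h _ subset_rfl
  have h2 : indepSum G w ((S.erase v).filter (fun u => ¬ G.Adj v u)) ≠ 0 :=
    h _ (Finset.filter_subset _ _)
  have h3 : ((kids (G.Adj v) (S.erase v) L).map (fun c => 1 + occRatio G w c)).prod ≠ 0 := by
    intro h3; rw [h3, mul_zero] at h1; exact h0 h1
  rw [occRatio, div_eq_div_iff h0 h3, h1]
  ring

theorem truncRatio_succ [Field K] (G : SimpleGraph V) (w : K) (L : List V) (i : ℕ)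
    (S : Finset V) (v : V) :
    truncRatio G L w (i + 1) (S, v) = w / ((kids (G.Adj v) (S.erase v) L).map
      (fun c => 1 + truncRatio G L w i c)).prod := by
  rw [truncRatio]

theorem truncRatio_ofReal (G : SimpleGraph V) (L : List V) (w : ℝ) (i : ℕ) (c : Finset V × V) :
    truncRatio G L (w : ℂ) i c = (truncRatio G L w i c : ℝ) := by
  induction i generalizing c with
  | zero => simp [truncRatio]
  | succ i ih =>
    rw [truncRatio, truncRatio, Complex.ofReal_div]
    congr 1
    rw [show ((List.map (fun c' => 1 + truncRatio G L w i c') _).prod : ℂ) =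
      Complex.ofRealHom (List.map (fun c' => 1 + truncRatio G L w i c') _).prod from rfl,
      map_list_prod, List.map_map]
    congr 1
    apply List.map_congr_left
    intro c' _
    simp [ih]

/-- The product over the top level of the recursion. -/
theorem indepSum_univ_eq_prod_kids [Field K] [Fintype V] (G : SimpleGraph V) (w : K)
    {L : List V} (hL : ∀ u, u ∈ L) (h : ∀ S, indepSum G w S ≠ 0) :
    indepSum G w Finset.univ =
      ((kids (fun _ => True) Finset.univ L).map (fun c => 1 + occRatio G w c)).prod := by
  rw [indepSum_eq_mul_prod_kids G w (fun _ => True) Finset.univ L (fun S _ => h S)]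
  simp [hL, indepSum_empty]

end Recursion

/-! ### The disc of radius `λ_G` -/

section Disc

theorem indepSum_zero {V K : Type*} [CommRing K] (G : SimpleGraph V) (S : Finset V) :
    indepSum G (0 : K) S = 1 := by
  classical
  rw [indepSum, Finset.sum_eq_single ∅]
  · simp
  · intro I _ hI
    exact zero_pow (Finset.card_ne_zero.2 (Finset.nonempty_iff_ne_empty.2 hI))
  · intro h
    simp [SimpleGraph.isIndepSet_iff] at h

theorem continuous_indepSum_neg {V : Type*} (G : SimpleGraph V) (S : Finset V) :
    Continuous fun t : ℝ => indepSum G (-t) S := by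
  unfold indepSum
  fun_prop

theorem lambdaG_pos {V : Type*} [Fintype V] [Nonempty V] (G : SimpleGraph V) :
    0 < lambdaG G := by
  obtain ⟨z, hz, h⟩ := (lambdaG_isLeast G).1
  rw [h, norm_pos_iff]
  rintro rfl
  rw [indepPoly_eq_indepSum, indepSum_zero] at hz
  exact one_ne_zero hz

/-- In the deletion recursion at a negative activity, the vertex put back contributes a nonpositive
term. -/
theorem indepSum_neg_anti {V : Type*} (G : SimpleGraph V) {t : ℝ} (ht : 0 ≤ t)
    (h : ∀ S, 0 ≤ indepSum G (-t) S) {S S' : Finset V} (hS : S ⊆ S') :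
    indepSum G (-t) S' ≤ indepSum G (-t) S := by
  classical
  induction hn : (S' \ S).card generalizing S' with
  | zero =>
    rw [Finset.card_eq_zero, Finset.sdiff_eq_empty_iff_subset] at hn
    rw [subset_antisymm hS hn]
  | succ n ih =>
    obtain ⟨v, hv⟩ := Finset.card_pos.1 (by omega : 0 < (S' \ S).card)
    rw [Finset.mem_sdiff] at hv
    have h1 : indepSum G (-t) (S'.erase v) ≤ indepSum G (-t) S := by
      apply ih (Finset.subset_erase.2 ⟨hS, hv.2⟩)
      rw [Finset.erase_sdiff_comm, Finset.card_erase_of_mem (Finset.mem_sdiff.2 hv), hn]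
      rfl
    rw [indepSum_erase G (-t) hv.1]
    nlinarith [mul_nonneg ht (h ((S'.erase v).filter (fun u => ¬ G.Adj v u)))]

/-- Below `λ_G` the independence polynomials of all induced subgraphs are positive on the negative
real axis. -/
theorem indepSum_neg_pos {V : Type*} [Fintype V] [Nonempty V] (G : SimpleGraph V) {T : ℝ}
    (hT0 : 0 ≤ T) (hT : T < lambdaG G) (S : Finset V) : 0 < indepSum G (-T) S := by
  classical
  by_contra hneg
  push Not at hneg
  -- The activities up to `T` at which positivity fails for some induced subgraph. The set is
  -- compact, so there is a first failure `t`.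
  let B : Set ℝ := Set.Icc 0 T ∩ ⋃ S : Finset V, {t | indepSum G (-t) S ≤ 0}
  have hB : IsCompact B := isCompact_Icc.inter_right
    (isClosed_iUnion_of_finite fun S => isClosed_le (continuous_indepSum_neg G S)
      continuous_const)
  obtain ⟨t, ⟨⟨ht0, htT⟩, htS⟩, hmin⟩ :=
    hB.exists_isLeast ⟨T, ⟨hT0, le_rfl⟩, Set.mem_iUnion.2 ⟨S, hneg⟩⟩
  have hnn : ∀ S, 0 ≤ indepSum G (-t) S := by
    intro S
    by_contra hlt
    push Not at hlt
    -- The value at activity 0 is 1, so a negative value at `-t` would force an earlier zero,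
    -- against the minimality of `t`.
    obtain ⟨u, hu, hu0⟩ := intermediate_value_Icc' ht0
      (continuous_indepSum_neg G S).continuousOn
      (⟨hlt.le, by simp [indepSum_zero]⟩ : (0 : ℝ) ∈ Set.Icc _ _)
    have : t ≤ u := hmin ⟨⟨hu.1, hu.2.trans htT⟩, Set.mem_iUnion.2 ⟨S, hu0.le⟩⟩
    have : u = t := le_antisymm hu.2 this
    subst this
    exact hlt.ne hu0
  obtain ⟨S₀, hS₀⟩ := Set.mem_iUnion.1 htS
  -- By monotonicity in the vertex set the failure is inherited by all of `G`, which therefore has a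
  -- root of modulus `t ≤ T < λ_G`.
  have h0 : indepSum G (-t) Finset.univ = 0 :=
    le_antisymm ((indepSum_neg_anti G ht0 hnn (Finset.subset_univ S₀)).trans hS₀) (hnn _)
  have := (lambdaG_isLeast G).2 ⟨(-t : ℝ), by
    rw [indepPoly_eq_indepSum, indepSum_ofReal, h0, Complex.ofReal_zero], rfl⟩
  rw [Complex.norm_real, norm_neg, Real.norm_of_nonneg ht0] at this
  linarith

variable {V : Type*} [DecidableEq V] (G : SimpleGraph V)

theorem neg_occRatio_nonneg {ρ : ℝ} (hρ : 0 ≤ ρ) (h : ∀ S, 0 < indepSum G (-ρ) S)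
    (c : Finset V × V) : 0 ≤ -occRatio G (-ρ) c := by
  rw [occRatio, neg_mul, neg_div, neg_neg]
  exact div_nonneg (mul_nonneg hρ (h _).le) (h _).le

/-- `1 + occRatio` is the quotient `Z(S) / Z(S \ v)` of two positive numbers. -/
theorem neg_occRatio_lt_one {ρ : ℝ} (h : ∀ S, 0 < indepSum G (-ρ) S)
    {c : Finset V × V} (hc : c.2 ∈ c.1) : -occRatio G (-ρ) c < 1 := by
  have h1 := one_add_occRatio G (-ρ) hc (h _).ne'
  have h2 := h c.1
  rw [h1] at h2
  have := pos_of_mul_pos_right h2 (h _).le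
  change 0 < 1 + occRatio G (-ρ) c at this
  linarith

theorem neg_occRatio_eq {ρ : ℝ} (h : ∀ S, 0 < indepSum G (-ρ) S) {L : List V}
    (hL : ∀ u, u ∈ L) (S : Finset V) (v : V) :
    -occRatio G (-ρ) (S, v) = ρ * ((kids (G.Adj v) (S.erase v) L).map
      (fun c => 1 - -occRatio G (-ρ) c)).prod⁻¹ := by
  rw [occRatio_eq G (-ρ) S v hL (fun S _ => (h S).ne')]
  simp only [sub_neg_eq_add, neg_neg, div_eq_mul_inv, neg_mul]

theorem neg_truncRatio_succ (ρ : ℝ) (L : List V) (i : ℕ) (S : Finset V) (v : V) :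
    -truncRatio G L (-ρ) (i + 1) (S, v) = ρ * ((kids (G.Adj v) (S.erase v) L).map
      (fun c => 1 - -truncRatio G L (-ρ) i c)).prod⁻¹ := by
  rw [truncRatio_succ]
  simp only [sub_neg_eq_add, neg_neg, div_eq_mul_inv, neg_mul]

theorem prod_one_sub_pos {ι : Type*} (l : List ι) (s : ι → ℝ) (h : ∀ c ∈ l, s c < 1) :
    0 < (l.map (fun c => 1 - s c)).prod := by
  apply List.prod_pos
  intro a ha
  obtain ⟨c, hc, rfl⟩ := List.mem_map.1 ha
  linarith [h c hc]

theorem one_sub_le_norm_one_add {T : ℂ} {s : ℝ} (h : ‖T‖ ≤ s) : 1 - s ≤ ‖1 + T‖ := by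
  have := norm_sub_norm_le (1 : ℂ) (-T)
  rw [norm_one, norm_neg, sub_neg_eq_add] at this
  linarith

theorem norm_inv_prod_le {ι : Type*} (l : List ι) (T : ι → ℂ) (s : ι → ℝ)
    (h : ∀ c ∈ l, ‖T c‖ ≤ s c ∧ s c < 1) :
    ‖(l.map (fun c => 1 + T c)).prod⁻¹‖ ≤ (l.map (fun c => 1 - s c)).prod⁻¹ := by
  induction l with
  | nil => simp
  | cons c l ih =>
    have hc := h c (by simp)
    simp only [List.map_cons, List.prod_cons, mul_inv, norm_mul]
    apply mul_le_mul _ (ih fun c hc => h c (by simp [hc])) (norm_nonneg _)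
      (inv_nonneg.2 (by linarith))
    rw [norm_inv]
    exact inv_anti₀ (by linarith) (one_sub_le_norm_one_add hc.1)

/-- Each `(1 + T)⁻¹` is a power series in `-T` with nonnegative coefficients, so its increments are
majorized by those of `(1 - s)⁻¹`. The product rule carries this over to products. -/
theorem norm_inv_prod_sub_le {ι : Type*} (l : List ι) (R T : ι → ℂ) (r s : ι → ℝ)
    (h : ∀ c ∈ l, ‖R c‖ ≤ r c ∧ r c < 1 ∧ ‖T c‖ ≤ s c ∧ ‖R c - T c‖ ≤ r c - s c) :
    ‖(l.map (fun c => 1 + R c)).prod⁻¹ - (l.map (fun c => 1 + T c)).prod⁻¹‖ ≤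
      (l.map (fun c => 1 - r c)).prod⁻¹ - (l.map (fun c => 1 - s c)).prod⁻¹ := by
  induction l with
  | nil => simp
  | cons c l ih =>
    obtain ⟨h1, h2, h3, h4⟩ := h c (by simp)
    have hsr : s c ≤ r c := by linarith [norm_nonneg (R c - T c)]
    have ih := ih fun c hc => h c (by simp [hc])
    have hR := norm_inv_prod_le l R r fun c hc => ⟨(h c (by simp [hc])).1, (h c (by simp [hc])).2.1⟩
    simp only [List.map_cons, List.prod_cons, mul_inv]
    set PR := (l.map (fun c => 1 + R c)).prod⁻¹
    set PT := (l.map (fun c => 1 + T c)).prod⁻¹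
    set pr := (l.map (fun c => 1 - r c)).prod⁻¹
    set ps := (l.map (fun c => 1 - s c)).prod⁻¹
    have hr1 := one_sub_le_norm_one_add h1
    have hs1 := one_sub_le_norm_one_add h3
    have e1 : ‖(1 + R c)⁻¹ - (1 + T c)⁻¹‖ ≤ (1 - r c)⁻¹ - (1 - s c)⁻¹ := by
      have n1 : (1 + R c) ≠ 0 := norm_pos_iff.1 (by linarith)
      have n2 : (1 + T c) ≠ 0 := norm_pos_iff.1 (by linarith)
      have p1 : 0 < 1 - r c := by linarith
      have p2 : 0 < 1 - s c := by linarith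
      rw [inv_sub_inv n1 n2, inv_sub_inv p1.ne' p2.ne', norm_div, norm_mul]
      apply div_le_div₀ (by linarith) _ (by positivity) (by gcongr)
      rw [show 1 + T c - (1 + R c) = -(R c - T c) by ring, norm_neg]
      linarith
    have e2 : ‖(1 + T c)⁻¹‖ ≤ (1 - s c)⁻¹ := by
      rw [norm_inv]; exact inv_anti₀ (by linarith) hs1
    calc ‖(1 + R c)⁻¹ * PR - (1 + T c)⁻¹ * PT‖
        = ‖((1 + R c)⁻¹ - (1 + T c)⁻¹) * PR + (1 + T c)⁻¹ * (PR - PT)‖ := by congr 1; ring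
      _ ≤ ‖(1 + R c)⁻¹ - (1 + T c)⁻¹‖ * ‖PR‖ + ‖(1 + T c)⁻¹‖ * ‖PR - PT‖ := by
        refine (norm_add_le _ _).trans ?_
        rw [norm_mul, norm_mul]
      _ ≤ ((1 - r c)⁻¹ - (1 - s c)⁻¹) * pr + (1 - s c)⁻¹ * (pr - ps) := by
        apply add_le_add
        · exact mul_le_mul e1 hR (norm_nonneg _) ((norm_nonneg _).trans e1)
        · exact mul_le_mul e2 ih (norm_nonneg _) ((norm_nonneg _).trans e2)
      _ = (1 - r c)⁻¹ * pr - (1 - s c)⁻¹ * ps := by ring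

/-- The ratios at a complex activity are dominated by those at the negative real axis. -/
theorem norm_occRatio_le {ρ : ℝ} (h : ∀ S, 0 < indepSum G (-ρ) S) {L : List V}
    (hL : ∀ u, u ∈ L) {z : ℂ} (hz : ‖z‖ ≤ ρ) (S : Finset V) :
    indepSum G z S ≠ 0 ∧ ∀ v ∈ S, ‖occRatio G z (S, v)‖ ≤ -occRatio G (-ρ) (S, v) := by
  induction hn : S.card using Nat.strong_induction_on generalizing S with
  | _ n ih =>
  have hsub : ∀ v ∈ S, ∀ S' ⊆ S.erase v, indepSum G z S' ≠ 0 ∧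
      ∀ v ∈ S', ‖occRatio G z (S', v)‖ ≤ -occRatio G (-ρ) (S', v) := by
    intro v hv S' hS'
    refine ih S'.card ?_ S' rfl
    have := Finset.card_le_card hS'
    rw [Finset.card_erase_of_mem hv] at this
    have := Finset.card_pos.2 ⟨v, hv⟩
    omega
  have hR : ∀ v ∈ S, ‖occRatio G z (S, v)‖ ≤ -occRatio G (-ρ) (S, v) := by
    intro v hv
    rw [occRatio_eq G z S v hL (fun S' hS' => (hsub v hv S' hS').1), neg_occRatio_eq G h hL,
      div_eq_mul_inv, norm_mul]
    apply mul_le_mul hz _ (norm_nonneg _) ((norm_nonneg _).trans hz)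
    apply norm_inv_prod_le
    intro c hc
    have hc := mem_kids hc
    exact ⟨(hsub v hv c.1 hc.1).2 c.2 hc.2.1, neg_occRatio_lt_one G h hc.2.1⟩
  refine ⟨?_, hR⟩
  rcases S.eq_empty_or_nonempty with rfl | ⟨v, hv⟩
  · rw [indepSum_empty]; exact one_ne_zero
  · have hv' := (hsub v hv _ subset_rfl).1
    rw [one_add_occRatio G z hv hv']
    refine mul_ne_zero hv' (norm_pos_iff.1 ?_)
    have h1 := one_sub_le_norm_one_add (hR v hv)
    have h2 := neg_occRatio_lt_one G h (c := (S, v)) hv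
    linarith

/-- The majorization is applied level by level. It reduces the decay at a complex activity to the
decay at the point `-ρ` of the negative axis. -/
theorem norm_occRatio_sub_truncRatio_le {ρ : ℝ} (h : ∀ S, 0 < indepSum G (-ρ) S) {L : List V}
    (hL : ∀ u, u ∈ L) {z : ℂ} (hz : ‖z‖ ≤ ρ) (i : ℕ) (c : Finset V × V) (hc : c.2 ∈ c.1) :
    ‖truncRatio G L z i c‖ ≤ -truncRatio G L (-ρ) i c ∧
    ‖occRatio G z c - truncRatio G L z i c‖ ≤
      -occRatio G (-ρ) c - -truncRatio G L (-ρ) i c := by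
  induction i generalizing c with
  | zero => simpa [truncRatio] using (norm_occRatio_le G h hL hz c.1).2 c.2 hc
  | succ i ih =>
    obtain ⟨S, v⟩ := c
    rw [truncRatio_succ G z, neg_truncRatio_succ,
      occRatio_eq G z S v hL (fun S' _ => (norm_occRatio_le G h hL hz S').1),
      neg_occRatio_eq G h hL, div_eq_mul_inv, div_eq_mul_inv, ← mul_sub, ← mul_sub, norm_mul,
      norm_mul]
    have hk : ∀ c ∈ kids (G.Adj v) (S.erase v) L,
        ‖occRatio G z c‖ ≤ -occRatio G (-ρ) c ∧ -occRatio G (-ρ) c < 1 ∧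
        ‖truncRatio G L z i c‖ ≤ -truncRatio G L (-ρ) i c ∧
        ‖occRatio G z c - truncRatio G L z i c‖ ≤
          -occRatio G (-ρ) c - -truncRatio G L (-ρ) i c := by
      intro c hc
      have hc := mem_kids hc
      exact ⟨(norm_occRatio_le G h hL hz c.1).2 c.2 hc.2.1, neg_occRatio_lt_one G h hc.2.1,
        ih c hc.2.1⟩
    constructor
    · apply mul_le_mul hz _ (norm_nonneg _) ((norm_nonneg _).trans hz)
      apply norm_inv_prod_le
      intro c hc
      have := hk c hc
      exact ⟨this.2.2.1, by linarith [norm_nonneg (occRatio G z c - truncRatio G L z i c)]⟩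
    · exact mul_le_mul hz (norm_inv_prod_sub_le _ _ _ _ _ hk) (norm_nonneg _)
        ((norm_nonneg _).trans hz)

/-- The factor `1 + β` is already produced by the activity in front of the inverse product. The
product itself is monotone, by induction. This superlinearity starts the comparison of the
truncation error with the gap between two activities. -/
theorem neg_occRatio_mono {ρ ρ' β : ℝ} (hρ : 0 ≤ ρ) (hβ : 0 ≤ β) (hρ' : ρ' = (1 + β) * ρ)
    (h : ∀ S, 0 < indepSum G (-ρ) S) (h' : ∀ S, 0 < indepSum G (-ρ') S) {L : List V}
    (hL : ∀ u, u ∈ L) (S : Finset V) (v : V) (hv : v ∈ S) :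
    (1 + β) * -occRatio G (-ρ) (S, v) ≤ -occRatio G (-ρ') (S, v) := by
  induction hn : S.card using Nat.strong_induction_on generalizing S v with
  | _ n ih =>
  rw [neg_occRatio_eq G h hL, neg_occRatio_eq G h' hL, ← mul_assoc, ← hρ']
  have hk : ∀ c ∈ kids (G.Adj v) (S.erase v) L,
      -occRatio G (-ρ) c ≤ -occRatio G (-ρ') c ∧ -occRatio G (-ρ') c < 1 := by
    intro c hc
    have hc := mem_kids hc
    have h1 := Finset.card_le_card hc.1
    rw [Finset.card_erase_of_mem hv] at h1
    have h2 := Finset.card_pos.2 ⟨v, hv⟩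
    have h3 := ih c.1.card (by omega) c.1 c.2 hc.2.1 rfl
    have h4 := neg_occRatio_nonneg G hρ h c
    refine ⟨?_, neg_occRatio_lt_one G h' hc.2.1⟩
    change (1 + β) * -occRatio G (-ρ) c ≤ -occRatio G (-ρ') c at h3
    nlinarith
  apply mul_le_mul_of_nonneg_left _ (by rw [hρ']; positivity)
  apply inv_anti₀ (prod_one_sub_pos _ _ fun c hc => (hk c hc).2)
  apply List.prod_map_le_prod_map₀
  · intro c hc; linarith [(hk c hc).2]
  · intro c hc; linarith [(hk c hc).1]

end Disc

/-! ### Decay of correlations in the disc -/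

section Decay

/-- The convex function `∏ (1 - x_c)⁻¹` lies above its tangent plane at `r`; the sum is its
logarithmic derivative in the direction `r - s`. -/
theorem sub_inv_prod_le {ι : Type*} (l : List ι) (r s : ι → ℝ)
    (h : ∀ c ∈ l, s c ≤ r c ∧ r c < 1) :
    (l.map (fun c => 1 - r c)).prod⁻¹ - (l.map (fun c => 1 - s c)).prod⁻¹ ≤
      (l.map (fun c => 1 - r c)).prod⁻¹ * (l.map (fun c => (r c - s c) / (1 - r c))).sum := by
  have key : (l.map (fun c => 1 - r c)).prod ≤ (l.map (fun c => 1 - s c)).prod ∧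
      1 - (l.map (fun c => (r c - s c) / (1 - r c))).sum ≤
      (l.map (fun c => 1 - r c)).prod * (l.map (fun c => 1 - s c)).prod⁻¹ := by
    induction l with
    | nil => simp
    | cons c l ih =>
      obtain ⟨h1, h2⟩ := h c (by simp)
      obtain ⟨i1, i2⟩ := ih fun c hc => h c (by simp [hc])
      have a0 := prod_one_sub_pos l r fun c hc => (h c (by simp [hc])).2
      simp only [List.map_cons, List.prod_cons, List.sum_cons]
      set a := (l.map (fun c => 1 - r c)).prod
      set b := (l.map (fun c => 1 - s c)).prod
      have p1 : 0 < 1 - r c := by linarith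
      have p2 : 0 < 1 - s c := by linarith
      refine ⟨mul_le_mul (by linarith) i1 a0.le p2.le, ?_⟩
      have hA : a * b⁻¹ ≤ 1 := by
        rw [← div_eq_mul_inv]; exact (div_le_one (a0.trans_le i1)).2 i1
      have hx : (1 - r c) / (1 - s c) ≤ 1 := (div_le_one p2).2 (by linarith)
      have hy : 1 - (r c - s c) / (1 - r c) ≤ (1 - r c) / (1 - s c) := by
        rw [one_sub_div p1.ne', div_le_div_iff₀ p1 p2]
        nlinarith [sq_nonneg (r c - s c)]
      have e : (1 - r c) * a * ((1 - s c) * b)⁻¹ = (1 - r c) / (1 - s c) * (a * b⁻¹) := by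
        rw [mul_inv]; ring
      rw [e]
      nlinarith
  have a0 := prod_one_sub_pos l r fun c hc => (h c hc).2
  have := mul_le_mul_of_nonneg_left key.2 (inv_nonneg.2 a0.le)
  rw [← mul_assoc, inv_mul_cancel₀ a0.ne', one_mul, mul_sub, mul_one] at this
  linarith

/-- For a single factor this is `1 - y ≤ exp (-y)` with `y = (t - r)/(1 - r)`, since `1 - y = (1 -
t)/(1 - r)`. -/
theorem exp_sum_le_prod_mul_inv_prod {ι : Type*} (l : List ι) (r t : ι → ℝ)
    (h : ∀ c ∈ l, r c ≤ t c ∧ t c < 1) :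
    Real.exp (l.map (fun c => (t c - r c) / (1 - r c))).sum ≤
      (l.map (fun c => 1 - r c)).prod * (l.map (fun c => 1 - t c)).prod⁻¹ := by
  induction l with
  | nil => simp
  | cons c l ih =>
    obtain ⟨h1, h2⟩ := h c (by simp)
    have ih := ih fun c hc => h c (by simp [hc])
    simp only [List.map_cons, List.prod_cons, List.sum_cons, Real.exp_add, mul_inv]
    have p1 : 0 < 1 - r c := by linarith
    have p2 : 0 < 1 - t c := by linarith
    have e1 : Real.exp ((t c - r c) / (1 - r c)) ≤ (1 - r c) * (1 - t c)⁻¹ := by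
      have := Real.add_one_le_exp (-((t c - r c) / (1 - r c)))
      have e : -((t c - r c) / (1 - r c)) + 1 = ((1 - r c) * (1 - t c)⁻¹)⁻¹ := by
        field_simp
        ring
      rw [e, Real.exp_neg] at this
      exact (inv_le_inv₀ (by positivity) (Real.exp_pos _)).1 this
    calc _ ≤ (1 - r c) * (1 - t c)⁻¹ * ((l.map (fun c => 1 - r c)).prod *
          (l.map (fun c => 1 - t c)).prod⁻¹) :=
        mul_le_mul e1 ih (Real.exp_pos _).le (by positivity)
      _ = _ := by ring

/-- One step of the recursion contracts the gap to the exact value, measured in units of the gap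
between two activities. -/
theorem gap_contraction {ι : Type*} (l : List ι) (r s t : ι → ℝ) {ρ β δ K : ℝ} (hρ : 0 ≤ ρ)
    (hβ : 0 ≤ β) (hδ : δ < 1) (hδβ : Real.exp (-δ) ≤ (1 - δ) * (1 + β)) (hK : 0 ≤ K)
    (h : ∀ c ∈ l, s c ≤ r c ∧ r c ≤ t c ∧ t c < 1 ∧ r c - s c ≤ K * (t c - r c)) :
    ρ * (l.map (fun c => 1 - r c)).prod⁻¹ - ρ * (l.map (fun c => 1 - s c)).prod⁻¹ ≤
      K * (1 - δ) * ((1 + β) * ρ * (l.map (fun c => 1 - t c)).prod⁻¹ -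
        ρ * (l.map (fun c => 1 - r c)).prod⁻¹) := by
  have h1 := sub_inv_prod_le l r s fun c hc => ⟨(h c hc).1, (h c hc).2.1.trans_lt (h c hc).2.2.1⟩
  have h2 := exp_sum_le_prod_mul_inv_prod l r t fun c hc => ⟨(h c hc).2.1, (h c hc).2.2.1⟩
  have a0 := prod_one_sub_pos l r fun c hc => (h c hc).2.1.trans_lt (h c hc).2.2.1
  have b0 := prod_one_sub_pos l t fun c hc => (h c hc).2.2.1
  have h3 : (l.map (fun c => (r c - s c) / (1 - r c))).sum ≤
      K * (l.map (fun c => (t c - r c) / (1 - r c))).sum := by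
    rw [← List.sum_map_mul_left]
    apply List.sum_le_sum
    intro c hc
    have := h c hc
    rw [← mul_div_assoc]
    exact div_le_div_of_nonneg_right this.2.2.2 (by linarith)
  set a := (l.map (fun c => 1 - r c)).prod
  set b := (l.map (fun c => 1 - t c)).prod
  set σ := (l.map (fun c => (t c - r c) / (1 - r c))).sum
  have d0 : 0 < 1 - δ := by linarith
  have b1 : 0 < 1 + β := by linarith
  -- Apply `log y ≤ y - 1` to `y = (1 - δ)(1 + β) a/b`. Its logarithm is at least `-δ + σ`, by the
  -- choice of `δ` and by `h2`.
  have h4 : σ ≤ (1 - δ) * ((1 + β) * (a * b⁻¹) - 1) := by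
    have : -δ ≤ Real.log ((1 - δ) * (1 + β)) := (Real.le_log_iff_exp_le (by positivity)).2 hδβ
    have l1 : Real.log ((1 - δ) * (1 + β) * (a * b⁻¹)) ≤ (1 - δ) * (1 + β) * (a * b⁻¹) - 1 :=
      Real.log_le_sub_one_of_pos (by positivity)
    rw [Real.log_mul (by positivity) (by positivity)] at l1
    have l2 : σ ≤ Real.log (a * b⁻¹) := (Real.le_log_iff_exp_le (by positivity)).2 h2
    nlinarith
  rw [← mul_sub]
  calc _ ≤ ρ * (a⁻¹ * (K * ((1 - δ) * ((1 + β) * (a * b⁻¹) - 1)))) := by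
        apply mul_le_mul_of_nonneg_left _ hρ
        refine h1.trans (mul_le_mul_of_nonneg_left (h3.trans ?_) (inv_nonneg.2 a0.le))
        exact mul_le_mul_of_nonneg_left h4 hK
    _ = _ := by field_simp

variable {V : Type*} [DecidableEq V] (G : SimpleGraph V)

/-- At depth 0 the error is the whole ratio, which is at most `β⁻¹` times the gap between the two
activities by `neg_occRatio_mono`. Each further level gains `1 - δ`. -/
theorem neg_occRatio_sub_truncRatio_le {ρ ρ' β δ : ℝ} (hρ : 0 ≤ ρ) (hβ : 0 < β)
    (hδ : δ < 1) (hδβ : Real.exp (-δ) ≤ (1 - δ) * (1 + β)) (hρ' : ρ' = (1 + β) * ρ)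
    (h : ∀ S, 0 < indepSum G (-ρ) S) (h' : ∀ S, 0 < indepSum G (-ρ') S) {L : List V}
    (hL : ∀ u, u ∈ L) (i : ℕ) (c : Finset V × V) (hc : c.2 ∈ c.1) :
    -occRatio G (-ρ) c - -truncRatio G L (-ρ) i c ≤
      β⁻¹ * (1 - δ) ^ i * (-occRatio G (-ρ') c - -occRatio G (-ρ) c) := by
  induction i generalizing c with
  | zero =>
    have := neg_occRatio_mono G hρ hβ.le hρ' h h' hL c.1 c.2 hc
    change (1 + β) * -occRatio G (-ρ) c ≤ -occRatio G (-ρ') c at this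
    rw [truncRatio, pow_zero, mul_one, inv_mul_eq_div, le_div_iff₀ hβ]
    linarith
  | succ i ih =>
    obtain ⟨S, v⟩ := c
    rw [neg_truncRatio_succ, neg_occRatio_eq G h hL, neg_occRatio_eq G h' hL, pow_succ,
      ← mul_assoc, hρ']
    refine gap_contraction _ _ _ _ hρ hβ.le hδ hδβ
      (mul_nonneg (inv_nonneg.2 hβ.le) (pow_nonneg (by linarith) i)) ?_
    intro c hc
    have hc := (mem_kids hc).2.1
    -- The activity 0 is only a device here: a norm bounded by the real error shows that this error
    -- is nonnegative.
    have h1 := (norm_occRatio_sub_truncRatio_le (z := (0 : ℂ)) G h hL (by simpa using hρ) i c hc).2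
    have h2 := neg_occRatio_mono G hρ hβ.le hρ' h h' hL c.1 c.2 hc
    change (1 + β) * -occRatio G (-ρ) c ≤ -occRatio G (-ρ') c at h2
    have h3 := neg_occRatio_nonneg G hρ h c
    have h4 := norm_nonneg (occRatio G (0 : ℂ) c - truncRatio G L 0 i c)
    rw [← hρ']
    exact ⟨by linarith, by nlinarith, neg_occRatio_lt_one G h' hc, ih c hc⟩

theorem norm_prod_sub_prod_le {ι : Type*} (l : List ι) (R T : ι → ℂ) {θ : ℝ} (hθ : 0 ≤ θ)
    (h : ∀ c ∈ l, ‖T c - R c‖ ≤ θ * ‖1 + R c‖) :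
    ‖(l.map (fun c => 1 + T c)).prod - (l.map (fun c => 1 + R c)).prod‖ ≤
      ((1 + θ) ^ l.length - 1) * ‖(l.map (fun c => 1 + R c)).prod‖ := by
  induction l with
  | nil => simp
  | cons c l ih =>
    have hc := h c (by simp)
    have ih := ih fun c hc => h c (by simp [hc])
    simp only [List.map_cons, List.prod_cons, List.length_cons, norm_mul]
    set PR := (l.map (fun c => 1 + R c)).prod
    set PT := (l.map (fun c => 1 + T c)).prod
    have hT : ‖1 + T c‖ ≤ (1 + θ) * ‖1 + R c‖ := by
      calc ‖1 + T c‖ = ‖(1 + R c) + (T c - R c)‖ := by congr 1; ring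
        _ ≤ ‖1 + R c‖ + ‖T c - R c‖ := norm_add_le _ _
        _ ≤ _ := by linarith
    have hp : 0 ≤ (1 + θ) ^ l.length - 1 := by
      have := one_le_pow₀ (n := l.length) (by linarith : (1 : ℝ) ≤ 1 + θ)
      linarith
    calc ‖(1 + T c) * PT - (1 + R c) * PR‖
        = ‖(1 + T c) * (PT - PR) + (T c - R c) * PR‖ := by congr 1; ring
      _ ≤ ‖1 + T c‖ * ‖PT - PR‖ + ‖T c - R c‖ * ‖PR‖ := by
        refine (norm_add_le _ _).trans ?_
        rw [norm_mul, norm_mul]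
      _ ≤ (1 + θ) * ‖1 + R c‖ * (((1 + θ) ^ l.length - 1) * ‖PR‖) + θ * ‖1 + R c‖ * ‖PR‖ := by
        gcongr
      _ = _ := by ring

theorem norm_prod_sub_prod_le_of_mul_le {ι : Type*} (l : List ι) (R T : ι → ℂ) {θ ε : ℝ}
    (hθ : 0 ≤ θ) (h : ∀ c ∈ l, ‖T c - R c‖ ≤ θ * ‖1 + R c‖) (hε : ε ≤ 1)
    (hl : l.length * θ ≤ ε / 2) :
    ‖(l.map (fun c => 1 + T c)).prod - (l.map (fun c => 1 + R c)).prod‖ ≤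
      ε * ‖(l.map (fun c => 1 + R c)).prod‖ := by
  refine (norm_prod_sub_prod_le l R T hθ h).trans ?_
  gcongr
  have h1 : (1 + θ) ^ l.length ≤ Real.exp (l.length * θ) := by
    rw [Real.exp_nat_mul]
    gcongr
    linarith [Real.add_one_le_exp θ]
  have h0 : 0 ≤ l.length * θ := by positivity
  have h2 := Real.abs_exp_sub_one_le (x := l.length * θ) (by rw [abs_of_nonneg h0]; linarith)
  rw [abs_of_nonneg h0] at h2
  linarith [le_abs_self (Real.exp (l.length * θ) - 1)]

/-- From `exp (-δ) ≤ 1/(1 + δ)` it remains to see `(1 - δ²)(1 + β) ≥ 1`. The first-order terms in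
`δ` cancel, so the rate may be of order `√β`. -/
theorem exp_neg_le_of_two_mul_sq_le {δ β : ℝ} (h0 : 0 ≤ δ) (h1 : δ ≤ 1 / 2)
    (h : 2 * δ ^ 2 ≤ β) : Real.exp (-δ) ≤ (1 - δ) * (1 + β) := by
  have h2 := Real.add_one_le_exp δ
  have h3 : Real.exp (-δ) ≤ 1 / (1 + δ) := by
    rw [Real.exp_neg, ← one_div]
    exact one_div_le_one_div_of_le (by linarith) (by linarith)
  refine h3.trans ?_
  rw [div_le_iff₀ (by linarith)]
  have : δ ^ 2 ≤ 1 / 4 := by nlinarith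
  nlinarith [sq_nonneg δ]

/-- With `δ = 1/(2m)`, every block of `2m` levels multiplies the error by at most `exp (-1) ≤ 1/2`.
-/
theorem one_sub_pow_le {m k : ℕ} (hm : 1 ≤ m) :
    (1 - 1 / (2 * m) : ℝ) ^ (2 * m * k) ≤ (1 / 2) ^ k := by
  have hm' : (1 : ℝ) ≤ m := by exact_mod_cast hm
  rw [pow_mul]
  have h0 : (1 / (2 * m) : ℝ) ≤ 1 := by
    rw [div_le_one (by linarith)]; linarith
  apply pow_le_pow_left₀ (pow_nonneg (by linarith) _)
  calc (1 - 1 / (2 * m) : ℝ) ^ (2 * m) ≤ Real.exp (-(1 / (2 * m))) ^ (2 * m) := by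
        apply pow_le_pow_left₀ (by linarith)
        linarith [Real.add_one_le_exp (-(1 / (2 * m) : ℝ))]
    _ = Real.exp (-1) := by
      rw [← Real.exp_nat_mul]
      congr 1
      push_cast
      field_simp
    _ ≤ 1 / 2 := by
      rw [Real.exp_neg, ← one_div]
      apply one_div_le_one_div_of_le (by norm_num)
      have := Real.add_one_le_exp (1 : ℝ)
      linarith

/-- The output of the truncated recursion. -/
noncomputable def truncPoly {V : Type*} [Fintype V] [DecidableEq V] (G : SimpleGraph V)
    (L : List V) (z : ℂ) (J : ℕ) : ℂ :=
  ((kids (fun _ => True) Finset.univ L).map (fun c => 1 + truncRatio G L z J c)).prod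

theorem length_kids_univ_le {V : Type*} [Fintype V] [DecidableEq V] (L : List V) :
    (kids (fun _ : V => True) Finset.univ L).length ≤ Fintype.card V := by
  refine (length_kids_le _ _ _).trans (Finset.card_le_univ _)

theorem isApprox_truncPoly_of_disc {V : Type*} [Fintype V] [DecidableEq V] [Nonempty V]
    (G : SimpleGraph V) {L : List V} (hL : ∀ u, u ∈ L) {z : ℂ} {ε α : ℝ}
    (hε1 : ε ≤ 1) (hα : 0 < α) (hz : (1 + α) * ‖z‖ ≤ lambdaG G) {m k : ℕ}
    (hm : 1 ≤ m) (hmα : 1 ≤ (m : ℝ) ^ 2 * α) (hk : 4 * Fintype.card V ≤ 2 ^ k * (ε * α)) :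
    IsApprox ε (truncPoly G L z (2 * m * k)) (indepPoly G (fun _ => z)) := by
  have hm' : (1 : ℝ) ≤ m := by exact_mod_cast hm
  -- Only half of the slack is used for the comparison activity, because positivity requires it to
  -- lie strictly below `λ_G`.
  have hlt : (1 + α / 2) * ‖z‖ < lambdaG G := by
    rcases (norm_nonneg z).eq_or_lt with h0 | h0
    · rw [← h0, mul_zero]; exact lambdaG_pos G
    · nlinarith
  have hz0 := norm_nonneg z
  have h' := indepSum_neg_pos G (mul_nonneg (by linarith) hz0) hlt
  have h := indepSum_neg_pos G hz0 (lt_of_le_of_lt (by nlinarith) hlt)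
  set δ : ℝ := 1 / (2 * m) with hδdef
  have hδ0 : 0 ≤ δ := by positivity
  have hδ1 : δ ≤ 1 / 2 := by
    rw [hδdef]; apply one_div_le_one_div_of_le <;> linarith
  have hδβ := exp_neg_le_of_two_mul_sq_le hδ0 hδ1 (β := α / 2) (by
    rw [hδdef, div_pow, one_pow, mul_pow, mul_one_div, div_le_iff₀ (by positivity)]
    linarith)
  have hθ : (1 - δ) ^ (2 * m * k) ≤ (1 / 2) ^ k := one_sub_pow_le hm
  rw [IsApprox, truncPoly, indepPoly_eq_indepSum,
    indepSum_univ_eq_prod_kids G z hL (fun S => (norm_occRatio_le G h hL le_rfl S).1)]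
  refine norm_prod_sub_prod_le_of_mul_le _ _ _ (θ := (α / 2)⁻¹ * (1 / 2) ^ k)
    (by positivity) ?_ hε1 ?_
  · intro c hc
    have hc := (mem_kids hc).2.1
    have h1 := (norm_occRatio_sub_truncRatio_le G h hL (le_refl ‖z‖) (2 * m * k) c hc).2
    have h2 := neg_occRatio_sub_truncRatio_le G hz0 (by linarith : 0 < α / 2)
      (by linarith : δ < 1) hδβ rfl h h' hL (2 * m * k) c hc
    have h3 := one_sub_le_norm_one_add ((norm_occRatio_le G h hL (le_refl ‖z‖) c.1).2 c.2 hc)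
    change 1 - -occRatio G (-‖z‖) c ≤ ‖1 + occRatio G z c‖ at h3
    have h4 := neg_occRatio_lt_one G h' hc
    have h5 := neg_occRatio_lt_one G h hc
    have h6 := neg_occRatio_mono G hz0 (by linarith : 0 ≤ α / 2) rfl h h' hL c.1 c.2 hc
    change (1 + α / 2) * -occRatio G (-‖z‖) c ≤ -occRatio G (-((1 + α / 2) * ‖z‖)) c at h6
    have h7 := neg_occRatio_nonneg G hz0 h c
    rw [norm_sub_rev]
    refine h1.trans (h2.trans ?_)
    -- The gap `t - r` is less than `1 - r`, as `t < 1`, and `1 - r ≤ |1 + R|`. The error is thus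
    -- relative to the factor, however small the latter is.
    apply mul_le_mul _ (by linarith) _ (by positivity)
    · exact mul_le_mul_of_nonneg_left hθ (by positivity)
    · nlinarith
  · have hl : ((kids (fun _ : V => True) Finset.univ L).length : ℝ) ≤ Fintype.card V := by
      exact_mod_cast length_kids_univ_le L
    have hkp : (0 : ℝ) < 2 ^ k := by positivity
    calc _ ≤ (Fintype.card V : ℝ) * ((α / 2)⁻¹ * (1 / 2) ^ k) := by gcongr
      _ ≤ ε / 2 := by
        rw [one_div, inv_pow, ← mul_inv, ← div_eq_mul_inv, div_le_iff₀ (by positivity)]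
        nlinarith

end Decay

/-! ### Graphs of bounded degree: the tree thresholds -/

section Threshold

open scoped Classical

variable {V : Type*} [Fintype V] [DecidableEq V] (G : SimpleGraph V)

/-- A child of a node of the recursion has lost its parent. -/
theorem card_filter_adj_le_of_mem_kids {D : ℕ}
    (hG : ∀ v, (Finset.univ.filter (G.Adj v)).card ≤ D + 1) {S : Finset V} {v : V} {L : List V}
    {c : Finset V × V} (hc : c ∈ kids (G.Adj v) (S.erase v) L) :
    ((c.1.erase c.2).filter (G.Adj c.2)).card ≤ D := by
  have hc := mem_kids hc
  have h1 : (c.1.erase c.2).filter (G.Adj c.2) ⊆ (Finset.univ.filter (G.Adj c.2)).erase v := by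
    intro a ha
    rw [Finset.mem_filter] at ha
    rw [Finset.mem_erase, Finset.mem_filter]
    refine ⟨?_, Finset.mem_univ _, ha.2⟩
    rintro rfl
    have := hc.1 (Finset.mem_of_mem_erase ha.1)
    simp at this
  have h2 := Finset.card_le_card h1
  rw [Finset.card_erase_of_mem (by simp [hc.2.2.symm])] at h2
  have := hG c.2
  omega

/-- The value `1/(D + 1)` reproduces itself: `D` children with ratios of this size give at most `|z|
((D + 1)/D)^D ≤ 1/(D + 1)`. A vertex with `D + 1` children violates this bound at most by a factor
that still leaves its ratio below 1, which is enough for nonvanishing. -/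
theorem indepSum_ne_zero_of_norm_lt {D : ℕ} (hD : 1 ≤ D)
    (hG : ∀ v, (Finset.univ.filter (G.Adj v)).card ≤ D + 1) {z : ℂ}
    (hz : ‖z‖ < lambdaC' (D + 1)) (S : Finset V) :
    indepSum G z S ≠ 0 ∧ ∀ v ∈ S, ((S.erase v).filter (G.Adj v)).card ≤ D →
      ‖occRatio G z (S, v)‖ ≤ 1 / (D + 1) := by
  have hD' : (1 : ℝ) ≤ D := by exact_mod_cast hD
  have hz' : ‖z‖ < (D : ℝ) ^ D / (D + 1) ^ (D + 1) := by
    simpa [lambdaC'] using hz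
  have hq : (1 - 1 / (D + 1) : ℝ) = D / (D + 1) := by field_simp; ring
  have hq1 : (0 : ℝ) < D / (D + 1) := by positivity
  have hq2 : (D / (D + 1) : ℝ) ≤ 1 := (div_le_one (by positivity)).2 (by linarith)
  induction hn : S.card using Nat.strong_induction_on generalizing S with
  | _ n ih =>
  have hsub : ∀ v ∈ S, ∀ S' ⊆ S.erase v, indepSum G z S' ≠ 0 ∧
      ∀ v ∈ S', ((S'.erase v).filter (G.Adj v)).card ≤ D →
        ‖occRatio G z (S', v)‖ ≤ 1 / (D + 1) := by
    intro v hv S' hS'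
    refine ih S'.card ?_ S' rfl
    have := Finset.card_le_card hS'
    rw [Finset.card_erase_of_mem hv] at this
    have := Finset.card_pos.2 ⟨v, hv⟩
    omega
  have hR : ∀ v ∈ S, ∀ j, ((S.erase v).filter (G.Adj v)).card ≤ j →
      ‖occRatio G z (S, v)‖ ≤ ‖z‖ * ((D / (D + 1) : ℝ) ^ j)⁻¹ := by
    intro v hv j hj
    have hL : ∀ u, u ∈ (Finset.univ : Finset V).toList := by simp
    rw [occRatio_eq G z S v hL (fun S' hS' => (hsub v hv S' hS').1), div_eq_mul_inv, norm_mul]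
    gcongr
    refine (norm_inv_prod_le _ _ (fun _ => 1 / (D + 1 : ℝ)) ?_).trans ?_
    · intro c hc
      have hk := mem_kids hc
      refine ⟨(hsub v hv c.1 hk.1).2 c.2 hk.2.1 (card_filter_adj_le_of_mem_kids G hG hc), ?_⟩
      rw [div_lt_one (by positivity)]
      linarith
    · rw [hq, List.map_const', List.prod_replicate]
      exact inv_anti₀ (by positivity)
        (pow_le_pow_of_le_one hq1.le hq2 ((length_kids_le _ _ _).trans hj))
  have hR1 : ∀ v ∈ S, ((S.erase v).filter (G.Adj v)).card ≤ D →
      ‖occRatio G z (S, v)‖ ≤ 1 / (D + 1) := by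
    intro v hv hj
    refine (hR v hv D hj).trans ?_
    rw [← div_eq_mul_inv, div_le_iff₀ (by positivity)]
    refine hz'.le.trans (le_of_eq ?_)
    rw [div_pow]
    field_simp
    ring
  refine ⟨?_, hR1⟩
  rcases S.eq_empty_or_nonempty with rfl | ⟨v, hv⟩
  · rw [indepSum_empty]; exact one_ne_zero
  · have hv' := (hsub v hv _ subset_rfl).1
    rw [one_add_occRatio G z hv hv']
    refine mul_ne_zero hv' (norm_pos_iff.1 ?_)
    have h1 := one_sub_le_norm_one_add (hR v hv (D + 1)
      ((Finset.card_le_card (Finset.filter_subset_filter _ (Finset.subset_univ _))).trans (hG v)))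
    have h2 : ‖z‖ * ((D / (D + 1) : ℝ) ^ (D + 1))⁻¹ < 1 := by
      rw [← div_eq_mul_inv, div_lt_one (by positivity)]
      refine hz'.trans_le ?_
      rw [div_pow]
      apply div_le_div_of_nonneg_right _ (by positivity)
      exact pow_le_pow_right₀ hD' (by omega)
    linarith

theorem lambdaC'_le_lambdaG [Nonempty V] {D : ℕ} (hD : 1 ≤ D)
    (hG : ∀ v, (Finset.univ.filter (G.Adj v)).card ≤ D + 1) :
    lambdaC' (D + 1) ≤ lambdaG G := by
  obtain ⟨z, hz, h⟩ := (lambdaG_isLeast G).1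
  by_contra hlt
  push Not at hlt
  rw [h] at hlt
  rw [indepPoly_eq_indepSum] at hz
  exact (indepSum_ne_zero_of_norm_lt G hD hG hlt _).1 hz

end Threshold

/-! ### The recursion at a positive activity in the coordinate `arsinh √r`. -/

section Positive

/-- The logarithm of the product of hyperbolic cosines. -/
noncomputable def sumLogCosh {ι : Type*} (l : List ι) (u : ι → ℝ) : ℝ :=
  (l.map (fun c => Real.log (Real.cosh (u c)))).sum

theorem hasDerivAt_sumLogCosh {ι : Type*} (l : List ι) (u v : ι → ℝ) (t : ℝ) :
    HasDerivAt (fun t => sumLogCosh l (fun c => u c + t * v c))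
      (l.map (fun c => Real.tanh (u c + t * v c) * v c)).sum t := by
  unfold sumLogCosh
  induction l with
  | nil => simpa using hasDerivAt_const t (0 : ℝ)
  | cons c l ih =>
    simp only [List.map_cons, List.sum_cons]
    refine HasDerivAt.fun_add ?_ ih
    have h1 : HasDerivAt (fun t => u c + t * v c) (v c) t := by
      simpa using ((hasDerivAt_id t).mul_const (v c)).const_add (u c)
    have h2 := h1.cosh.log (Real.cosh_pos _).ne'
    refine h2.congr_deriv ?_
    rw [Real.tanh_eq_sinh_div_cosh]
    ring

/-- The map `r ↦ x / ∏ (1 + r_c)`, in the coordinate `u = arsinh √r`, is Lipschitz with any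
constant that bounds its gradient. -/
theorem abs_arsinh_sqrt_sub_le {ι : Type*} (l : List ι) (r s : ι → ℝ) {x κ M : ℝ} (hx : 0 < x)
    (hr : ∀ c ∈ l, 0 ≤ r c) (hs : ∀ c ∈ l, 0 ≤ s c)
    (hκ : ∀ u : ι → ℝ, (∀ c ∈ l, 0 ≤ u c) →
      x * Real.exp (-2 * sumLogCosh l u) * (l.map (fun c => Real.tanh (u c))).sum ^ 2 ≤
        κ ^ 2 * (1 + x * Real.exp (-2 * sumLogCosh l u)))
    (hκ0 : 0 ≤ κ) (hM0 : 0 ≤ M)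
    (hM : ∀ c ∈ l, |Real.arsinh √(r c) - Real.arsinh √(s c)| ≤ M) :
    |Real.arsinh √(x / (l.map (fun c => 1 + r c)).prod) -
      Real.arsinh √(x / (l.map (fun c => 1 + s c)).prod)| ≤ κ * M := by
  set u : ι → ℝ := fun c => Real.arsinh √(s c)
  set w : ι → ℝ := fun c => Real.arsinh √(r c)
  set v : ι → ℝ := fun c => w c - u c
  -- With `q = sinh² u` one has `1 + q = cosh² u`, so the product becomes an exponential of a sum.
  have hend : ∀ q : ι → ℝ, (∀ c ∈ l, 0 ≤ q c) →
      √(x / (l.map (fun c => 1 + q c)).prod) =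
        √x * Real.exp (-sumLogCosh l (fun c => Real.arsinh √(q c))) := by
    intro q hq
    have : (l.map (fun c => 1 + q c)).prod =
        Real.exp (sumLogCosh l (fun c => Real.arsinh √(q c))) ^ 2 := by
      clear hκ hM
      unfold sumLogCosh
      induction l with
      | nil => simp
      | cons c l ih =>
        have hc := hq c (by simp)
        simp only [List.map_cons, List.prod_cons, List.sum_cons, Real.exp_add, mul_pow]
        rw [ih (fun c hc => hr c (by simp [hc])) (fun c hc => hs c (by simp [hc]))
          (fun c hc => hq c (by simp [hc])), Real.exp_log (Real.cosh_pos _), Real.cosh_arsinh,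
          Real.sq_sqrt (by positivity), Real.sq_sqrt hc]
    rw [this, Real.sqrt_div hx.le, Real.sqrt_sq (Real.exp_pos _).le, Real.exp_neg, div_eq_mul_inv]
  rw [hend r hr, hend s hs]
  -- The segment from `s` to `r` in the new coordinate; the claim is the mean value inequality along
  -- it.
  set g : ℝ → ℝ := fun t => √x * Real.exp (-sumLogCosh l (fun c => u c + t * v c)) with hg
  have hderiv : ∀ t, HasDerivAt (fun t => Real.arsinh (g t))
      ((√(1 + g t ^ 2))⁻¹ • (√x * (Real.exp (-sumLogCosh l (fun c => u c + t * v c)) *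
        -(l.map (fun c => Real.tanh (u c + t * v c) * v c)).sum))) t := by
    intro t
    exact (((hasDerivAt_sumLogCosh l u v t).fun_neg.exp).const_mul (√x)).arsinh
  have hbound : ∀ t ∈ Set.Icc (0 : ℝ) 1, ‖(√(1 + g t ^ 2))⁻¹ • (√x *
      (Real.exp (-sumLogCosh l (fun c => u c + t * v c)) *
        -(l.map (fun c => Real.tanh (u c + t * v c) * v c)).sum))‖ ≤ κ * M := by
    intro t ht
    set p : ι → ℝ := fun c => u c + t * v c
    have hp : ∀ c ∈ l, 0 ≤ p c := by
      intro c _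
      have h1 : 0 ≤ u c := Real.arsinh_nonneg_iff.2 (Real.sqrt_nonneg _)
      have h2 : 0 ≤ w c := Real.arsinh_nonneg_iff.2 (Real.sqrt_nonneg _)
      have : p c = (1 - t) * u c + t * w c := by simp only [p, v]; ring
      rw [this]
      nlinarith [ht.1, ht.2]
    have hth : ∀ c ∈ l, 0 ≤ Real.tanh (p c) := fun c hc => by
      rw [Real.tanh_eq_sinh_div_cosh]
      exact div_nonneg (Real.sinh_nonneg_iff.2 (hp c hc)) (Real.cosh_pos _).le
    have hsum : |(l.map (fun c => Real.tanh (p c) * v c)).sum| ≤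
        (l.map (fun c => Real.tanh (p c))).sum * M := by
      clear_value p
      clear hκ hp hderiv hend hg g
      induction l with
      | nil => simp
      | cons c l ih =>
        simp only [List.map_cons, List.sum_cons]
        have ih := ih (fun c hc => hr c (by simp [hc])) (fun c hc => hs c (by simp [hc]))
          (fun c hc => hM c (by simp [hc])) (fun c hc => hth c (by simp [hc]))
        have h1 := hth c (by simp)
        have h2 : |v c| ≤ M := hM c (by simp)
        refine (abs_add_le _ _).trans ?_
        rw [abs_mul, abs_of_nonneg h1, add_mul]
        exact add_le_add (mul_le_mul_of_nonneg_left h2 h1) ih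
    have hT0 : 0 ≤ (l.map (fun c => Real.tanh (p c))).sum := by
      apply List.sum_nonneg
      intro a ha
      obtain ⟨c, hc, rfl⟩ := List.mem_map.1 ha
      exact hth c hc
    have hk := hκ p hp
    have hg2 : g t ^ 2 = x * Real.exp (-2 * sumLogCosh l p) := by
      simp only [hg, mul_pow, Real.sq_sqrt hx.le, ← Real.exp_nat_mul]
      congr 2
      push_cast
      ring
    have hgp : 0 < g t := by positivity
    rw [← hg2] at hk
    have hroot : g t * (l.map (fun c => Real.tanh (p c))).sum ≤ κ * √(1 + g t ^ 2) := by
      apply le_of_sq_le_sq _ (by positivity)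
      rw [mul_pow (g t), mul_pow κ, Real.sq_sqrt (by positivity)]
      exact hk
    rw [smul_eq_mul, norm_mul, norm_inv, Real.norm_of_nonneg (Real.sqrt_nonneg _),
      ← mul_assoc, norm_mul, norm_neg, Real.norm_of_nonneg hgp.le, inv_mul_le_iff₀ (by positivity),
      Real.norm_eq_abs]
    calc _ ≤ g t * ((l.map (fun c => Real.tanh (p c))).sum * M) := by gcongr
      _ = g t * (l.map (fun c => Real.tanh (p c))).sum * M := by ring
      _ ≤ κ * √(1 + g t ^ 2) * M := by gcongr
      _ = _ := by ring
  have := (convex_Icc (0 : ℝ) 1).norm_image_sub_le_of_norm_hasDerivWithin_le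
    (fun t _ => (hderiv t).hasDerivWithinAt) hbound (x := 0) (y := 1) (by simp) (by simp)
  simpa [g, v, w, u] using this

end Positive

/-! ### Decay of correlations on the positive axis -/

section PositiveDecay

theorem sumLogCosh_nonneg {ι : Type*} (l : List ι) (u : ι → ℝ) : 0 ≤ sumLogCosh l u := by
  apply List.sum_nonneg
  intro a ha
  obtain ⟨c, _, rfl⟩ := List.mem_map.1 ha
  exact Real.log_nonneg (Real.one_le_cosh _)

/-- `tanh² u = 1 - exp (-2 log cosh u)` is a concave function of `2 log cosh u`, and the right-hand
side is its tangent at `e`. Summing over the children with a common `e` gives Jensen's inequality.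
-/
theorem tanh_sq_le (u e : ℝ) :
    Real.tanh u ^ 2 ≤ 1 - Real.exp (-e) * (1 + e - 2 * Real.log (Real.cosh u)) := by
  have h1 : Real.tanh u ^ 2 = 1 - Real.exp (-2 * Real.log (Real.cosh u)) := by
    have hc := Real.cosh_pos u
    rw [neg_mul, Real.exp_neg, mul_comm, Real.exp_mul, Real.exp_log hc, Real.tanh_eq_sinh_div_cosh,
      div_pow, Real.rpow_two, Real.sinh_sq]
    field_simp
  have h2 : Real.exp (-2 * Real.log (Real.cosh u)) =
      Real.exp (-e) * Real.exp (e - 2 * Real.log (Real.cosh u)) := by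
    rw [← Real.exp_add]; congr 1; ring
  rw [h1, h2]
  have h3 := Real.add_one_le_exp (e - 2 * Real.log (Real.cosh u))
  have := mul_le_mul_of_nonneg_left h3 (Real.exp_pos (-e)).le
  linarith

theorem sum_tanh_sq_le {ι : Type*} (l : List ι) (u : ι → ℝ) (e : ℝ) :
    (l.map (fun c => Real.tanh (u c) ^ 2)).sum ≤
      l.length - Real.exp (-e) * (l.length * (1 + e) - 2 * sumLogCosh l u) := by
  unfold sumLogCosh
  induction l with
  | nil => simp
  | cons c l ih =>
    have := tanh_sq_le (u c) e
    simp only [List.map_cons, List.sum_cons, List.length_cons]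
    push_cast
    linarith

theorem sq_sum_map_le {ι : Type*} (l : List ι) (f : ι → ℝ) :
    (l.map f).sum ^ 2 ≤ l.length * (l.map (fun c => f c ^ 2)).sum := by
  rw [← Fin.sum_univ_fun_getElem, ← Fin.sum_univ_fun_getElem]
  simpa using sq_sum_le_card_mul_sum_sq (s := Finset.univ) (f := fun i : Fin l.length => f l[i.1])

/-- The gradient bound for the recursion below the uniqueness threshold. -/
theorem gradient_bound {ι : Type*} (l : List ι) {D : ℕ} (hD : 1 ≤ D) (hl : l.length ≤ D)
    {x Λ κ : ℝ} (hx : 0 < x) (hxΛ : x < Λ)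
    (hΛ : ∀ y : ℝ, 0 < y → y ≤ 1 → Λ * y ^ D * (D ^ 2 * (1 - y) - 1) ≤ 1)
    (hκ : κ ^ 2 = x * (1 + Λ) / ((1 + x) * Λ)) (u : ι → ℝ) :
    x * Real.exp (-2 * sumLogCosh l u) * (l.map (fun c => Real.tanh (u c))).sum ^ 2 ≤
      κ ^ 2 * (1 + x * Real.exp (-2 * sumLogCosh l u)) := by
  have hD' : (1 : ℝ) ≤ D := by exact_mod_cast hD
  have hl' : (l.length : ℝ) ≤ D := by exact_mod_cast hl
  have hS := sumLogCosh_nonneg l u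
  set S := sumLogCosh l u
  -- The mean is taken over `D` children, the missing ones counting as `u = 0`. This makes `exp
  -- (-2S)` exactly `y ^ D`.
  set e : ℝ := 2 * S / D with he
  have he0 : 0 ≤ e := by positivity
  set y : ℝ := Real.exp (-e) with hy
  have hy0 : 0 < y := Real.exp_pos _
  have hy1 : y ≤ 1 := Real.exp_le_one_iff.2 (by linarith)
  have hP : Real.exp (-2 * S) = y ^ D := by
    rw [hy, ← Real.exp_nat_mul, he]
    congr 1
    field_simp
  have hp1 : y ^ D ≤ 1 := pow_le_one₀ hy0.le hy1
  have hp0 : 0 < y ^ D := by positivity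
  have h1 := sum_tanh_sq_le l u e
  have hye : y * (1 + e) ≤ 1 := by
    have := mul_le_mul_of_nonneg_left (Real.add_one_le_exp e) hy0.le
    rw [hy, ← Real.exp_add, neg_add_cancel, Real.exp_zero] at this
    rw [hy]; linarith
  have h2 : (l.map (fun c => Real.tanh (u c) ^ 2)).sum ≤ D * (1 - y) := by
    refine h1.trans ?_
    have e2 : 2 * S = D * e := by rw [he]; field_simp
    change (l.length : ℝ) - y * (l.length * (1 + e) - 2 * S) ≤ _
    rw [e2]
    nlinarith
  have h3 : (l.map (fun c => Real.tanh (u c))).sum ^ 2 ≤ D ^ 2 * (1 - y) := by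
    refine (sq_sum_map_le l _).trans ?_
    calc (l.length : ℝ) * (l.map (fun c => Real.tanh (u c) ^ 2)).sum
        ≤ l.length * (D * (1 - y)) := by gcongr
      _ ≤ D * (D * (1 - y)) := by
        apply mul_le_mul_of_nonneg_right hl'
        have : 0 ≤ 1 - y := by linarith
        positivity
      _ = _ := by ring
  have hΛy := hΛ y hy0 hy1
  have hΛ0 : 0 < Λ := hx.trans hxΛ
  rw [hP, hκ]
  set p := y ^ D
  -- The hypothesis on `Λ` says that the gradient is at most 1 at the activity `Λ`. Passing down to
  -- `x` gains the factor `κ²`; that step amounts to `(Λ - x)(1 - p) ≥ 0`.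
  calc x * p * (l.map (fun c => Real.tanh (u c))).sum ^ 2 ≤ x * p * (D ^ 2 * (1 - y)) := by
        gcongr
    _ ≤ x * (1 + Λ * p) / Λ := by
        rw [le_div_iff₀ hΛ0]
        have := mul_le_mul_of_nonneg_left hΛy hx.le
        linarith
    _ ≤ x * (1 + Λ) / ((1 + x) * Λ) * (1 + x * p) := by
        rw [div_mul_eq_mul_div, div_le_div_iff₀ hΛ0 (by positivity)]
        have : 0 ≤ (Λ - x) * (1 - p) := mul_nonneg (by linarith) (by linarith)
        have h5 := mul_nonneg (mul_nonneg hx.le hΛ0.le) this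
        nlinarith

/-- Bernoulli's inequality for `a ^ (D + 1)` with `a = (D - 1)/(D y)`. Equality holds at `y = (D -
1)/D`, which is why the constant is the uniqueness threshold. -/
theorem tree_threshold_bound {D : ℕ} (hD : 2 ≤ D) {y : ℝ} (hy : 0 < y) :
    (D : ℝ) ^ D / (D - 1) ^ (D + 1) * y ^ D * (D ^ 2 * (1 - y) - 1) ≤ 1 := by
  have hD' : (2 : ℝ) ≤ D := by exact_mod_cast hD
  have hE : (0 : ℝ) < D - 1 := by linarith
  set a : ℝ := (D - 1) / (D * y) with ha
  have ha0 : 0 < a := by positivity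
  have h := one_add_mul_le_pow (a := a - 1) (by linarith) (D + 1)
  rw [add_sub_cancel] at h
  have e1 : a ^ (D + 1) = (D - 1) ^ (D + 1) / ((D : ℝ) ^ D * y ^ D * (D * y)) := by
    rw [ha, div_pow, mul_pow]
    congr 1
    ring
  have hDy : (0 : ℝ) < D * y := by positivity
  rw [e1, le_div_iff₀ (by positivity)] at h
  rw [div_mul_eq_mul_div, div_mul_eq_mul_div, div_le_one (by positivity)]
  refine le_trans (le_of_eq ?_) h
  rw [ha]
  push_cast
  field_simp
  ring

theorem exists_threshold {d : ℕ} (hd : 2 ≤ d) {x : ℝ} (hx : 0 < x)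
    (h : ENNReal.ofReal x < lambdaC d) :
    ∃ Λ, x < Λ ∧ ∀ y : ℝ, 0 < y → y ≤ 1 →
      Λ * y ^ (d - 1) * (((d - 1 : ℕ) : ℝ) ^ 2 * (1 - y) - 1) ≤ 1 := by
  rcases hd.eq_or_lt with rfl | hd
  -- For `d = 2` a node has at most one child, the bracket equals `-y`, and any `Λ` will do.
  · refine ⟨x + 1, by linarith, fun y hy hy1 => ?_⟩
    norm_num
    nlinarith [mul_pos hy hy]
  · obtain ⟨D, rfl⟩ : ∃ D, d = D + 1 := ⟨d - 1, by omega⟩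
    have hD : 2 ≤ D := by omega
    have hD' : (2 : ℝ) ≤ D := by exact_mod_cast hD
    refine ⟨(D : ℝ) ^ D / (D - 1) ^ (D + 1), ?_, fun y hy _ => by
      simpa using tree_threshold_bound hD hy⟩
    have e : lambdaC (D + 1) = ENNReal.ofReal ((D : ℝ) ^ D / (D - 1) ^ (D + 1)) := by
      have h1 : ((D + 1 : ℕ) : ENNReal) - 1 = ENNReal.ofReal D := by
        rw [ENNReal.ofReal_natCast]; push_cast; exact ENNReal.add_sub_cancel_right ENNReal.one_ne_top
      have h2 : ((D + 1 : ℕ) : ENNReal) - 2 = ENNReal.ofReal (D - 1) := by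
        rw [ENNReal.ofReal_sub _ zero_le_one, ENNReal.ofReal_natCast, ENNReal.ofReal_one]
        push_cast
        rw [← one_add_one_eq_two]
        exact ENNReal.add_sub_add_eq_sub_right ENNReal.one_ne_top
      rw [lambdaC, h1, h2, Nat.add_sub_cancel, ENNReal.ofReal_div_of_pos (by
        have : (0 : ℝ) < D - 1 := by linarith
        positivity), ENNReal.ofReal_pow (by linarith), ENNReal.ofReal_pow (by linarith)]
    rw [e] at h
    exact (ENNReal.ofReal_lt_ofReal_iff_of_nonneg hx.le).1 h

section

open scoped Classical

variable {V : Type*} [DecidableEq V] (G : SimpleGraph V)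

theorem indepSum_pos {V : Type*} (G : SimpleGraph V) {x : ℝ} (hx : 0 ≤ x) (S : Finset V) : 0 < indepSum G x S := by
  rw [indepSum]
  apply Finset.sum_pos'
  · intro I _; positivity
  · refine ⟨∅, ?_, by simp⟩
    simp [SimpleGraph.isIndepSet_iff]

theorem occRatio_nonneg {x : ℝ} (hx : 0 ≤ x) (c : Finset V × V) : 0 ≤ occRatio G x c :=
  div_nonneg (mul_nonneg hx (indepSum_pos G hx _).le) (indepSum_pos G hx _).le

theorem one_le_prod_one_add {ι : Type*} (l : List ι) {r : ι → ℝ} (h : ∀ c ∈ l, 0 ≤ r c) :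
    1 ≤ (l.map (fun c => 1 + r c)).prod := by
  induction l with
  | nil => simp
  | cons c l ih =>
    rw [List.map_cons, List.prod_cons]
    exact one_le_mul_of_one_le_of_one_le (by linarith [h c (by simp)])
      (ih fun c hc => h c (by simp [hc]))

theorem truncRatio_nonneg {x : ℝ} (hx : 0 ≤ x) (L : List V) (i : ℕ) (c : Finset V × V) :
    0 ≤ truncRatio G L x i c := by
  induction i generalizing c with
  | zero => exact le_rfl
  | succ i ih =>
    rw [truncRatio]
    exact div_nonneg hx (zero_le_one.trans (one_le_prod_one_add _ fun c _ => ih c))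

theorem truncRatio_le {x : ℝ} (hx : 0 ≤ x) (L : List V) (i : ℕ) (c : Finset V × V) :
    truncRatio G L x i c ≤ x := by
  cases i with
  | zero => exact hx
  | succ i =>
    rw [truncRatio]
    exact div_le_self hx (one_le_prod_one_add _ fun c _ => truncRatio_nonneg G hx L i c)

theorem occRatio_le [Fintype V] {x : ℝ} (hx : 0 ≤ x) (c : Finset V × V) : occRatio G x c ≤ x := by
  have hL : ∀ u, u ∈ (Finset.univ : Finset V).toList := by simp
  rw [occRatio_eq G x c.1 c.2 hL fun S _ => (indepSum_pos G hx S).ne']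
  exact div_le_self hx (one_le_prod_one_add _ fun c _ => occRatio_nonneg G hx c)

/-- The constant `κ` is left free: it is a genuine contraction at nodes with at most `D` children,
but only the crude `D + 1` is available for the topmost ratios, whose vertices have no parent to
lose. -/
theorem abs_arsinh_occRatio_sub_le_succ {x κ M : ℝ} (hx : 0 < x) {L : List V}
    (hL : ∀ u, u ∈ L) (i : ℕ) (S : Finset V) (v : V) (hκ0 : 0 ≤ κ) (hM0 : 0 ≤ M)
    (hκ : ∀ u : Finset V × V → ℝ, (∀ c ∈ kids (G.Adj v) (S.erase v) L, 0 ≤ u c) →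
      x * Real.exp (-2 * sumLogCosh (kids (G.Adj v) (S.erase v) L) u) *
        ((kids (G.Adj v) (S.erase v) L).map (fun c => Real.tanh (u c))).sum ^ 2 ≤
        κ ^ 2 * (1 + x * Real.exp (-2 * sumLogCosh (kids (G.Adj v) (S.erase v) L) u)))
    (hM : ∀ c ∈ kids (G.Adj v) (S.erase v) L,
      |Real.arsinh √(occRatio G x c) - Real.arsinh √(truncRatio G L x i c)| ≤ M) :
    |Real.arsinh √(occRatio G x (S, v)) - Real.arsinh √(truncRatio G L x (i + 1) (S, v))| ≤
      κ * M := by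
  rw [occRatio_eq G x S v hL fun S _ => (indepSum_pos G hx.le S).ne', truncRatio_succ]
  exact abs_arsinh_sqrt_sub_le _ _ _ hx (fun c _ => occRatio_nonneg G hx.le c)
    (fun c _ => truncRatio_nonneg G hx.le L i c) hκ hκ0 hM0 hM

theorem abs_arsinh_occRatio_sub_le [Fintype V] {D : ℕ} (hD : 1 ≤ D)
    (hG : ∀ v, (Finset.univ.filter (G.Adj v)).card ≤ D + 1) {x Λ κ : ℝ} (hx : 0 < x)
    (hxΛ : x < Λ) (hΛ : ∀ y : ℝ, 0 < y → y ≤ 1 → Λ * y ^ D * (D ^ 2 * (1 - y) - 1) ≤ 1)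
    (hκ0 : 0 ≤ κ) (hκ : κ ^ 2 = x * (1 + Λ) / ((1 + x) * Λ)) {L : List V} (hL : ∀ u, u ∈ L)
    (i : ℕ) (c : Finset V × V) (hc : ((c.1.erase c.2).filter (G.Adj c.2)).card ≤ D) :
    |Real.arsinh √(occRatio G x c) - Real.arsinh √(truncRatio G L x i c)| ≤
      κ ^ i * Real.arsinh √x := by
  have hB : 0 ≤ Real.arsinh √x := Real.arsinh_nonneg_iff.2 (Real.sqrt_nonneg _)
  induction i generalizing c with
  | zero =>
    rw [truncRatio, Real.sqrt_zero, Real.arsinh_zero, sub_zero, pow_zero, one_mul,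
      abs_of_nonneg (Real.arsinh_nonneg_iff.2 (Real.sqrt_nonneg _))]
    exact Real.arsinh_le_arsinh.2 (Real.sqrt_le_sqrt (occRatio_le G hx.le c))
  | succ i ih =>
    obtain ⟨S, v⟩ := c
    rw [pow_succ', mul_assoc]
    refine abs_arsinh_occRatio_sub_le_succ G hx hL i S v hκ0 (by positivity) ?_ ?_
    · intro u _
      exact gradient_bound _ hD ((length_kids_le _ _ _).trans hc) hx hxΛ hΛ hκ u
    · intro c hc
      exact ih c (card_filter_adj_le_of_mem_kids G hG hc)

theorem tanh_sum_sq_le {ι : Type*} (l : List ι) (u : ι → ℝ) :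
    (l.map (fun c => Real.tanh (u c))).sum ^ 2 ≤ (l.length : ℝ) ^ 2 := by
  refine (sq_sum_map_le l _).trans ?_
  rw [sq]
  apply mul_le_mul_of_nonneg_left _ (Nat.cast_nonneg _)
  have : (l.map (fun c => Real.tanh (u c) ^ 2)).sum ≤ (l.map (fun _ => (1 : ℝ))).sum := by
    apply List.sum_le_sum
    intro c _
    rw [sq_le_one_iff_abs_le_one]
    exact (Real.abs_tanh_lt_one _).le
  simpa using this

/-- Back to the original coordinate: `r = sinh² u` has derivative `2 sinh u cosh u ≤ 2(1 + x)` as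
long as `r ≤ x`. -/
theorem abs_sub_le_of_arsinh {a b x M : ℝ} (ha : 0 ≤ a) (hb : 0 ≤ b) (hax : a ≤ x) (hbx : b ≤ x)
    (h : |Real.arsinh √a - Real.arsinh √b| ≤ M) : |a - b| ≤ 2 * (1 + x) * M := by
  wlog hab : b ≤ a generalizing a b
  · rw [abs_sub_comm]
    exact this hb ha hbx hax (by rwa [abs_sub_comm]) (by linarith)
  have hx : 0 ≤ x := ha.trans hax
  have hM : 0 ≤ M := (abs_nonneg _).trans h
  have h1 : √b ≤ √a := Real.sqrt_le_sqrt hab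
  have h2 : √a ≤ √(1 + x) := Real.sqrt_le_sqrt (by linarith)
  have h3 : √a - √b ≤ √(1 + x) * M := by
    have := (convex_Icc (Real.arsinh √b) (Real.arsinh √a)).norm_image_sub_le_of_norm_hasDerivWithin_le
      (f := Real.sinh) (f' := Real.cosh) (C := √(1 + x))
      (fun t _ => (Real.hasDerivAt_sinh t).hasDerivWithinAt) (fun t ht => by
        rw [Real.norm_of_nonneg (Real.cosh_pos _).le]
        have h0 : 0 ≤ t := (Real.arsinh_nonneg_iff.2 (Real.sqrt_nonneg b)).trans ht.1
        have : Real.cosh t ≤ Real.cosh (Real.arsinh √a) :=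
          Real.cosh_le_cosh.2 (abs_le_abs_of_nonneg h0 ht.2)
        refine this.trans ?_
        rw [Real.cosh_arsinh, Real.sq_sqrt ha]
        exact Real.sqrt_le_sqrt (by linarith))
      (x := Real.arsinh √b) (y := Real.arsinh √a)
      (Set.left_mem_Icc.2 (Real.arsinh_le_arsinh.2 h1))
      (Set.right_mem_Icc.2 (Real.arsinh_le_arsinh.2 h1))
    rw [Real.sinh_arsinh, Real.sinh_arsinh, Real.norm_eq_abs, Real.norm_eq_abs] at this
    refine (le_abs_self _).trans (this.trans ?_)
    gcongr
  have e : a - b = (√a - √b) * (√a + √b) := by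
    have := Real.sq_sqrt ha
    have := Real.sq_sqrt hb
    nlinarith
  rw [abs_of_nonneg (by linarith), e]
  calc (√a - √b) * (√a + √b) ≤ (√(1 + x) * M) * (√(1 + x) + √(1 + x)) := by
        apply mul_le_mul h3 (by linarith) (by positivity) (by positivity)
    _ = 2 * (√(1 + x) ^ 2) * M := by ring
    _ = _ := by rw [Real.sq_sqrt (by linarith)]

/-- On the positive axis below the uniqueness threshold, the truncated recursion is accurate for
all sufficiently small values of the parameter `α`. -/
theorem exists_isApprox_truncPoly_of_pos {D : ℕ} (hD : 1 ≤ D) {x Λ : ℝ} (hx : 0 < x)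
    (hxΛ : x < Λ) (hΛ : ∀ y : ℝ, 0 < y → y ≤ 1 → Λ * y ^ D * (D ^ 2 * (1 - y) - 1) ≤ 1) :
    ∃ α : ℝ, 0 < α ∧ α ≤ 1 ∧ ∀ (n : ℕ) (G : SimpleGraph (Fin n)) (L : List (Fin n)),
      (∀ u, u ∈ L) → (∀ v, (Finset.univ.filter (G.Adj v)).card ≤ D + 1) → 1 ≤ n →
      ∀ (ε : ℝ) (m k : ℕ), 0 < ε → ε ≤ 1 → 1 ≤ (m : ℝ) ^ 2 * α →
        4 * (n : ℝ) ≤ 2 ^ k * (ε * α) →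
        IsApprox ε (truncPoly G L x (2 * m * k)) (indepPoly G (fun _ => (x : ℂ))) := by
  have hΛ0 : 0 < Λ := hx.trans hxΛ
  set κ := √(x * (1 + Λ) / ((1 + x) * Λ)) with hκdef
  have hq : x * (1 + Λ) / ((1 + x) * Λ) < 1 := by
    rw [div_lt_one (by positivity)]; nlinarith
  have hκ : κ ^ 2 = x * (1 + Λ) / ((1 + x) * Λ) := Real.sq_sqrt (by positivity)
  have hκ0 : 0 < κ := Real.sqrt_pos.2 (by positivity)
  have hκ1 : κ < 1 := by
    rw [hκdef, Real.sqrt_lt' one_pos]; simpa using hq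
  obtain ⟨m₀, hm₀⟩ := exists_pow_lt_of_lt_one (by norm_num : (0 : ℝ) < 1 / 4) hκ1
  set B := Real.arsinh √x
  have hB : 0 ≤ B := Real.arsinh_nonneg_iff.2 (Real.sqrt_nonneg _)
  set M := 2 * (1 + x) * ((D + 1) * (κ⁻¹ * B))
  have hM : 0 ≤ M := by positivity
  -- This `α` satisfies `M α ≤ 1`, and `m² α ≥ 1` forces `m ≥ m₀`, so that `κ ^ (2m) ≤ 1/4`.
  refine ⟨(1 + M + (m₀ : ℝ) ^ 2)⁻¹, by positivity, inv_le_one_of_one_le₀ (by nlinarith), ?_⟩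
  intro n G L hL hG hn ε m k hε hε1 hm hk
  set α := (1 + M + (m₀ : ℝ) ^ 2)⁻¹
  have hα : 0 < α := by positivity
  have hα1 : α ≤ 1 := inv_le_one_of_one_le₀ (by nlinarith)
  have hMα : M * α ≤ 1 := by
    rw [← div_eq_mul_inv, div_le_one (by positivity)]; nlinarith
  have hn' : (1 : ℝ) ≤ n := by exact_mod_cast hn
  have hmm : m₀ ≤ m := by
    have h1 : (m₀ : ℝ) ^ 2 * α ≤ 1 := by
      rw [← div_eq_mul_inv, div_le_one (by positivity)]; linarith
    have h2 : (m₀ : ℝ) ^ 2 ≤ (m : ℝ) ^ 2 := le_of_mul_le_mul_right (h1.trans hm) hα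
    have := sq_le_sq.1 h2
    rw [Nat.abs_cast, Nat.abs_cast] at this
    exact_mod_cast this
  have hm1 : 1 ≤ m := by
    rcases Nat.eq_zero_or_pos m with rfl | h
    · norm_num at hm
    · exact h
  have hk1 : 1 ≤ k := by
    rcases Nat.eq_zero_or_pos k with rfl | h
    · rw [pow_zero, one_mul] at hk
      have : ε * α ≤ 1 := mul_le_one₀ hε1 hα.le hα1
      linarith
    · exact h
  -- One level is spent on the topmost ratios, which do not contract; the factor `κ⁻¹` in `M` pays
  -- for it.
  obtain ⟨j, hj⟩ : ∃ j, 2 * m * k = j + 1 := ⟨2 * m * k - 1, by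
    have : 1 ≤ 2 * m * k := Nat.mul_pos (by omega) hk1
    omega⟩
  -- The decay is twice as fast as needed: one factor `2^(-k)` yields the accuracy, the other one
  -- absorbs the constant `M`.
  have hpow : κ ^ (2 * m * k) ≤ ((1 / 2) ^ k) ^ 2 := by
    have : κ ^ (2 * m) ≤ 1 / 4 :=
      (pow_le_pow_of_le_one hκ0.le hκ1.le (by omega)).trans hm₀.le
    calc κ ^ (2 * m * k) = (κ ^ (2 * m)) ^ k := pow_mul _ _ _
      _ ≤ (1 / 4) ^ k := by gcongr
      _ = ((1 / 2) ^ k) ^ 2 := by rw [← pow_mul, mul_comm, pow_mul]; norm_num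
  have hposne : ∀ S, indepSum G (x : ℂ) S ≠ 0 := fun S => by
    rw [indepSum_ofReal]; exact_mod_cast (indepSum_pos G hx.le S).ne'
  have hocc : ∀ c, occRatio G (x : ℂ) c = (occRatio G x c : ℝ) := fun c => by
    rw [occRatio, occRatio, indepSum_ofReal, indepSum_ofReal]; push_cast; rfl
  rw [IsApprox, truncPoly, indepPoly_eq_indepSum, indepSum_univ_eq_prod_kids G (x : ℂ) hL hposne]
  set θ := 2 * (1 + x) * ((D + 1) * (κ ^ j * B)) with hθ
  have hθM : θ = M * κ ^ (2 * m * k) := by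
    rw [hj, pow_succ, hθ]
    simp only [M]
    field_simp
  refine norm_prod_sub_prod_le_of_mul_le _ _ _ (θ := θ) (by positivity) ?_ hε1 ?_
  · intro c _
    obtain ⟨S, v⟩ := c
    have h0 := occRatio_nonneg G hx.le (S, v)
    have h1 : |Real.arsinh √(occRatio G x (S, v)) -
        Real.arsinh √(truncRatio G L x (j + 1) (S, v))| ≤ (D + 1) * (κ ^ j * B) := by
      refine abs_arsinh_occRatio_sub_le_succ G hx hL j S v (by positivity) (by positivity) ?_ ?_
      · intro u _
        have h2 := tanh_sum_sq_le (kids (G.Adj v) (S.erase v) L) u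
        have h3 : ((kids (G.Adj v) (S.erase v) L).length : ℝ) ≤ D + 1 := by
          exact_mod_cast (length_kids_le _ _ _).trans
            ((Finset.card_le_card (Finset.filter_subset_filter _ (Finset.subset_univ _))).trans
              (hG v))
        have h4 : ((kids (G.Adj v) (S.erase v) L).length : ℝ) ^ 2 ≤ (D + 1 : ℝ) ^ 2 := by gcongr
        have h5 : 0 < x * Real.exp (-2 * sumLogCosh (kids (G.Adj v) (S.erase v) L) u) := by
          positivity
        have h6 : (0 : ℝ) ≤ (D + 1 : ℝ) ^ 2 := by positivity
        nlinarith [mul_le_mul_of_nonneg_left (h2.trans h4) h5.le]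
      · intro c hc
        exact abs_arsinh_occRatio_sub_le G hD hG hx hxΛ hΛ hκ0.le hκ hL j c
          (card_filter_adj_le_of_mem_kids G hG hc)
    have h2 := abs_sub_le_of_arsinh h0 (truncRatio_nonneg G hx.le L (j + 1) (S, v))
      (occRatio_le G hx.le _) (truncRatio_le G hx.le _ _ _) h1
    rw [hj, truncRatio_ofReal, hocc, norm_sub_rev, ← Complex.ofReal_sub, Complex.norm_real,
      Real.norm_eq_abs, ← Complex.ofReal_one, ← Complex.ofReal_add, Complex.norm_real,
      Real.norm_of_nonneg (by linarith)]
    have hθ0 : 0 ≤ θ := by positivity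
    nlinarith
  · have hl : ((kids (fun _ : Fin n => True) Finset.univ L).length : ℝ) ≤ n := by
      exact_mod_cast (length_kids_univ_le L).trans (by simp)
    have hinv : (1 / 2 : ℝ) ^ k ≤ ε * α / (4 * n) := by
      rw [one_div, inv_pow, ← one_div, div_le_div_iff₀ (by positivity) (by positivity)]
      linarith
    calc _ ≤ (n : ℝ) * (M * ((ε * α / (4 * n)) ^ 2)) := by
          rw [hθM]
          gcongr
          exact hpow.trans (pow_le_pow_left₀ (by positivity) hinv 2)
      _ = (M * α) * α * ε * ε / (16 * n) := by field_simp; ring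
      _ ≤ 1 * 1 * 1 * ε / (16 * 1) := by gcongr
      _ ≤ ε / 2 := by linarith

end

end PositiveDecay

/-! ### Running programs -/

section Machine

theorem RamState.writeNat_nat (s : RamState) (a i k b j : ℕ) :
    (s.writeNat a i k).nat b j = if b = a ∧ j = i then k else s.nat b j := by
  simp only [RamState.writeNat, Function.update_apply]
  split_ifs <;> simp_all

theorem RamState.writeNat_real (s : RamState) (a i k : ℕ) :
    (s.writeNat a i k).real = s.real := rfl

theorem RamState.writeReal_nat (s : RamState) (a i : ℕ) (x : ℝ) :
    (s.writeReal a i x).nat = s.nat := rfl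

theorem RamState.writeReal_real (s : RamState) (a i : ℕ) (x : ℝ) (b j : ℕ) :
    (s.writeReal a i x).real b j = if b = a ∧ j = i then x else s.real b j := by
  simp only [RamState.writeReal, Function.update_apply]
  split_ifs <;> simp_all

/-- The programs without tests and loops. -/
def RamProg.Straight : RamProg → Prop
  | .skip => True
  | .setNat _ _ _ => True
  | .setReal _ _ _ => True
  | .seq p q => p.Straight ∧ q.Straight
  | .ite _ _ _ => False
  | .loop _ _ => False

/-- The final state of a program without tests and loops. -/
noncomputable def RamProg.run : RamProg → RamState → RamState
  | .skip, s => s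
  | .setNat a i e, s => s.writeNat a (i.eval s) (e.eval s)
  | .setReal a i e, s => s.writeReal a (i.eval s) (e.eval s)
  | .seq p q, s => q.run (p.run s)
  | .ite _ _ _, s => s
  | .loop _ _, s => s

/-- The running time of a program without tests and loops. -/
def RamProg.time : RamProg → ℕ
  | .skip => 1
  | .setNat _ i e => i.cost + e.cost + 1
  | .setReal _ i e => i.cost + e.cost + 1
  | .seq p q => p.time + q.time
  | .ite _ _ _ => 0
  | .loop _ _ => 0

theorem RamProg.Straight.exec {p : RamProg} (h : p.Straight) (s : RamState) :
    Exec p s (p.run s) p.time := by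
  induction p generalizing s with
  | skip => exact .skip s
  | setNat a i e => exact .setNat s a i e
  | setReal a i e => exact .setReal s a i e
  | seq p q ihp ihq => exact .seq (ihp h.1 s) (ihq h.2 _)
  | ite => exact h.elim
  | loop => exact h.elim

/-- The rule for loops with a counter. -/
theorem exec_loop {b : RamTest} {p : RamProg} {T N : ℕ} (I : ℕ → RamState → Prop)
    (hstep : ∀ i < N, ∀ s, I i s → b.holds s ∧ ∃ s' t, Exec p s s' t ∧ t ≤ T ∧ I (i + 1) s')
    (hend : ∀ s, I N s → ¬ b.holds s) {s : RamState} (h0 : I 0 s) :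
    ∃ s' t, Exec (.loop b p) s s' t ∧ t ≤ N * (b.cost + T) + b.cost ∧ I N s' := by
  suffices h : ∀ k i s, i + k = N → I i s →
      ∃ s' t, Exec (.loop b p) s s' t ∧ t ≤ k * (b.cost + T) + b.cost ∧ I N s' from
    h N 0 s (by omega) h0
  intro k
  induction k with
  | zero =>
    intro i s hi hI
    obtain rfl : i = N := by omega
    exact ⟨s, _, .loopStop (hend s hI), by omega, hI⟩
  | succ k ih =>
    intro i s hi hI
    obtain ⟨hb, s', t, hp, ht, hI'⟩ := hstep i (by omega) s hI
    obtain ⟨s'', u, hl, hu, hI''⟩ := ih (i + 1) s' (by omega) hI'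
    refine ⟨s'', _, .loopStep hb hp hl, ?_, hI''⟩
    rw [Nat.succ_mul]
    omega

/-- Within time `t` the loop passes from the state `s` to the state `s'`. -/
def Reach (b : RamTest) (p : RamProg) (s s' : RamState) (t : ℕ) : Prop :=
  ∀ s'' u, Exec (.loop b p) s' s'' u → ∃ u', Exec (.loop b p) s s'' u' ∧ u' ≤ t + u

theorem Reach.refl (b : RamTest) (p : RamProg) (s : RamState) : Reach b p s s 0 :=
  fun _ u h => ⟨u, h, by omega⟩

theorem Reach.trans {b : RamTest} {p : RamProg} {s s' s'' : RamState} {t u v : ℕ}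
    (h : Reach b p s s' t) (h' : Reach b p s' s'' u) (hv : t + u ≤ v) : Reach b p s s'' v := by
  intro s₃ w hw
  obtain ⟨w', h1, h2⟩ := h' s₃ w hw
  obtain ⟨w'', h3, h4⟩ := h s₃ w' h1
  exact ⟨w'', h3, by omega⟩

theorem Reach.of_exec {b : RamTest} {p : RamProg} {s s' : RamState} {t v : ℕ}
    (hb : b.holds s) (h : Exec p s s' t) (hv : b.cost + t ≤ v) : Reach b p s s' v :=
  fun _ _ hu => ⟨_, .loopStep hb h hu, by omega⟩

end Machine

/-! ### The program

Natural number arrays: 2 the level, 3 the offset `level * n`, 4 the depth, 5 a counter, 6 and 12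
parameters, 7 the offsets of the adjacency rows of the vertices on the stack, 8 the multiples of
`n`, 9 the scan positions, 10 the vertex sets (one block of `n` cells for each level), 11 an
accumulator. Real arrays: 2 and 3 the accumulated products, 4 to 7 scratch. -/

section Program

/-- A natural number variable. -/
def nvar (a : ℕ) : NatExpr := .get a (.lit 0)

/-- A real variable. -/
def rvar (a : ℕ) : RealExpr := .get a (.lit 0)

/-- The real variable of the current level. -/
def rtop (a : ℕ) : RealExpr := .get a (nvar 2)

/-- The scan position of the current level. -/
def ptrTop : NatExpr := .get 9 (nvar 2)

def progAdvance : RamProg := .setNat 9 (nvar 2) (.add ptrTop (.lit 1))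

/-- The vertex is deleted from the current set before the set is copied, so both the child and the
later siblings lose it. -/
def progPushPre : RamProg :=
  .seq (.setNat 10 (.add (nvar 3) ptrTop) (.lit 0)) (.setNat 5 (.lit 0) (.lit 0))

def testCopy : RamTest := .natLe (.add (nvar 5) (.lit 1)) (nvar 0)

def progCopyBody : RamProg :=
  .seq (.setNat 10 (.add (.add (nvar 3) (nvar 0)) (nvar 5)) (.get 10 (.add (nvar 3) (nvar 5))))
    (.setNat 5 (.lit 0) (.add (nvar 5) (.lit 1)))

/-- The order matters: the row offset is read before the scan position advances, and the level
changes last because the addresses depend on it. The accumulator of the new frame starts as the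
empty product. -/
def progPushPost : RamProg :=
  .seq (.setNat 7 (.add (nvar 2) (.lit 1)) (.get 8 ptrTop))
  (.seq (.setNat 9 (.add (nvar 2) (.lit 1)) (.lit 0))
  (.seq (.setReal 2 (.add (nvar 2) (.lit 1)) (.ofNat (.lit 1)))
  (.seq (.setReal 3 (.add (nvar 2) (.lit 1)) (.ofNat (.lit 0)))
  (.seq (.setNat 9 (nvar 2) (.add ptrTop (.lit 1)))
  (.seq (.setNat 3 (.lit 0) (.add (nvar 3) (nvar 0)))
    (.setNat 2 (.lit 0) (.add (nvar 2) (.lit 1))))))))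

def progPush : RamProg := .seq progPushPre (.seq (.loop testCopy progCopyBody) progPushPost)

/-- Once `1 + z / acc` is in the scratch cells 4 and 5, lowering the level makes `rtop` refer to the
parent. Cell 6 holds the new real part until the imaginary part, which needs the old one, has been
computed. -/
def progPop : RamProg :=
  .seq (.setReal 6 (.lit 0) (.add (.mul (rtop 2) (rtop 2)) (.mul (rtop 3) (rtop 3))))
  (.seq (.setReal 4 (.lit 0) (.div (.add (.mul (rvar 0) (rtop 2))
    (.mul (.get 0 (.lit 1)) (rtop 3))) (rvar 6)))
  (.seq (.setReal 5 (.lit 0) (.div (.sub (.mul (.get 0 (.lit 1)) (rtop 2))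
    (.mul (rvar 0) (rtop 3))) (rvar 6)))
  (.seq (.setReal 4 (.lit 0) (.add (rvar 4) (.ofNat (.lit 1))))
  (.seq (.setNat 2 (.lit 0) (.sub (nvar 2) (.lit 1)))
  (.seq (.setNat 3 (.lit 0) (.sub (nvar 3) (nvar 0)))
  (.seq (.setReal 6 (.lit 0) (.sub (.mul (rtop 2) (rvar 4)) (.mul (rtop 3) (rvar 5))))
  (.seq (.setReal 3 (nvar 2) (.add (.mul (rtop 2) (rvar 5)) (.mul (rtop 3) (rvar 4))))
    (.setReal 2 (nvar 2) (rvar 6)))))))))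

def testPush : RamTest :=
  .conj (.natLe (.add (nvar 2) (.lit 1)) (nvar 4))
    (.conj (.natLe (.lit 1) (.get 1 (.add (.get 7 (nvar 2)) ptrTop)))
      (.natLe (.lit 1) (.get 10 (.add (nvar 3) ptrTop))))

def progBody : RamProg :=
  .ite (.natLe (nvar 0) ptrTop) progPop (.ite testPush progPush progAdvance)

def testMain : RamTest := .neg (.conj (.natLe (nvar 2) (.lit 0)) (.natLe (nvar 0) ptrTop))

variable {n : ℕ}

/-- The contents of the stack frame at the level `l`. -/
structure FrameAt (l : ℕ) (N : Fin n → Prop) (S : Finset (Fin n)) (p : ℕ) (acc : ℂ)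
    (s : RamState) : Prop where
  row : ∀ u : Fin n, 1 ≤ s.nat 1 (s.nat 7 l + u) ↔ N u
  set : ∀ u : Fin n, 1 ≤ s.nat 10 (l * n + u) ↔ u ∈ S
  ptr : s.nat 9 l = p
  re : s.real 2 l = acc.re
  im : s.real 3 l = acc.im

/-- The global contents of the memory, when the current level is `l`. -/
structure StackAt (G : SimpleGraph (Fin n)) (z : ℂ) (J l : ℕ) (s : RamState) : Prop where
  size : s.nat 0 0 = n
  adj : ∀ v u : Fin n, 1 ≤ s.nat 1 ((v : ℕ) * n + u) ↔ G.Adj v u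
  rows : ∀ u : Fin n, s.nat 8 u = u * n
  depth : s.nat 4 0 = J
  re : s.real 0 0 = z.re
  im : s.real 0 1 = z.im
  level : s.nat 2 0 = l
  base : s.nat 3 0 = l * n

/-- Nothing below the level `l` has changed. -/
structure SameBelow (n l : ℕ) (s s' : RamState) : Prop where
  adj : s'.nat 1 = s.nat 1
  row : ∀ j < l, s'.nat 7 j = s.nat 7 j
  ptr : ∀ j < l, s'.nat 9 j = s.nat 9 j
  set : ∀ j < l * n, s'.nat 10 j = s.nat 10 j
  re : ∀ j < l, s'.real 2 j = s.real 2 j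
  im : ∀ j < l, s'.real 3 j = s.real 3 j

theorem SameBelow.refl (n l : ℕ) (s : RamState) : SameBelow n l s s :=
  ⟨rfl, fun _ _ => rfl, fun _ _ => rfl, fun _ _ => rfl, fun _ _ => rfl, fun _ _ => rfl⟩

theorem SameBelow.trans {l : ℕ} {s s' s'' : RamState} (h : SameBelow n l s s')
    (h' : SameBelow n l s' s'') : SameBelow n l s s'' :=
  ⟨h'.adj.trans h.adj, fun j hj => (h'.row j hj).trans (h.row j hj),
    fun j hj => (h'.ptr j hj).trans (h.ptr j hj), fun j hj => (h'.set j hj).trans (h.set j hj),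
    fun j hj => (h'.re j hj).trans (h.re j hj), fun j hj => (h'.im j hj).trans (h.im j hj)⟩

theorem SameBelow.of_succ {l : ℕ} {s s' : RamState} (h : SameBelow n (l + 1) s s') :
    SameBelow n l s s' :=
  ⟨h.adj, fun j hj => h.row j (by omega), fun j hj => h.ptr j (by omega),
    fun j hj => h.set j (by rw [Nat.succ_mul]; omega), fun j hj => h.re j (by omega),
    fun j hj => h.im j (by omega)⟩

theorem FrameAt.of_sameBelow {l : ℕ} {N : Fin n → Prop} {S : Finset (Fin n)} {p : ℕ} {acc : ℂ}
    {s s' : RamState} (h : FrameAt l N S p acc s) (h' : SameBelow n (l + 1) s s') :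
    FrameAt l N S p acc s' where
  row u := by rw [h'.adj, h'.row l (by omega)]; exact h.row u
  set u := by
    rw [h'.set _ (by rw [Nat.succ_mul]; have := u.2; omega)]; exact h.set u
  ptr := by rw [h'.ptr l (by omega)]; exact h.ptr
  re := by rw [h'.re l (by omega)]; exact h.re
  im := by rw [h'.im l (by omega)]; exact h.im

theorem exec_advance {G : SimpleGraph (Fin n)} {z : ℂ} {J l : ℕ} {N : Fin n → Prop}
    {S : Finset (Fin n)} {p : ℕ} {acc : ℂ} {s : RamState} (hs : StackAt G z J l s)
    (hf : FrameAt l N S p acc s) :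
    ∃ s', Exec progAdvance s s' 8 ∧ StackAt G z J l s' ∧ FrameAt l N S (p + 1) acc s' ∧
      SameBelow n l s s' := by
  refine ⟨_, RamProg.Straight.exec (by simp [RamProg.Straight, progAdvance]) s, ?_, ?_, ?_⟩
  · constructor <;> simp [progAdvance, RamProg.run, RamState.writeNat_nat, RamState.writeNat_real,
      NatExpr.eval, nvar, ptrTop, hs.size, hs.adj, hs.rows, hs.depth, hs.re, hs.im, hs.level,
      hs.base]
  · constructor <;> simp [progAdvance, RamProg.run, RamState.writeNat_nat, RamState.writeNat_real,
      NatExpr.eval, nvar, ptrTop, hs.level, hf.ptr, hf.row, hf.set, hf.re, hf.im]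
  · constructor <;> simp +contextual [progAdvance, RamProg.run, RamState.writeNat_nat,
      RamState.writeNat_real, NatExpr.eval, nvar, ptrTop, hs.level]
    · ext; simp [RamState.writeNat_nat]
    · intro j hj hj'; omega

theorem exec_copy {s : RamState} {b : ℕ} (hn : s.nat 0 0 = n) (hb : s.nat 3 0 = b)
    (hi : s.nat 5 0 = 0) :
    ∃ s' t, Exec (.loop testCopy progCopyBody) s s' t ∧ t ≤ 31 * n + 7 ∧
      (∀ j < n, s'.nat 10 (b + n + j) = s.nat 10 (b + j)) ∧
      (∀ j < b + n, s'.nat 10 j = s.nat 10 j) ∧ (∀ a, a ≠ 5 → a ≠ 10 → s'.nat a = s.nat a) ∧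
      s'.real = s.real := by
  obtain ⟨s', t, he, ht, h1, h2, h3, h4, h5⟩ := exec_loop (b := testCopy) (p := progCopyBody)
    (T := 24) (N := n)
    (fun i s' => s'.nat 5 0 = i ∧ (∀ j < i, s'.nat 10 (b + n + j) = s.nat 10 (b + j)) ∧
      (∀ j < b + n, s'.nat 10 j = s.nat 10 j) ∧ (∀ a, a ≠ 5 → a ≠ 10 → s'.nat a = s.nat a) ∧
      s'.real = s.real)
    (by
      rintro i hiN s' ⟨h1, h2, h3, h4, h5⟩
      have hn' : s'.nat 0 0 = n := by rw [h4 0 (by norm_num) (by norm_num), hn]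
      have hb' : s'.nat 3 0 = b := by rw [h4 3 (by norm_num) (by norm_num), hb]
      refine ⟨?_, _, _, RamProg.Straight.exec (by simp [RamProg.Straight, progCopyBody]) s',
        (by decide : progCopyBody.time ≤ 24), ?_, ?_, ?_, ?_, ?_⟩
      · simp [testCopy, RamTest.holds, NatExpr.eval, nvar, h1, hn']; omega
      · simp [progCopyBody, RamProg.run, RamState.writeNat_nat, NatExpr.eval, nvar, h1]
      · intro j hj
        simp only [progCopyBody, RamProg.run, RamState.writeNat_nat, NatExpr.eval, nvar, h1, hn',
          hb']
        rcases Nat.lt_succ_iff_lt_or_eq.1 hj with hj | rfl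
        · simp [show j ≠ i by omega, h2 j hj]
        · simp [h3 (b + j) (by omega)]
      · intro j hj
        simp only [progCopyBody, RamProg.run, RamState.writeNat_nat, NatExpr.eval, nvar, h1, hn',
          hb']
        simp [show j ≠ b + n + i by omega, h3 j hj]
      · intro a ha ha'
        ext j
        simp [progCopyBody, RamProg.run, RamState.writeNat_nat, ha, ha', h4 a ha ha']
      · simp [progCopyBody, RamProg.run, RamState.writeNat_real, h5])
    (by
      rintro s' ⟨h1, h2, h3, h4, h5⟩
      simp [testCopy, RamTest.holds, NatExpr.eval, nvar, h1, h4, hn])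
    (s := s) ⟨hi, by simp, by simp, by simp, rfl⟩
  exact ⟨s', t, he, ht.trans (by rw [show testCopy.cost = 7 by decide]; omega), h2, h3, h4, h5⟩

theorem exec_push {G : SimpleGraph (Fin n)} {z : ℂ} {J l : ℕ} {N : Fin n → Prop}
    {S : Finset (Fin n)} {u : Fin n} {acc : ℂ} {s : RamState} (hs : StackAt G z J l s)
    (hf : FrameAt l N S u acc s) :
    ∃ s' t, Exec progPush s s' t ∧ t ≤ 31 * n + 100 ∧ StackAt G z J (l + 1) s' ∧
      FrameAt l N (S.erase u) (u + 1) acc s' ∧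
      FrameAt (l + 1) (G.Adj u) (S.erase u) 0 1 s' ∧ SameBelow n l s s' := by
  have e1 := RamProg.Straight.exec (p := progPushPre) (by simp [RamProg.Straight, progPushPre]) s
  have hu := u.2
  set s₁ := progPushPre.run s with hs₁
  have a1 : ∀ a, a ≠ 5 → a ≠ 10 → s₁.nat a = s.nat a := by
    intro a ha ha'
    ext j
    simp [hs₁, progPushPre, RamProg.run, RamState.writeNat_nat, ha, ha']
  have a2 : ∀ j, s₁.nat 10 j = if j = l * n + u then 0 else s.nat 10 j := by
    intro j
    simp [hs₁, progPushPre, RamProg.run, RamState.writeNat_nat, NatExpr.eval, nvar, ptrTop,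
      hs.base, hs.level, hf.ptr]
  have a3 : s₁.real = s.real := by
    simp [hs₁, progPushPre, RamProg.run, RamState.writeNat_real]
  have a4 : s₁.nat 5 0 = 0 := by
    simp [hs₁, progPushPre, RamProg.run, RamState.writeNat_nat, NatExpr.eval]
  obtain ⟨s₂, t, e2, ht, b1, b2, b3, b4⟩ := exec_copy (n := n) (s := s₁) (b := l * n)
    (by rw [a1 0 (by norm_num) (by norm_num), hs.size])
    (by rw [a1 3 (by norm_num) (by norm_num), hs.base]) a4
  have c1 : ∀ a, a ≠ 5 → a ≠ 10 → s₂.nat a = s.nat a := fun a ha ha' =>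
    (b3 a ha ha').trans (a1 a ha ha')
  have c2 : s₂.real = s.real := b4.trans a3
  have e3 := RamProg.Straight.exec (p := progPushPost)
    (by simp [RamProg.Straight, progPushPost]) s₂
  set s₃ := progPushPost.run s₂ with hs₃
  have d0 : s₃.nat 10 = s₂.nat 10 := by
    ext j
    simp [hs₃, progPushPost, RamProg.run, RamState.writeNat_nat, RamState.writeReal_nat]
  have f1 : s₂.nat 0 = s.nat 0 := c1 0 (by norm_num) (by norm_num)
  have f2 : s₂.nat 1 = s.nat 1 := c1 1 (by norm_num) (by norm_num)
  have f3 : s₂.nat 2 = s.nat 2 := c1 2 (by norm_num) (by norm_num)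
  have f4 : s₂.nat 3 = s.nat 3 := c1 3 (by norm_num) (by norm_num)
  have f5 : s₂.nat 4 = s.nat 4 := c1 4 (by norm_num) (by norm_num)
  have f6 : s₂.nat 7 = s.nat 7 := c1 7 (by norm_num) (by norm_num)
  have f7 : s₂.nat 8 = s.nat 8 := c1 8 (by norm_num) (by norm_num)
  have f8 : s₂.nat 9 = s.nat 9 := c1 9 (by norm_num) (by norm_num)
  refine ⟨s₃, _, .seq e1 (.seq e2 e3), ?_, ?_, ?_, ?_, ?_⟩
  · have : progPushPre.time ≤ 20 := by decide
    have : progPushPost.time ≤ 60 := by decide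
    omega
  · constructor <;> simp [hs₃, progPushPost, RamProg.run, RamState.writeNat_nat,
      RamState.writeNat_real, RamState.writeReal_nat, RamState.writeReal_real, NatExpr.eval, nvar,
      ptrTop, f1, f2, f3, f4, f5, f7, c2, hs.size, hs.adj, hs.rows, hs.depth, hs.re, hs.im,
      hs.level, hs.base, Nat.succ_mul]
  · constructor
    · simp [hs₃, progPushPost, RamProg.run, RamState.writeNat_nat, RamState.writeReal_nat,
        NatExpr.eval, nvar, ptrTop, f2, f3, f6, hs.level, hf.row]
    · intro v
      have hv := v.2
      rw [d0, b2 _ (by omega), a2, Finset.mem_erase, ← hf.set v]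
      by_cases h : v = u
      · simp [h]
      · have : (v : ℕ) ≠ u := fun h' => h (Fin.ext h')
        simp [h, this]
    all_goals simp [hs₃, progPushPost, RamProg.run, RamState.writeNat_nat,
      RamState.writeNat_real, RamState.writeReal_nat, RamState.writeReal_real, NatExpr.eval, nvar,
      ptrTop, f3, f8, c2, hs.level, hf.ptr, hf.re, hf.im]
  · constructor
    · intro v
      rw [← hs.adj, ← hs.rows]
      simp [hs₃, progPushPost, RamProg.run, RamState.writeNat_nat, RamState.writeReal_nat,
        NatExpr.eval, nvar, ptrTop, f2, f3, f7, f8, hs.level, hf.ptr]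
    · intro v
      have hv := v.2
      rw [d0, Nat.succ_mul, b1 _ hv, a2, Finset.mem_erase, ← hf.set v]
      by_cases h : v = u
      · simp [h]
      · have : (v : ℕ) ≠ u := fun h' => h (Fin.ext h')
        simp [h, this]
    all_goals simp [hs₃, progPushPost, RamProg.run, RamState.writeNat_nat,
      RamState.writeNat_real, RamState.writeReal_nat, RamState.writeReal_real, NatExpr.eval,
      RealExpr.eval, nvar, f3, hs.level]
  · constructor
    · ext j
      simp [hs₃, progPushPost, RamProg.run, RamState.writeNat_nat, RamState.writeReal_nat, f2]
    · intro j hj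
      simp [hs₃, progPushPost, RamProg.run, RamState.writeNat_nat, RamState.writeReal_nat,
        NatExpr.eval, nvar, f3, f6, hs.level, show j ≠ l + 1 by omega]
    · intro j hj
      simp [hs₃, progPushPost, RamProg.run, RamState.writeNat_nat, RamState.writeReal_nat,
        NatExpr.eval, nvar, f3, f8, hs.level, show j ≠ l + 1 by omega, show j ≠ l by omega]
    · intro j hj
      rw [d0, b2 _ (by omega), a2, if_neg (by omega)]
    · intro j hj
      simp [hs₃, progPushPost, RamProg.run, RamState.writeNat_nat, RamState.writeReal_nat,
        RamState.writeNat_real, RamState.writeReal_real,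
        NatExpr.eval, nvar, f3, c2, hs.level, show j ≠ l + 1 by omega]
    · intro j hj
      simp [hs₃, progPushPost, RamProg.run, RamState.writeNat_nat, RamState.writeReal_nat,
        RamState.writeNat_real, RamState.writeReal_real,
        NatExpr.eval, nvar, f3, c2, hs.level, show j ≠ l + 1 by omega]

/-- Nonvanishing of `acc'` is not required: the machine's real division and division in `ℂ` both
return 0 for a zero denominator. The program therefore computes `truncRatio` at every activity. -/
theorem exec_pop {G : SimpleGraph (Fin n)} {z : ℂ} {J l : ℕ} {N N' : Fin n → Prop}
    {S S' : Finset (Fin n)} {p p' : ℕ} {acc acc' : ℂ} {s : RamState} (hs : StackAt G z J (l + 1) s)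
    (hf : FrameAt l N S p acc s) (hf' : FrameAt (l + 1) N' S' p' acc' s) :
    ∃ s', Exec progPop s s' progPop.time ∧ StackAt G z J l s' ∧
      FrameAt l N S p ((1 + z / acc') * acc) s' ∧ SameBelow n l s s' := by
  refine ⟨_, RamProg.Straight.exec (by simp [RamProg.Straight, progPop]) s, ?_, ?_, ?_⟩
  · constructor <;> simp [progPop, RamProg.run, RamState.writeNat_nat,
      RamState.writeNat_real, RamState.writeReal_nat, RamState.writeReal_real, NatExpr.eval, nvar,
      hs.size, hs.adj, hs.rows, hs.depth, hs.re, hs.im, hs.level, hs.base, Nat.succ_mul]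
  · constructor
    · simp [progPop, RamProg.run, RamState.writeNat_nat, RamState.writeReal_nat, hf.row]
    · simp [progPop, RamProg.run, RamState.writeNat_nat, RamState.writeReal_nat, hf.set]
    · simp [progPop, RamProg.run, RamState.writeNat_nat, RamState.writeReal_nat, hf.ptr]
    · simp [progPop, RamProg.run, RamState.writeNat_nat, RamState.writeReal_nat,
        RamState.writeNat_real, RamState.writeReal_real, NatExpr.eval, RealExpr.eval, nvar, rvar,
        rtop, hs.level, hs.re, hs.im, hf'.re, hf'.im, hf.re, hf.im, Complex.div_re, Complex.div_im,
        Complex.normSq_apply]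
      ring
    · simp [progPop, RamProg.run, RamState.writeNat_nat, RamState.writeReal_nat,
        RamState.writeNat_real, RamState.writeReal_real, NatExpr.eval, RealExpr.eval, nvar, rvar,
        rtop, hs.level, hs.re, hs.im, hf'.re, hf'.im, hf.re, hf.im, Complex.div_re, Complex.div_im,
        Complex.normSq_apply]
      ring
  · constructor
    · ext j
      simp [progPop, RamProg.run, RamState.writeNat_nat, RamState.writeReal_nat]
    all_goals
      intro j hj
      simp [progPop, RamProg.run, RamState.writeNat_nat, RamState.writeReal_nat,
        RamState.writeNat_real, RamState.writeReal_real, NatExpr.eval, nvar, hs.level,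
        hj.ne]

end Program

/-! ### Correctness and running time of the main loop. -/

section MainLoop

variable {n : ℕ}

theorem testPush_holds {G : SimpleGraph (Fin n)} {z : ℂ} {J l : ℕ} {N : Fin n → Prop}
    {S : Finset (Fin n)} {u : Fin n} {acc : ℂ} {s : RamState} (hs : StackAt G z J l s)
    (hf : FrameAt l N S u acc s) : testPush.holds s ↔ l < J ∧ N u ∧ u ∈ S := by
  simp only [testPush, RamTest.holds, NatExpr.eval, nvar, ptrTop, hs.level, hs.depth, hs.base,
    hf.ptr, hf.row, hf.set, Nat.add_one_le_iff]

theorem testMain_holds {G : SimpleGraph (Fin n)} {z : ℂ} {J l : ℕ} {N : Fin n → Prop}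
    {S : Finset (Fin n)} {p : ℕ} {acc : ℂ} {s : RamState} (hs : StackAt G z J l s)
    (hf : FrameAt l N S p acc s) : testMain.holds s ↔ ¬ (l = 0 ∧ n ≤ p) := by
  simp [testMain, RamTest.holds, NatExpr.eval, nvar, ptrTop, hs.level, hs.size, hf.ptr]

theorem reach_advance {G : SimpleGraph (Fin n)} {z : ℂ} {J l : ℕ} {N : Fin n → Prop}
    {S : Finset (Fin n)} {u : Fin n} {acc : ℂ} {s : RamState} (hs : StackAt G z J l s)
    (hf : FrameAt l N S u acc s) (h : ¬ (l < J ∧ N u ∧ u ∈ S)) :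
    ∃ s', Reach testMain progBody s s' 200 ∧ StackAt G z J l s' ∧ FrameAt l N S (u + 1) acc s' ∧
      SameBelow n l s s' := by
  obtain ⟨s', he, h1, h2, h3⟩ := exec_advance hs hf
  refine ⟨s', Reach.of_exec ((testMain_holds hs hf).2 ?_)
    (.iteFalse ?_ (.iteFalse (fun h' => h ((testPush_holds hs hf).1 h')) he)) (by decide),
    h1, h2, h3⟩
  · have := u.2; omega
  · have := u.2
    simp [RamTest.holds, NatExpr.eval, nvar, ptrTop, hs.level, hs.size, hf.ptr]

theorem reach_push {G : SimpleGraph (Fin n)} {z : ℂ} {J l : ℕ} {N : Fin n → Prop}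
    {S : Finset (Fin n)} {u : Fin n} {acc : ℂ} {s : RamState} (hs : StackAt G z J l s)
    (hf : FrameAt l N S u acc s) (h : l < J ∧ N u ∧ u ∈ S) :
    ∃ s', Reach testMain progBody s s' (31 * n + 200) ∧ StackAt G z J (l + 1) s' ∧
      FrameAt l N (S.erase u) (u + 1) acc s' ∧
      FrameAt (l + 1) (G.Adj u) (S.erase u) 0 1 s' ∧ SameBelow n l s s' := by
  obtain ⟨s', t, he, ht, h1, h2, h3, h4⟩ := exec_push hs hf
  refine ⟨s', Reach.of_exec ((testMain_holds hs hf).2 ?_)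
    (.iteFalse ?_ (.iteTrue ((testPush_holds hs hf).2 h) he)) ?_, h1, h2, h3, h4⟩
  · have := u.2; omega
  · have := u.2
    simp [RamTest.holds, NatExpr.eval, nvar, ptrTop, hs.level, hs.size, hf.ptr]
  · have : testMain.cost + ((RamTest.natLe (nvar 0) ptrTop).cost + testPush.cost) ≤ 100 := by
      decide
    omega

theorem reach_pop {G : SimpleGraph (Fin n)} {z : ℂ} {J l : ℕ} {N N' : Fin n → Prop}
    {S S' : Finset (Fin n)} {p : ℕ} {acc acc' : ℂ} {s : RamState} (hs : StackAt G z J (l + 1) s)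
    (hf : FrameAt l N S p acc s) (hf' : FrameAt (l + 1) N' S' n acc' s) :
    ∃ s', Reach testMain progBody s s' 200 ∧ StackAt G z J l s' ∧
      FrameAt l N S p ((1 + z / acc') * acc) s' ∧ SameBelow n l s s' := by
  obtain ⟨s', he, h1, h2, h3⟩ := exec_pop hs hf hf'
  refine ⟨s', Reach.of_exec ((testMain_holds hs hf').2 (by omega)) (.iteTrue ?_ he) (by decide),
    h1, h2, h3⟩
  simp [RamTest.holds, NatExpr.eval, nvar, ptrTop, hs.level, hs.size, hf'.ptr]

/-- A bound for the time that a frame with `i` levels below it needs, if it is the frame of a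
vertex in a graph of maximal degree `d`; shifted by one. -/
def frameTime (n d : ℕ) : ℕ → ℕ
  | 0 => 0
  | i + 1 => n * 200 + d * (200 * (n + 2) + frameTime n d i)

theorem drop_finRange (u : Fin n) :
    (List.finRange n).drop u = u :: (List.finRange n).drop (u + 1) := by
  rw [List.drop_eq_getElem_cons (by simp)]
  simp

theorem reach_scan_last {G : SimpleGraph (Fin n)} {z : ℂ} {J : ℕ} {N : Fin n → Prop}
    {S : Finset (Fin n)} {acc : ℂ} (q p : ℕ) (hq : p + q = n) {s : RamState}
    (hs : StackAt G z J J s) (hf : FrameAt J N S p acc s) :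
    ∃ s', Reach testMain progBody s s' (q * 200) ∧ StackAt G z J J s' ∧
      FrameAt J N S n acc s' ∧ SameBelow n J s s' := by
  induction q generalizing p s with
  | zero =>
    obtain rfl : p = n := by omega
    exact ⟨s, by simpa using Reach.refl _ _ s, hs, hf, SameBelow.refl _ _ _⟩
  | succ q ih =>
    obtain ⟨s₁, r₁, hs₁, hf₁, hb₁⟩ := reach_advance (u := ⟨p, by omega⟩) hs hf (by simp)
    obtain ⟨s₂, r₂, hs₂, hf₂, hb₂⟩ := ih (p + 1) (by omega) hs₁ hf₁
    exact ⟨s₂, r₁.trans r₂ (by omega), hs₂, hf₂, hb₁.trans hb₂⟩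

theorem prod_kids_zero {G : SimpleGraph (Fin n)} {z : ℂ} (l : List (Finset (Fin n) × Fin n))
    (L : List (Fin n)) : (l.map (fun c => 1 + truncRatio G L z 0 c)).prod = 1 := by
  simp [truncRatio]

theorem card_filter_adj_le_maxDegree (G : SimpleGraph (Fin n)) [DecidableRel G.Adj]
    (u : Fin n) (S : Finset (Fin n)) {_ : DecidablePred (G.Adj u)} :
    (S.filter (G.Adj u)).card ≤ G.maxDegree := by
  refine le_trans ?_ (G.degree_le_maxDegree u)
  unfold SimpleGraph.degree
  apply Finset.card_le_card
  intro a ha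
  simpa using (Finset.mem_filter.1 ha).2

/-- The main loop evaluates the recursion. -/
theorem reach_scan {G : SimpleGraph (Fin n)} [DecidableRel G.Adj] {z : ℂ} {J d : ℕ}
    (hd : G.maxDegree ≤ d) (i l : ℕ) (hl : l + i = J) (q p : ℕ) (hq : p + q = n)
    {N : Fin n → Prop} {S : Finset (Fin n)} {acc : ℂ} {s : RamState}
    (hs : StackAt G z J l s) (hf : FrameAt l N S p acc s) :
    ∃ s' S', Reach testMain progBody s s' (q * 200 +
        (kids N S ((List.finRange n).drop p)).length * (200 * (n + 2) + frameTime n d i)) ∧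
      StackAt G z J l s' ∧
      FrameAt l N S' n (acc * ((kids N S ((List.finRange n).drop p)).map
        (fun c => 1 + truncRatio G (List.finRange n) z i c)).prod) s' ∧ SameBelow n l s s' := by
  induction i generalizing l q p N S acc s with
  | zero =>
    obtain rfl : l = J := by omega
    obtain ⟨s', h1, h2, h3, h4⟩ := reach_scan_last q p hq hs hf
    exact ⟨s', S, h1.trans (Reach.refl _ _ _) (by omega), h2,
      by rw [prod_kids_zero, mul_one]; exact h3, h4⟩
  | succ i ihi =>
    induction q generalizing p S acc s with
    | zero =>
      obtain rfl : p = n := by omega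
      rw [List.drop_eq_nil_of_le (by simp)]
      refine ⟨s, S, ?_, hs, ?_, SameBelow.refl _ _ _⟩
      · simpa [kids] using Reach.refl _ _ s
      · simpa [kids] using hf
    | succ q ihq =>
      obtain ⟨u, rfl⟩ : ∃ u : Fin n, (u : ℕ) = p := ⟨⟨p, by omega⟩, rfl⟩
      rw [drop_finRange, kids]
      by_cases hu : N u ∧ u ∈ S
      -- Push the child, evaluate its whole subtree by the hypothesis for one level less, pop, and
      -- go on with the siblings. The parent's frame survives since nothing below the child's level
      -- changes.
      · obtain ⟨s₁, r₁, hs₁, hf₁, hf₁', hb₁⟩ := reach_push hs hf ⟨by omega, hu⟩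
        obtain ⟨s₂, S₂, r₂, hs₂, hf₂, hb₂⟩ := ihi (l + 1) (by omega) n 0 (by omega) hs₁ hf₁'
        rw [List.drop_zero, one_mul] at hf₂
        obtain ⟨s₃, r₃, hs₃, hf₃, hb₃⟩ := reach_pop hs₂ (hf₁.of_sameBelow hb₂) hf₂
        obtain ⟨s₄, S₄, r₄, hs₄, hf₄, hb₄⟩ := ihq (u + 1) (by omega) hs₃ hf₃
        rw [if_pos hu]
        refine ⟨s₄, S₄, (((r₁.trans r₂ le_rfl).trans r₃ le_rfl).trans r₄ ?_), hs₄, ?_,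
          ((hb₁.trans hb₂.of_succ).trans hb₃).trans hb₄⟩
        · have hk : (kids (G.Adj u) (S.erase u) (List.finRange n)).length ≤ d := by
            exact (length_kids_le _ _ _).trans ((card_filter_adj_le_maxDegree G u _).trans hd)
          have h1 := Nat.mul_le_mul_right (200 * (n + 2) + frameTime n d i) hk
          rw [List.drop_zero, List.length_cons, Nat.succ_mul q, Nat.succ_mul (List.length _), frameTime]
          omega
        · rw [List.map_cons, List.prod_cons, truncRatio_succ]
          convert hf₄ using 1
          ring
      · obtain ⟨s₁, r₁, hs₁, hf₁, hb₁⟩ := reach_advance hs hf (fun h => hu h.2)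
        obtain ⟨s₂, S₂, r₂, hs₂, hf₂, hb₂⟩ := ihq (u + 1) (by omega) hs₁ hf₁
        rw [if_neg hu]
        exact ⟨s₂, S₂, r₁.trans r₂ (by omega), hs₂, hf₂, hb₁.trans hb₂⟩

end MainLoop

/-! ### Preparation of the memory and computation of the truncation depth. -/

section Initialization

def progRowsBody : RamProg :=
  .seq (.setNat 8 (nvar 5) (nvar 11)) (.seq (.setNat 11 (.lit 0) (.add (nvar 11) (nvar 0)))
    (.setNat 5 (.lit 0) (.add (nvar 5) (.lit 1))))

/-- Multiples of `n` by repeated addition. The loop includes the index `n`, as the offset `n * n`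
serves for the row of the root. -/
def progRows : RamProg := .loop (.natLe (nvar 5) (nvar 0)) progRowsBody

/-- An extra row of ones is appended to the adjacency matrix. It belongs to a virtual vertex
adjacent to everything, so that the top-level product has the form of an inner node. -/
def progRootBody : RamProg :=
  .seq (.setNat 1 (.add (.get 8 (nvar 0)) (nvar 5)) (.lit 1))
    (.seq (.setNat 10 (nvar 5) (.lit 1)) (.setNat 5 (.lit 0) (.add (nvar 5) (.lit 1))))

def progRoot : RamProg :=
  .seq (.setNat 5 (.lit 0) (.lit 0)) (.loop testCopy progRootBody)

def testSqrt : RamTest :=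
  .neg (.realLe (.ofNat (.lit 1))
    (.mul (.ofNat (nvar 6)) (.mul (.ofNat (nvar 6)) (.get 0 (.lit 3)))))

def progSqrtBody : RamProg := .setNat 6 (.lit 0) (.add (nvar 6) (.lit 1))

/-- Finds the least `m ≥ 1` with `m² α ≥ 1`, a substitute for `1/√α`. -/
def progSqrt : RamProg := .seq (.setNat 6 (.lit 0) (.lit 1)) (.loop testSqrt progSqrtBody)

def testLog : RamTest :=
  .neg (.realLe (.mul (.ofNat (.lit 4)) (.ofNat (nvar 0)))
    (.mul (rvar 7) (.mul (.get 0 (.lit 2)) (.get 0 (.lit 3)))))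

def progLogBody : RamProg :=
  .seq (.setReal 7 (.lit 0) (.add (rvar 7) (rvar 7)))
    (.setNat 12 (.lit 0) (.add (nvar 12) (.lit 1)))

/-- Finds the least `k` with `4n ≤ 2^k ε α`, by repeated doubling. -/
def progLog : RamProg :=
  .seq (.setReal 7 (.lit 0) (.ofNat (.lit 1))) (.loop testLog progLogBody)

def progDepthBody : RamProg :=
  .seq (.setNat 4 (.lit 0) (.add (nvar 4) (.add (nvar 6) (nvar 6))))
    (.setNat 5 (.lit 0) (.add (nvar 5) (.lit 1)))

def progDepth : RamProg :=
  .seq (.setNat 5 (.lit 0) (.lit 0))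
    (.loop (.natLe (.add (nvar 5) (.lit 1)) (nvar 12)) progDepthBody)

def progStart : RamProg :=
  .seq (.setNat 7 (.lit 0) (.get 8 (nvar 0))) (.setReal 2 (.lit 0) (.ofNat (.lit 1)))

def progOutput : RamProg :=
  .seq (.setReal 1 (.lit 0) (rvar 2)) (.setReal 1 (.lit 1) (rvar 3))

/-- Weitz' algorithm: truncation of the tree of self-avoiding walks. -/
def weitzProg : RamProg :=
  .seq progRows (.seq progRoot (.seq progSqrt (.seq progLog (.seq progDepth
    (.seq progStart (.seq (.loop testMain progBody) progOutput))))))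

variable {n : ℕ}

theorem exec_rows {s : RamState} (hn : s.nat 0 0 = n) (h5 : s.nat 5 0 = 0)
    (h11 : s.nat 11 0 = 0) :
    ∃ s' t, Exec progRows s s' t ∧ t ≤ 40 * n + 50 ∧ (∀ j ≤ n, s'.nat 8 j = j * n) ∧
      (∀ a, a ≠ 5 → a ≠ 8 → a ≠ 11 → s'.nat a = s.nat a) ∧ s'.real = s.real := by
  obtain ⟨s', t, he, ht, -, -, h3, h4, h5⟩ := exec_loop (b := .natLe (nvar 5) (nvar 0))
    (p := progRowsBody) (T := 30) (N := n + 1)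
    (fun i s' => s'.nat 5 0 = i ∧ s'.nat 11 0 = i * n ∧ (∀ j < i, s'.nat 8 j = j * n) ∧
      (∀ a, a ≠ 5 → a ≠ 8 → a ≠ 11 → s'.nat a = s.nat a) ∧ s'.real = s.real)
    (by
      rintro i hiN s' ⟨h1, h2, h3, h4, h5⟩
      have hn' : s'.nat 0 0 = n := by rw [h4 0 (by norm_num) (by norm_num) (by norm_num), hn]
      refine ⟨?_, _, _, RamProg.Straight.exec (by simp [RamProg.Straight, progRowsBody]) s',
        (by decide : progRowsBody.time ≤ 30), ?_, ?_, ?_, ?_, ?_⟩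
      · simp only [RamTest.holds, NatExpr.eval, nvar, h1, hn']; omega
      · simp [progRowsBody, RamProg.run, RamState.writeNat_nat, NatExpr.eval, nvar, h1]
      · simp [progRowsBody, RamProg.run, RamState.writeNat_nat, NatExpr.eval, nvar, h2, hn',
          Nat.succ_mul]
      · intro j hj
        simp only [progRowsBody, RamProg.run, RamState.writeNat_nat, NatExpr.eval, nvar, h1, h2]
        rcases Nat.lt_succ_iff_lt_or_eq.1 hj with hj | rfl
        · simp [show j ≠ i by omega, h3 j hj]
        · simp
      · intro a ha ha' ha''
        ext j
        simp [progRowsBody, RamProg.run, RamState.writeNat_nat, ha, ha', ha'', h4 a ha ha' ha'']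
      · simp [progRowsBody, RamProg.run, RamState.writeNat_real, h5])
    (by
      rintro s' ⟨h1, h2, h3, h4, h5⟩
      simp [RamTest.holds, NatExpr.eval, nvar, h1, h4, hn])
    (s := s) ⟨h5, by simpa using h11, by simp, by simp, rfl⟩
  refine ⟨s', t, he, ht.trans ?_, fun j hj => h3 j (by omega), h4, h5⟩
  rw [show (RamTest.natLe (nvar 5) (nvar 0)).cost = 5 by decide]
  omega

theorem exec_root {s : RamState} (hn : s.nat 0 0 = n) (h8 : s.nat 8 n = n * n) :
    ∃ s' t, Exec progRoot s s' t ∧ t ≤ 50 * n + 50 ∧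
      (∀ j < n, s'.nat 1 (n * n + j) = 1 ∧ s'.nat 10 j = 1) ∧
      (∀ j < n * n, s'.nat 1 j = s.nat 1 j) ∧
      (∀ a, a ≠ 1 → a ≠ 5 → a ≠ 10 → s'.nat a = s.nat a) ∧ s'.real = s.real := by
  have e1 : Exec (.setNat 5 (.lit 0) (.lit 0)) s (s.writeNat 5 0 0) 3 := .setNat _ _ _ _
  obtain ⟨s', t, he, ht, h1, h2, h3, h4, h5⟩ := exec_loop (b := testCopy)
    (p := progRootBody) (T := 30) (N := n)
    (fun i s' => s'.nat 5 0 = i ∧ (∀ j < i, s'.nat 1 (n * n + j) = 1 ∧ s'.nat 10 j = 1) ∧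
      (∀ j < n * n, s'.nat 1 j = s.nat 1 j) ∧
      (∀ a, a ≠ 1 → a ≠ 5 → a ≠ 10 → s'.nat a = s.nat a) ∧ s'.real = s.real)
    (by
      rintro i hiN s' ⟨h1, h2, h3, h4, h5⟩
      have hn' : s'.nat 0 0 = n := by rw [h4 0 (by norm_num) (by norm_num) (by norm_num), hn]
      have h8' : s'.nat 8 n = n * n := by
        rw [h4 8 (by norm_num) (by norm_num) (by norm_num), h8]
      refine ⟨?_, _, _, RamProg.Straight.exec (by simp [RamProg.Straight, progRootBody]) s',
        (by decide : progRootBody.time ≤ 30), ?_, ?_, ?_, ?_, ?_⟩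
      · simp only [testCopy, RamTest.holds, NatExpr.eval, nvar, h1, hn']; omega
      · simp [progRootBody, RamProg.run, RamState.writeNat_nat, NatExpr.eval, nvar, h1]
      · intro j hj
        simp only [progRootBody, RamProg.run, RamState.writeNat_nat, NatExpr.eval, nvar, h1, hn',
          h8']
        rcases Nat.lt_succ_iff_lt_or_eq.1 hj with hj | rfl
        · simp [show j ≠ i by omega, h2 j hj]
        · simp
      · intro j hj
        simp only [progRootBody, RamProg.run, RamState.writeNat_nat, NatExpr.eval, nvar, h1, hn',
          h8']
        simp [show j ≠ n * n + i by omega, h3 j hj]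
      · intro a ha ha' ha''
        ext j
        simp [progRootBody, RamProg.run, RamState.writeNat_nat, ha, ha', ha'', h4 a ha ha' ha'']
      · simp [progRootBody, RamProg.run, RamState.writeNat_real, h5])
    (by
      rintro s' ⟨h1, h2, h3, h4, h5⟩
      simp [testCopy, RamTest.holds, NatExpr.eval, nvar, h1, h4, hn])
    (s := s.writeNat 5 0 0) ⟨by simp [RamState.writeNat_nat], by simp,
      by simp [RamState.writeNat_nat], fun a _ h _ => by ext j; simp [RamState.writeNat_nat, h],
      rfl⟩
  refine ⟨s', _, .seq e1 he, ?_, h2, h3, h4, h5⟩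
  rw [show testCopy.cost = 7 by decide] at ht
  omega

theorem exec_sqrt {s : RamState} {α : ℝ} (hα : s.real 0 3 = α) {m : ℕ} (hm : 1 ≤ m)
    (hmα : 1 ≤ (m : ℝ) ^ 2 * α) (hmin : ∀ j < m, 1 ≤ j → (j : ℝ) ^ 2 * α < 1) :
    ∃ s' t, Exec progSqrt s s' t ∧ t ≤ 50 * m + 50 ∧ s'.nat 6 0 = m ∧
      (∀ a, a ≠ 6 → s'.nat a = s.nat a) ∧ s'.real = s.real := by
  have e1 : Exec (.setNat 6 (.lit 0) (.lit 1)) s (s.writeNat 6 0 1) 3 := .setNat _ _ _ _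
  obtain ⟨s', t, he, ht, h1, h2, h3⟩ := exec_loop (b := testSqrt)
    (p := progSqrtBody) (T := 20) (N := m - 1)
    (fun i s' => s'.nat 6 0 = i + 1 ∧ (∀ a, a ≠ 6 → s'.nat a = s.nat a) ∧ s'.real = s.real)
    (by
      rintro i hiN s' ⟨h1, h2, h3⟩
      refine ⟨?_, _, _, RamProg.Straight.exec (by simp [RamProg.Straight, progSqrtBody]) s',
        (by decide : progSqrtBody.time ≤ 20), ?_, ?_, ?_⟩
      · have := hmin (i + 1) (by omega) (by omega)
        simp only [testSqrt, RamTest.holds, RealExpr.eval, NatExpr.eval, nvar, h1, h3, hα, not_le]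
        rw [← mul_assoc, ← sq]
        simpa using this
      · simp [progSqrtBody, RamProg.run, RamState.writeNat_nat, NatExpr.eval, nvar, h1]
      · intro a ha
        ext j
        simp [progSqrtBody, RamProg.run, RamState.writeNat_nat, ha, h2 a ha]
      · simp [progSqrtBody, RamProg.run, RamState.writeNat_real, h3])
    (by
      rintro s' ⟨h1, h2, h3⟩
      simp only [testSqrt, RamTest.holds, RealExpr.eval, NatExpr.eval, nvar, h1, h3, hα, not_not]
      rw [Nat.sub_add_cancel hm, ← mul_assoc, ← sq]
      simpa using hmα)
    (s := s.writeNat 6 0 1) ⟨by simp [RamState.writeNat_nat],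
      fun a h => by ext j; simp [RamState.writeNat_nat, h], rfl⟩
  refine ⟨s', _, .seq e1 he, ?_, by rw [h1]; omega, h2, h3⟩
  have : testSqrt.cost ≤ 20 := by decide
  have := Nat.mul_le_mul_left (m - 1) (show testSqrt.cost + 20 ≤ 40 by omega)
  omega

theorem exec_log {s : RamState} {ε α : ℝ} (hn : s.nat 0 0 = n) (hε : s.real 0 2 = ε)
    (hα : s.real 0 3 = α) (h12 : s.nat 12 0 = 0) {k : ℕ}
    (hk : 4 * (n : ℝ) ≤ 2 ^ k * (ε * α)) (hmin : ∀ j < k, 2 ^ j * (ε * α) < 4 * (n : ℝ)) :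
    ∃ s' t, Exec progLog s s' t ∧ t ≤ 60 * k + 50 ∧ s'.nat 12 0 = k ∧
      (∀ a, a ≠ 12 → s'.nat a = s.nat a) ∧ (∀ a, a ≠ 7 → s'.real a = s.real a) := by
  have e1 : Exec (.setReal 7 (.lit 0) (.ofNat (.lit 1))) s (s.writeReal 7 0 ((1 : ℕ) : ℝ)) 4 :=
    .setReal _ _ _ _
  obtain ⟨s', t, he, ht, h1, h2, h3, h4⟩ := exec_loop (b := testLog)
    (p := progLogBody) (T := 30) (N := k)
    (fun i s' => s'.nat 12 0 = i ∧ s'.real 7 0 = 2 ^ i ∧ (∀ a, a ≠ 12 → s'.nat a = s.nat a) ∧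
      (∀ a, a ≠ 7 → s'.real a = s.real a))
    (by
      rintro i hiN s' ⟨h1, h2, h3, h4⟩
      have hn' : s'.nat 0 0 = n := by rw [h3 0 (by norm_num), hn]
      refine ⟨?_, _, _, RamProg.Straight.exec (by simp [RamProg.Straight, progLogBody]) s',
        (by decide : progLogBody.time ≤ 30), ?_, ?_, ?_, ?_⟩
      · have := hmin i hiN
        simp only [testLog, RamTest.holds, RealExpr.eval, NatExpr.eval, nvar, rvar, hn', h2,
          h4 0 (by norm_num), hα, hε, not_le]
        simpa using this
      · simp [progLogBody, RamProg.run, RamState.writeNat_nat, RamState.writeReal_nat,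
          NatExpr.eval, nvar, h1]
      · simp [progLogBody, RamProg.run, RamState.writeNat_real, RamState.writeReal_real,
          NatExpr.eval, RealExpr.eval, rvar, h2]
        ring
      · intro a ha
        ext j
        simp [progLogBody, RamProg.run, RamState.writeNat_nat, RamState.writeReal_nat, ha, h3 a ha]
      · intro a ha
        ext j
        simp [progLogBody, RamProg.run, RamState.writeNat_real, RamState.writeReal_real, ha,
          h4 a ha])
    (by
      rintro s' ⟨h1, h2, h3, h4⟩
      have hn' : s'.nat 0 0 = n := by rw [h3 0 (by norm_num), hn]
      simp only [testLog, RamTest.holds, RealExpr.eval, NatExpr.eval, nvar, rvar, hn', h2,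
        h4 0 (by norm_num), hα, hε, not_not]
      simpa using hk)
    (s := s.writeReal 7 0 ((1 : ℕ) : ℝ)) ⟨h12, by simp [RamState.writeReal_real],
      fun a _ => rfl, fun a h => by ext j; simp [RamState.writeReal_real, h]⟩
  refine ⟨s', _, .seq e1 he, ?_, h1, h3, h4⟩
  have : testLog.cost ≤ 25 := by decide
  have := Nat.mul_le_mul_left k (show testLog.cost + 30 ≤ 55 by omega)
  omega

theorem exec_depth {s : RamState} {m k : ℕ} (h4 : s.nat 4 0 = 0) (h6 : s.nat 6 0 = m)
    (h12 : s.nat 12 0 = k) :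
    ∃ s' t, Exec progDepth s s' t ∧ t ≤ 50 * k + 50 ∧ s'.nat 4 0 = 2 * m * k ∧
      (∀ a, a ≠ 4 → a ≠ 5 → s'.nat a = s.nat a) ∧ s'.real = s.real := by
  have e1 : Exec (.setNat 5 (.lit 0) (.lit 0)) s (s.writeNat 5 0 0) 3 := .setNat _ _ _ _
  obtain ⟨s', t, he, ht, h1, h2, h3, h5⟩ := exec_loop
    (b := .natLe (.add (nvar 5) (.lit 1)) (nvar 12)) (p := progDepthBody) (T := 30) (N := k)
    (fun i s' => s'.nat 5 0 = i ∧ s'.nat 4 0 = 2 * m * i ∧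
      (∀ a, a ≠ 4 → a ≠ 5 → s'.nat a = s.nat a) ∧ s'.real = s.real)
    (by
      rintro i hiN s' ⟨h1, h2, h3, h5⟩
      have h6' : s'.nat 6 0 = m := by rw [h3 6 (by norm_num) (by norm_num), h6]
      have h12' : s'.nat 12 0 = k := by rw [h3 12 (by norm_num) (by norm_num), h12]
      refine ⟨?_, _, _, RamProg.Straight.exec (by simp [RamProg.Straight, progDepthBody]) s',
        (by decide : progDepthBody.time ≤ 30), ?_, ?_, ?_, ?_⟩
      · simp only [RamTest.holds, NatExpr.eval, nvar, h1, h12']; omega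
      · simp [progDepthBody, RamProg.run, RamState.writeNat_nat, NatExpr.eval, nvar, h1]
      · simp [progDepthBody, RamProg.run, RamState.writeNat_nat, NatExpr.eval, nvar, h2, h6']
        ring
      · intro a ha ha'
        ext j
        simp [progDepthBody, RamProg.run, RamState.writeNat_nat, ha, ha', h3 a ha ha']
      · simp [progDepthBody, RamProg.run, RamState.writeNat_real, h5])
    (by
      rintro s' ⟨h1, h2, h3, h5⟩
      simp [RamTest.holds, NatExpr.eval, nvar, h1, h3, h12])
    (s := s.writeNat 5 0 0) ⟨by simp [RamState.writeNat_nat], by simp [RamState.writeNat_nat, h4],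
      fun a _ h => by ext j; simp [RamState.writeNat_nat, h], rfl⟩
  refine ⟨s', _, .seq e1 he, ?_, h2, h3, h5⟩
  rw [show (RamTest.natLe (.add (nvar 5) (.lit 1)) (nvar 12)).cost = 7 by decide] at ht
  omega

theorem ramInput_adj (G : SimpleGraph (Fin n)) [DecidableRel G.Adj] (z : ℂ) (ε α : ℝ)
    (v u : Fin n) : 1 ≤ (ramInput G z ε α).nat 1 ((v : ℕ) * n + u) ↔ G.Adj v u := by
  have : (∃ i j : Fin n, G.Adj i j ∧ (v : ℕ) * n + u = (i : ℕ) * n + j) ↔ G.Adj v u := by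
    constructor
    · rintro ⟨i, j, h, e⟩
      have hn : 0 < n := by have := v.2; omega
      have e1 : (v : ℕ) = i := by
        have := congrArg (· / n) e
        simpa [Nat.add_comm _ (_ : ℕ), Nat.add_mul_div_right _ _ hn,
          Nat.div_eq_of_lt u.2, Nat.div_eq_of_lt j.2] using this
      have e2 : (u : ℕ) = j := by rw [e1] at e; omega
      rwa [Fin.ext e1, Fin.ext e2]
    · exact fun h => ⟨v, u, h, rfl⟩
  simp only [ramInput, one_ne_zero, false_and, if_false, true_and, this]
  by_cases h : G.Adj v u <;> simp [h]

/-- The program computes the truncated recursion. -/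
theorem exec_weitzProg (G : SimpleGraph (Fin n)) [DecidableRel G.Adj] (z : ℂ) (ε α : ℝ)
    {d m k : ℕ} (hd : G.maxDegree ≤ d) (hm : 1 ≤ m) (hmα : 1 ≤ (m : ℝ) ^ 2 * α)
    (hmmin : ∀ j < m, 1 ≤ j → (j : ℝ) ^ 2 * α < 1) (hk : 4 * (n : ℝ) ≤ 2 ^ k * (ε * α))
    (hkmin : ∀ j < k, 2 ^ j * (ε * α) < 4 * (n : ℝ)) :
    ∃ s t, Exec weitzProg (ramInput G z ε α) s t ∧
      t ≤ 150 * (n + m + k + 3) + n * 200 +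
        n * (200 * (n + 2) + frameTime n d (2 * m * k)) ∧
      ramOutput s = truncPoly G (List.finRange n) z (2 * m * k) := by
  set s₀ := ramInput G z ε α with hs₀
  obtain ⟨s₁, t₁, x₁, ht₁, a1, a2, a3⟩ := exec_rows (n := n) (s := s₀) (by simp [hs₀, ramInput])
    (by simp [hs₀, ramInput]) (by simp [hs₀, ramInput])
  obtain ⟨s₂, t₂, x₂, ht₂, b1, b2, b3, b4⟩ := exec_root (n := n) (s := s₁)
    (by rw [a2 0 (by norm_num) (by norm_num) (by norm_num)]; simp [hs₀, ramInput]) (a1 n le_rfl)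
  obtain ⟨s₃, t₃, x₃, ht₃, c1, c2, c3⟩ := exec_sqrt (s := s₂) (α := α)
    (by rw [b4, a3]; simp [hs₀, ramInput]) hm hmα hmmin
  have n2 : ∀ a, a ≠ 1 → a ≠ 5 → a ≠ 8 → a ≠ 10 → a ≠ 11 → s₂.nat a = s₀.nat a :=
    fun a h1 h5 h8 h10 h11 => (b3 a h1 h5 h10).trans (a2 a h5 h8 h11)
  have n3 : ∀ a, a ≠ 1 → a ≠ 5 → a ≠ 6 → a ≠ 8 → a ≠ 10 → a ≠ 11 → s₃.nat a = s₀.nat a :=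
    fun a h1 h5 h6 h8 h10 h11 => (c2 a h6).trans (n2 a h1 h5 h8 h10 h11)
  have r3 : s₃.real = s₀.real := c3.trans (b4.trans a3)
  obtain ⟨s₄, t₄, x₄, ht₄, d1, d2, d3⟩ := exec_log (n := n) (s := s₃) (ε := ε) (α := α)
    (by rw [n3 0] <;> simp [hs₀, ramInput]) (by rw [r3]; simp [hs₀, ramInput])
    (by rw [r3]; simp [hs₀, ramInput]) (by rw [n3 12] <;> simp [hs₀, ramInput]) hk hkmin
  obtain ⟨s₅, t₅, x₅, ht₅, f1, f2, f3⟩ := exec_depth (s := s₄) (m := m) (k := k)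
    (by rw [d2 4 (by norm_num), n3 4] <;> simp [hs₀, ramInput])
    (by rw [d2 6 (by norm_num), c1]) d1
  have n5 : ∀ a, a ≠ 1 → a ≠ 4 → a ≠ 5 → a ≠ 6 → a ≠ 8 → a ≠ 10 → a ≠ 11 → a ≠ 12 →
      s₅.nat a = s₀.nat a := fun a h1 h4 h5 h6 h8 h10 h11 h12 =>
    (f2 a h4 h5).trans ((d2 a h12).trans (n3 a h1 h5 h6 h8 h10 h11))
  have r5 : ∀ a, a ≠ 7 → s₅.real a = s₀.real a := fun a h7 => by rw [f3, d3 a h7, r3]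
  have m1 : s₅.nat 1 = s₂.nat 1 := by
    rw [f2 1 (by norm_num) (by norm_num), d2 1 (by norm_num), c2 1 (by norm_num)]
  have m10 : s₅.nat 10 = s₂.nat 10 := by
    rw [f2 10 (by norm_num) (by norm_num), d2 10 (by norm_num), c2 10 (by norm_num)]
  have m8 : s₅.nat 8 = s₁.nat 8 := by
    rw [f2 8 (by norm_num) (by norm_num), d2 8 (by norm_num), c2 8 (by norm_num),
      b3 8 (by norm_num) (by norm_num) (by norm_num)]
  have x₆ := RamProg.Straight.exec (p := progStart) (by simp [RamProg.Straight, progStart]) s₅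
  have k0 : s₅.nat 0 0 = n := by rw [n5 0] <;> simp [hs₀, ramInput]
  set s₆ := progStart.run s₅ with hs₆
  have p7 : s₆.nat 7 0 = n * n := by
    simp [hs₆, progStart, RamProg.run, RamState.writeNat_nat, RamState.writeReal_nat,
      NatExpr.eval, nvar, k0, m8, a1]
  have pn : ∀ a, a ≠ 7 → s₆.nat a = s₅.nat a := by
    intro a ha
    ext j
    simp [hs₆, progStart, RamProg.run, RamState.writeNat_nat, RamState.writeReal_nat, ha]
  have pr : ∀ a, a ≠ 2 → s₆.real a = s₅.real a := by
    intro a ha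
    ext j
    simp [hs₆, progStart, RamProg.run, RamState.writeNat_real, RamState.writeReal_real, ha]
  have p2 : s₆.real 2 0 = 1 := by
    simp [hs₆, progStart, RamProg.run, RamState.writeReal_real,
      NatExpr.eval, RealExpr.eval]
  have hstack : StackAt G z (2 * m * k) 0 s₆ := by
    refine ⟨?_, ?_, ?_, ?_, ?_, ?_, ?_, ?_⟩
    · rw [pn 0 (by norm_num), k0]
    · intro v u
      have hv := v.2
      have hu := u.2
      have hlt : (v : ℕ) * n + u < n * n := by
        have := Nat.mul_le_mul_right n (show (v : ℕ) + 1 ≤ n by omega)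
        rw [Nat.succ_mul] at this
        omega
      rw [pn 1 (by norm_num), m1, b2 _ hlt, a2 1 (by norm_num) (by norm_num) (by norm_num),
        hs₀, ramInput_adj]
    · intro u
      rw [pn 8 (by norm_num), m8, a1 _ u.2.le]
    · rw [pn 4 (by norm_num), f1]
    · rw [pr 0 (by norm_num), r5 0 (by norm_num)]; simp [hs₀, ramInput]
    · rw [pr 0 (by norm_num), r5 0 (by norm_num)]; simp [hs₀, ramInput]
    · rw [pn 2 (by norm_num), n5 2] <;> simp [hs₀, ramInput]
    · rw [pn 3 (by norm_num), n5 3] <;> simp [hs₀, ramInput]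
  have hframe : FrameAt 0 (fun _ : Fin n => True) Finset.univ 0 1 s₆ := by
    refine ⟨?_, ?_, ?_, ?_, ?_⟩
    · intro u
      rw [p7, pn 1 (by norm_num), m1, (b1 u u.2).1]
      simp
    · intro u
      rw [pn 10 (by norm_num), m10, zero_mul, zero_add, (b1 u u.2).2]
      simp
    · rw [pn 9 (by norm_num), n5 9] <;> simp [hs₀, ramInput]
    · rw [p2, Complex.one_re]
    · rw [pr 3 (by norm_num), r5 3 (by norm_num)]; simp [hs₀, ramInput]
  obtain ⟨s₇, S₇, hr, hstack', hframe', -⟩ := reach_scan hd (2 * m * k) 0 (by omega) n 0 (by omega)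
    hstack hframe
  obtain ⟨t₇, x₇, ht₇⟩ := hr s₇ _ (.loopStop (by
    rw [testMain_holds hstack' hframe']; simp))
  have x₈ := RamProg.Straight.exec (p := progOutput) (by simp [RamProg.Straight, progOutput]) s₇
  refine ⟨_, _, .seq x₁ (.seq x₂ (.seq x₃ (.seq x₄ (.seq x₅ (.seq x₆ (.seq x₇ x₈)))))), ?_, ?_⟩
  · have y1 : progStart.time ≤ 20 := by decide
    have y2 : progOutput.time ≤ 20 := by decide
    have y3 : testMain.cost ≤ 20 := by decide
    have y4 : (kids (fun _ : Fin n => True) Finset.univ ((List.finRange n).drop 0)).length ≤ n :=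
      (length_kids_univ_le _).trans (by simp)
    have y5 := Nat.mul_le_mul_right (200 * (n + 2) + frameTime n d (2 * m * k)) y4
    omega
  · rw [one_mul, List.drop_zero] at hframe'
    have e1 := hframe'.re
    have e2 := hframe'.im
    rw [truncPoly]
    apply Complex.ext
    · rw [← e1]
      simp [ramOutput, progOutput, RamProg.run, RamState.writeReal_real, NatExpr.eval,
        RealExpr.eval, rvar]
    · rw [← e2]
      simp [ramOutput, progOutput, RamProg.run, RamState.writeReal_real, NatExpr.eval,
        RealExpr.eval, rvar]

end Initialization

/-! ### The running time -/

section Time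

theorem frameTime_le {n d : ℕ} (hn : 1 ≤ n) (hd : 2 ≤ d) (i : ℕ) :
    frameTime n d i ≤ 1600 * n * d ^ i := by
  -- The added constant absorbs the inhomogeneous term of the recurrence, because `d ≥ 2`.
  suffices h : frameTime n d i + (800 * n + 800) ≤ d ^ i * (800 * n + 800) by
    nlinarith [Nat.zero_le (d ^ i)]
  induction i with
  | zero => simp [frameTime]
  | succ i ih =>
    rw [frameTime, pow_succ']
    have := Nat.mul_le_mul_left d ih
    nlinarith

theorem exists_parameters {n : ℕ} {ε α : ℝ} (hε : 0 < ε) (hα : 0 < α) :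
    ∃ m k : ℕ, 1 ≤ m ∧ 1 ≤ (m : ℝ) ^ 2 * α ∧ (∀ j < m, 1 ≤ j → (j : ℝ) ^ 2 * α < 1) ∧
      4 * (n : ℝ) ≤ 2 ^ k * (ε * α) ∧ ∀ j < k, 2 ^ j * (ε * α) < 4 * (n : ℝ) := by
  classical
  have h1 : ∃ m : ℕ, 1 ≤ (m : ℝ) ^ 2 * α := by
    obtain ⟨m, hm⟩ := exists_nat_gt (1 / α)
    have h0 : 0 < 1 / α := by positivity
    have h1 : (1 : ℝ) ≤ m := by
      have : 0 < m := by exact_mod_cast h0.trans hm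
      exact_mod_cast this
    rw [div_lt_iff₀ hα] at hm
    exact ⟨m, by nlinarith⟩
  have h2 : ∃ k : ℕ, 4 * (n : ℝ) ≤ 2 ^ k * (ε * α) := by
    have h0 : 0 < ε * α := by positivity
    obtain ⟨k, hk⟩ := pow_unbounded_of_one_lt (4 * (n : ℝ) / (ε * α)) (one_lt_two)
    rw [div_lt_iff₀ h0] at hk
    exact ⟨k, hk.le⟩
  refine ⟨Nat.find h1, Nat.find h2, ?_, Nat.find_spec h1, fun j hj _ => ?_, Nat.find_spec h2,
    fun j hj => ?_⟩
  · rw [Nat.one_le_iff_ne_zero]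
    intro h
    have := Nat.find_spec h1
    rw [h] at this
    norm_num at this
  · exact not_le.1 (Nat.find_min h1 hj)
  · exact not_le.1 (Nat.find_min h2 hj)

/-- The size of the tree of self-avoiding walks down to the level that the algorithm explores. -/
theorem pow_depth_le {n d m k : ℕ} {ε α : ℝ} (hn : 1 ≤ n) (hd : 2 ≤ d) (hε : 0 < ε) (hε1 : ε ≤ 1)
    (hα : 0 < α) (hα1 : α ≤ 1) (hmmin : ∀ j < m, 1 ≤ j → (j : ℝ) ^ 2 * α < 1)
    (hkmin : ∀ j < k, 2 ^ j * (ε * α) < 4 * (n : ℝ)) :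
    (d : ℝ) ^ (2 * m * k) ≤
      Real.exp (Real.log d / √α * (12 + 8 * Real.log ((n : ℝ) / (ε * α)))) := by
  have hn' : (1 : ℝ) ≤ n := by exact_mod_cast hn
  have hd' : (2 : ℝ) ≤ d := by exact_mod_cast hd
  have hεα : 0 < ε * α := by positivity
  set X : ℝ := n / (ε * α) with hX
  have hX1 : 1 ≤ X := by
    rw [hX, le_div_iff₀ hεα]
    have := mul_le_one₀ hε1 hα.le hα1
    linarith
  have hsq : 0 < √α := Real.sqrt_pos.2 hα
  have hsq1 : √α ≤ 1 := Real.sqrt_le_one.2 hα1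
  -- Minimality gives `(m - 1) √α < 1`, hence `m ≤ 1 + 1/√α ≤ 2/√α`; for `m ≤ 1` the bound is
  -- immediate.
  have hm : (m : ℝ) ≤ 2 / √α := by
    rw [le_div_iff₀ hsq]
    rcases Nat.lt_or_ge m 2 with h | h
    · have : (m : ℝ) ≤ 1 := by exact_mod_cast Nat.lt_succ_iff.1 h
      nlinarith
    · have h1 := hmmin (m - 1) (by omega) (by omega)
      rw [Nat.cast_sub (by omega), Nat.cast_one] at h1
      have h2 : (((m : ℝ) - 1) * √α) ^ 2 < 1 ^ 2 := by
        rw [mul_pow, Real.sq_sqrt hα.le]; simpa using h1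
      have h3 := lt_of_pow_lt_pow_left₀ 2 (by norm_num) h2
      nlinarith
  have hlog2 : (1 / 2 : ℝ) < Real.log 2 := by linarith [Real.log_two_gt_d9]
  have hlogX : 0 ≤ Real.log X := Real.log_nonneg hX1
  have hk : (k : ℝ) ≤ 3 + 2 * Real.log X := by
    rcases Nat.eq_zero_or_pos k with rfl | h
    · simp; linarith
    · have h1 := hkmin (k - 1) (by omega)
      have h2 : (2 : ℝ) ^ (k - 1) < 2 ^ 2 * X := by
        rw [hX, mul_div_assoc', lt_div_iff₀ hεα]; linarith
      have h3 := Real.log_lt_log (by positivity) h2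
      rw [Real.log_mul (by norm_num) (by positivity), Real.log_pow, Real.log_pow,
        Nat.cast_sub h] at h3
      push_cast at h3
      by_contra hcon
      push Not at hcon
      nlinarith
  have hlogd : 0 ≤ Real.log d := Real.log_nonneg (by linarith)
  rw [← Real.exp_log (show (0 : ℝ) < (d : ℝ) ^ (2 * m * k) by positivity), Real.log_pow]
  apply Real.exp_le_exp.2
  push_cast
  calc 2 * (m : ℝ) * k * Real.log d ≤ 2 * (2 / √α) * (3 + 2 * Real.log X) * Real.log d := by
        gcongr
    _ = _ := by ring

theorem time_le {n m k d t : ℕ} (hn : 1 ≤ n) (hm : 1 ≤ m) (hk : 1 ≤ k) (hd : 2 ≤ d)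
    (ht : t ≤ 150 * (n + m + k + 3) + n * 200 +
      n * (200 * (n + 2) + frameTime n d (2 * m * k))) :
    (t : ℝ) ≤ 4000 * (n : ℝ) ^ 2 * (d : ℝ) ^ (2 * m * k) := by
  have h1 := frameTime_le hn hd (2 * m * k)
  have h2 : 2 * m * k < d ^ (2 * m * k) := Nat.lt_pow_self (by omega)
  have h3 : m ≤ 2 * m * k := by nlinarith
  have h4 : k ≤ 2 * m * k := by nlinarith
  set W := d ^ (2 * m * k) with hW
  have hn2 : n ≤ n ^ 2 := by nlinarith
  have h5 : n * frameTime n d (2 * m * k) ≤ 1600 * n ^ 2 * W := by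
    refine (Nat.mul_le_mul_left n h1).trans (le_of_eq ?_)
    ring
  have h6 : n ^ 2 ≤ n ^ 2 * W := Nat.le_mul_of_pos_right _ (by omega)
  have h7 : W ≤ n ^ 2 * W := Nat.le_mul_of_pos_left _ (by positivity)
  have h8 : t ≤ 4000 * n ^ 2 * W := by
    have : n * (200 * (n + 2) + frameTime n d (2 * m * k)) =
        200 * n ^ 2 + 400 * n + n * frameTime n d (2 * m * k) := by ring
    rw [this] at ht
    have e : 4000 * n ^ 2 * W = 4000 * (n ^ 2 * W) := by ring
    have e' : 1600 * n ^ 2 * W = 1600 * (n ^ 2 * W) := by ring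
    omega
  calc (t : ℝ) ≤ ((4000 * n ^ 2 * W : ℕ) : ℝ) := by exact_mod_cast h8
    _ = _ := by rw [hW]; push_cast; ring

theorem exists_exec_weitzProg : ∃ C : ℝ, 0 < C ∧
    ∀ (n d : ℕ) (G : SimpleGraph (Fin n)) [DecidableRel G.Adj] (z : ℂ) (ε α : ℝ),
      1 ≤ n → 2 ≤ d → G.maxDegree ≤ d → 0 < ε → ε ≤ 1 → 0 < α → α ≤ 1 →
      ∃ m k : ℕ, 1 ≤ m ∧ 1 ≤ (m : ℝ) ^ 2 * α ∧ 4 * (n : ℝ) ≤ 2 ^ k * (ε * α) ∧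
        ∃ s t, Exec weitzProg (ramInput G z ε α) s t ∧
          (t : ℝ) ≤ C * ((n : ℝ) / (ε * α)) ^ (C * (Real.log d / √α)) ∧
          ramOutput s = truncPoly G (List.finRange n) z (2 * m * k) := by
  -- The factor 4000 comes from `time_le`, and `exp 40` from the degenerate case `X < 2` below. The
  -- exponent needs only `36 = 32 + 4`, for the size of the tree and for `n²`.
  refine ⟨4000 * Real.exp 40, by positivity, ?_⟩
  intro n d G _ z ε α hn hd hG hε hε1 hα hα1
  obtain ⟨m, k, hm, hmα, hmmin, hk, hkmin⟩ := exists_parameters (n := n) hε hα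
  refine ⟨m, k, hm, hmα, hk, ?_⟩
  have hn' : (1 : ℝ) ≤ n := by exact_mod_cast hn
  have hd' : (2 : ℝ) ≤ d := by exact_mod_cast hd
  have hεα : 0 < ε * α := by positivity
  have hεα1 : ε * α ≤ 1 := mul_le_one₀ hε1 hα.le hα1
  have hk1 : 1 ≤ k := by
    rcases Nat.eq_zero_or_pos k with rfl | h
    · rw [pow_zero, one_mul] at hk; linarith
    · exact h
  set X : ℝ := n / (ε * α) with hX
  have hnX : (n : ℝ) ≤ X := by rw [hX]; exact le_div_self (by linarith) hεα hεα1
  have hX1 : 1 ≤ X := hn'.trans hnX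
  have hX0 : 0 < X := by linarith
  have hsq : 0 < √α := Real.sqrt_pos.2 hα
  have hsq1 : √α ≤ 1 := Real.sqrt_le_one.2 hα1
  have hlog2 : (1 / 2 : ℝ) < Real.log 2 := by linarith [Real.log_two_gt_d9]
  have hlog2' : Real.log 2 < 1 := by linarith [Real.log_two_lt_d9]
  have hE : 1 / 2 ≤ Real.log d / √α := by
    rw [le_div_iff₀ hsq]
    have := Real.log_le_log (by norm_num) hd'
    nlinarith
  have hC : (4000 : ℝ) ≤ 4000 * Real.exp 40 := by
    have := Real.one_le_exp (show (0 : ℝ) ≤ 40 by norm_num)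
    linarith
  rcases le_or_gt 2 X with hX2 | hX2
  · obtain ⟨s, t, hexec, ht, hout⟩ := exec_weitzProg G z ε α hG hm hmα hmmin hk hkmin
    refine ⟨s, t, hexec, ?_, hout⟩
    set E := Real.log d / √α
    have h1 := pow_depth_le hn hd hε hε1 hα hα1 hmmin hkmin
    have hlX : 1 / 2 ≤ Real.log X := hlog2.le.trans (Real.log_le_log (by norm_num) hX2)
    have h2 : (d : ℝ) ^ (2 * m * k) ≤ X ^ (32 * E) := by
      refine h1.trans ?_
      rw [Real.rpow_def_of_pos hX0]
      apply Real.exp_le_exp.2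
      nlinarith
    have h3 : (n : ℝ) ^ 2 ≤ X ^ (4 * E) := by
      calc (n : ℝ) ^ 2 ≤ X ^ 2 := by gcongr
        _ = X ^ (2 : ℝ) := by norm_cast
        _ ≤ X ^ (4 * E) := Real.rpow_le_rpow_of_exponent_le hX1 (by linarith)
    calc (t : ℝ) ≤ 4000 * (n : ℝ) ^ 2 * (d : ℝ) ^ (2 * m * k) := time_le hn hm hk1 hd ht
      _ ≤ 4000 * X ^ (4 * E) * X ^ (32 * E) := by gcongr
      _ = 4000 * X ^ (36 * E) := by
        rw [mul_assoc, ← Real.rpow_add hX0]; ring_nf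
      _ ≤ 4000 * Real.exp 40 * X ^ (4000 * Real.exp 40 * E) := by
        gcongr
        linarith
  -- For `X` near 1 a power of `X` dominates nothing. But then `n = 1` and `α > 1/2`, and the time
  -- is bounded by an absolute constant once `d` is replaced by the valid degree bound 2.
  · have hn1 : n = 1 := by
      have : (n : ℝ) < 2 := by linarith
      have : n < 2 := by exact_mod_cast this
      omega
    have hG2 : G.maxDegree ≤ 2 := by
      subst hn1
      have : G.maxDegree < Fintype.card (Fin 1) := G.maxDegree_lt_card_verts
      rw [Fintype.card_fin] at this
      omega
    obtain ⟨s, t, hexec, ht, hout⟩ := exec_weitzProg G z ε α hG2 hm hmα hmmin hk hkmin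
    refine ⟨s, t, hexec, ?_, hout⟩
    have h1 := pow_depth_le hn le_rfl hε hε1 hα hα1 hmmin hkmin
    have hα2 : 1 / 2 < α := by
      rw [hX, div_lt_iff₀ hεα] at hX2
      nlinarith
    have hs2 : 1 / 2 ≤ √α := by
      apply Real.le_sqrt_of_sq_le
      linarith
    have hE2 : Real.log (2 : ℕ) / √α ≤ 2 := by
      rw [div_le_iff₀ hsq]
      push_cast
      linarith
    have hE0 : 0 ≤ Real.log (2 : ℕ) / √α := by
      push_cast
      exact div_nonneg (by linarith) hsq.le
    have hlX : Real.log X ≤ 1 := (Real.log_le_log hX0 hX2.le).trans hlog2'.le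
    have hlX0 : 0 ≤ Real.log X := Real.log_nonneg hX1
    have h2 : ((2 : ℕ) : ℝ) ^ (2 * m * k) ≤ Real.exp 40 := by
      refine h1.trans (Real.exp_le_exp.2 ?_)
      calc _ ≤ (2 : ℝ) * (12 + 8 * 1) := by gcongr
        _ = 40 := by norm_num
    calc (t : ℝ) ≤ 4000 * (n : ℝ) ^ 2 * ((2 : ℕ) : ℝ) ^ (2 * m * k) := time_le hn hm hk1 le_rfl ht
      _ ≤ 4000 * Real.exp 40 * 1 := by
        rw [hn1, Nat.cast_one, one_pow, mul_one, mul_one]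
        gcongr
      _ ≤ 4000 * Real.exp 40 * X ^ (4000 * Real.exp 40 * (Real.log d / √α)) := by
        gcongr
        exact Real.one_le_rpow hX1 (by positivity)

theorem exists_slack {d : ℕ} {x : ℝ} (hx : -lambdaC' d < x) (hx0 : x ≤ 0) :
    ∃ α : ℝ, 0 < α ∧ α ≤ 1 ∧ (1 + α) * -x ≤ lambdaC' d := by
  rcases hx0.eq_or_lt with rfl | h
  · exact ⟨1, one_pos, le_rfl, by linarith⟩
  · refine ⟨min 1 (lambdaC' d / -x - 1), lt_min one_pos ?_, min_le_left _ _, ?_⟩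
    · rw [sub_pos, one_lt_div (by linarith)]; linarith
    · have h1 := min_le_right 1 (lambdaC' d / -x - 1)
      have h2 : (1 + min 1 (lambdaC' d / -x - 1)) * -x ≤ lambdaC' d / -x * -x :=
        mul_le_mul_of_nonneg_right (by linarith) (by linarith)
      rwa [div_mul_cancel₀ _ (by linarith)] at h2

end Time

theorem mainTheorem2 :
    ∃ (P : RamProg) (C : ℝ), 0 < C ∧
      (∀ (n d : ℕ) (G : SimpleGraph (Fin n)) [DecidableRel G.Adj] (z : ℂ) (ε α : ℝ),
        1 ≤ n → 2 ≤ d → G.maxDegree ≤ d → 0 < ε → ε ≤ 1 → 0 < α → α ≤ 1 →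
        (1 + α) * ‖z‖ ≤ lambdaG G →
        ApproximatesWithin P G z ε α
          (C * ((n : ℝ) / (ε * α)) ^ (C * (Real.log d / Real.sqrt α)))) ∧
      (∀ (d : ℕ) (x : ℝ), 2 ≤ d → -lambdaC' d < x → ENNReal.ofReal x < lambdaC d →
        ∃ α : ℝ, 0 < α ∧ α ≤ 1 ∧
          ∀ (n : ℕ) (G : SimpleGraph (Fin n)) [DecidableRel G.Adj] (ε : ℝ),
            1 ≤ n → G.maxDegree ≤ d → 0 < ε → ε ≤ 1 →
            ApproximatesWithin P G (x : ℂ) ε α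
              (C * ((n : ℝ) / (ε * α)) ^ (C * (Real.log d / Real.sqrt α)))) := by
  obtain ⟨C, hC, hexec⟩ := exists_exec_weitzProg
  have part1 : ∀ (n d : ℕ) (G : SimpleGraph (Fin n)) [DecidableRel G.Adj] (z : ℂ) (ε α : ℝ),
        1 ≤ n → 2 ≤ d → G.maxDegree ≤ d → 0 < ε → ε ≤ 1 → 0 < α → α ≤ 1 →
        (1 + α) * ‖z‖ ≤ lambdaG G →
        ApproximatesWithin weitzProg G z ε α
          (C * ((n : ℝ) / (ε * α)) ^ (C * (Real.log d / Real.sqrt α))) := by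
    intro n d G _ z ε α hn hd hG hε hε1 hα hα1 hz
    obtain ⟨m, k, hm, hmα, hk, s, t, he, ht, hout⟩ := hexec n d G z ε α hn hd hG hε hε1 hα hα1
    have : Nonempty (Fin n) := ⟨⟨0, hn⟩⟩
    refine ⟨s, t, he, ht, ?_⟩
    rw [hout]
    exact isApprox_truncPoly_of_disc G List.mem_finRange hε1 hα hz hm hmα (by simpa using hk)
  refine ⟨weitzProg, C, hC, part1, ?_⟩
  intro d x hd hx hx'
  obtain ⟨D, rfl⟩ : ∃ D, d = D + 1 := ⟨d - 1, by omega⟩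
  -- Nonpositive activities lie in the disc, as `λ'_c(d) ≤ λ_G`. Positive ones may exceed `λ_G`, so
  -- the accuracy comes from the contraction instead; the time bound holds at any activity.
  rcases le_or_gt x 0 with h0 | h0
  · obtain ⟨α, hα, hα1, hαx⟩ := exists_slack hx h0
    refine ⟨α, hα, hα1, fun n G _ ε hn hG hε hε1 => ?_⟩
    have : Nonempty (Fin n) := ⟨⟨0, hn⟩⟩
    refine part1 n (D + 1) G x ε α hn hd hG hε hε1 hα hα1 ?_
    rw [Complex.norm_real, Real.norm_of_nonpos h0]
    exact hαx.trans (lambdaC'_le_lambdaG G (by omega) fun v =>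
      (card_filter_adj_le_maxDegree G v _).trans hG)
  · obtain ⟨Λ, hxΛ, hΛ⟩ := exists_threshold hd h0 hx'
    rw [Nat.add_sub_cancel] at hΛ
    obtain ⟨α, hα, hα1, happ⟩ := exists_isApprox_truncPoly_of_pos (by omega) h0 hxΛ hΛ
    refine ⟨α, hα, hα1, fun n G _ ε hn hG hε hε1 => ?_⟩
    obtain ⟨m, k, hm, hmα, hk, s, t, he, ht, hout⟩ :=
      hexec n (D + 1) G x ε α hn hd hG hε hε1 hα hα1
    refine ⟨s, t, he, ht, ?_⟩
    rw [hout]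
    exact happ n G (List.finRange n) List.mem_finRange
      (fun v => (card_filter_adj_le_maxDegree G v _).trans hG) hn ε m k hε hε1 hmα hk
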